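/- Let $N\ge 0$ be an integer, let $M\ge 0$ with $2M\in\mathbb Z$, and let $a,b,b'$ be real numbers. Let $\mathcal S$ be the complex vector space with basis $|s_1,\dots,s_N\rangle$, $s_i\in\{-M,-M+1,\dots,M\}$. Let $S_{ij}$ exchange $s_i$ and $s_j$, let $S_i$ replace $s_i$ by $-s_i$, and put $\tilde S_{ij}=S_iS_jS_{ij}$. On smooth $\mathcal S$-valued functions on the open set $U\subset\mathbb R^N$ where all $x_i\neq0$ and $x_i\ne\pm x_j$ for $i\neq j$, consider the hyperbolic $B_N$ Sutherland spin Hamiltonian $$H^*=-\sum_i\partial_{x_i}^2+2a\sum_{i<j}\Big[\frac{a+S_{ij}}{\sinh^{2}(x_i-x_j)}+\frac{a+\tilde S_{ij}}{\sinh^{2}(x_i+x_j)}\Big]+b\sum_i\frac{b+S_i}{\sinh^{2}x_i}-b'\sum_i\frac{b'+S_i}{\cosh^{2}x_i}.$$ Let $\mu(x)=\prod_{i<j}|\sinh(x_i-x_j)\sinh(x_i+x_j)|^a\prod_i|\sinh x_i|^b|\cosh x_i|^{b'}$, let $\mathcal R_m$ be the complex span of the functions $\mu(x)\exp(2\sum_i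 n_ix_i)$ with $n_i\in\{-m,\dots,m\}$, let $\Lambda$ be the projection onto the functions antisymmetric under every simultaneous exchange $\Pi_{ij}$ of the coordinates and spins $i,j$ and every simultaneous sign reversal $\Pi_i$ of $x_i$ and $s_i$, that is, $$\Lambda=2^{-N}\prod_i(1-\Pi_i)\cdot\frac1{N!}\sum_{\sigma}\operatorname{sgn}(\sigma)P_\sigma,$$ where $P_\sigma$ permutes coordinates and spins simultaneously, and let $\mathcal M_m=\Lambda(\mathcal R_m\otimes\mathcal S)$. Assume that there is an integer $m\ge0$ with $\frac12(b+b')+a(N-1)+m<0$, and let $m_1$ be the largest such $m$. Put $m_0=\big\lceil (N-\lceil M\rceil)/(2M+1)\big\rceil$. Theorem. Suppose $m_0\le m_1$. Then $H^*$ maps $\mathcal M_{m_1}$ into itself, and the algebraic energies of $H^*$, i.e. the eigenvalues of its restriction to $\mathcal M_{m_1}$, are exactly the numbers $$E_n^*=-\sum_{i=1}^N\lambda_{n,i}^2,$$ where $n=(n_1,\dots,n_N)$ runs over the integer multi-indices with $m_1\ge n_1\ge\dots\ge n_N\ge0$ that satisfy $\#(n_i)\le 2M+1$ if $n_i>0$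 and $\#(n_i)\le\lceil M\rceil$ if $n_i=0$, and where $$\lambda_{n,i}=\begin{cases}2n_i+b+b'+2a\big(N+i+1-\#(n_i)-2\ell(n_i)\big),& n_i>0,\\ -b-b'+2a(i-N),& n_i=0,\end{cases}$$ with $\#(k)=\operatorname{card}\{i: n_i=k\}$ and $\ell(k)=\min\{i:n_i=k\}$. Counted with algebraic multiplicity, the eigenvalues are the numbers $E_n^*$ indexed by the pairs $(n,s)$ in which $n$ is as above and $s\in\{-M,\dots,M\}^N$ satisfies $s_i>s_j$ whenever $n_i=n_j$ and $i<j$, and $s_i>0$ whenever $n_i=0$; that is, the characteristic polynomial of $H^*|_{\mathcal M_{m_1}}$ is $\prod_{(n,s)}(X-E_n^*)$. -/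

import Mathlib

open scoped ContDiff

noncomputable section

namespace SutherlandBN

/-! ### Spin space -/

/-- The spin quantum number `M = d / 2`. The parameter `d : ℕ` is `2 M` throughout. -/
def spinM (d : ℕ) : ℚ := (d : ℚ) / 2

/-- Labels of the basis kets `|s₁, …, s_N⟩`. The element `k : Fin (d + 1)` stands for the spin
value `k - M`, one of `-M, -M + 1, …, M`; see `spinValue`. -/
abbrev Spins (N d : ℕ) : Type := Fin N → Fin (d + 1)

/-- The numerical value `k - M ∈ {-M, …, M}` of the spin labelled by `k`. -/
def spinValue (d : ℕ) (k : Fin (d + 1)) : ℚ := (k : ℚ) - spinM d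

/-- The `(2 M + 1) ^ N`-dimensional spin space; `v s` is the coefficient of `v` along `|s⟩`. -/
abbrev SpinSpace (N d : ℕ) : Type := Spins N d → ℂ

/-- Reverse the signs of the spins `s_i` with `i ∈ T`. (`Fin.rev k` is the label of the spin value
opposite to that of `k`.) -/
def flipSpins {N d : ℕ} (T : Finset (Fin N)) (s : Spins N d) : Spins N d :=
  fun i => if i ∈ T then Fin.rev (s i) else s i

/-- Reverse the signs of the coordinates `x_i` with `i ∈ T`. -/
def flipCoords {N : ℕ} (T : Finset (Fin N)) (x : Fin N → ℝ) : Fin N → ℝ :=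
  fun i => if i ∈ T then -x i else x i

/-- Permutation of the spins: `(spinPerm σ v) s = v (s ∘ σ)`. -/
def spinPerm (N d : ℕ) (σ : Equiv.Perm (Fin N)) : Module.End ℂ (SpinSpace N d) :=
  LinearMap.funLeft ℂ ℂ (fun s : Spins N d => s ∘ σ)

/-- Reversal of the spins with index in `T`: `(spinSign T v) s = v (flipSpins T s)`. -/
def spinSign (N d : ℕ) (T : Finset (Fin N)) : Module.End ℂ (SpinSpace N d) :=
  LinearMap.funLeft ℂ ℂ (flipSpins T)

/-- `S_{ij}`, which exchanges `s_i` and `s_j`. -/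
def spinExchange (N d : ℕ) (i j : Fin N) : Module.End ℂ (SpinSpace N d) :=
  spinPerm N d (Equiv.swap i j)

/-- `S_i`, which sends `|…, s_i, …⟩` to `|…, -s_i, …⟩`. -/
def spinReverse (N d : ℕ) (i : Fin N) : Module.End ℂ (SpinSpace N d) :=
  spinSign N d {i}

/-- `S̃_{ij} = S_i S_j S_{ij}`. -/
def spinExchangeTilde (N d : ℕ) (i j : Fin N) : Module.End ℂ (SpinSpace N d) :=
  spinReverse N d i * spinReverse N d j * spinExchange N d i j

/-! ### Smooth functions off the singular hyperplanes -/

/-- The complement in `ℝ ^ N` of the hyperplanes `x_i = 0` and `x_i = ± x_j`. -/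
def regular (N : ℕ) : Set (Fin N → ℝ) :=
  {x | (∀ i, x i ≠ 0) ∧ ∀ i j, i ≠ j → x i ≠ x j ∧ x i ≠ -x j}

theorem isOpen_regular (N : ℕ) : IsOpen (regular N) := by
  have h : regular N = (⋂ i, {x : Fin N → ℝ | x i ≠ 0}) ∩
      ⋂ i, ⋂ j, ⋂ (_ : i ≠ j), ({x : Fin N → ℝ | x i ≠ x j} ∩ {x | x i ≠ -x j}) := by
    ext x
    simp [regular]
  rw [h]
  refine IsOpen.inter (isOpen_iInter_of_finite fun i => ?_)
    (isOpen_iInter_of_finite fun i => isOpen_iInter_of_finite fun j =>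
      isOpen_iInter_of_finite fun _ => IsOpen.inter ?_ ?_)
  · exact isOpen_ne_fun (by fun_prop) (by fun_prop)
  · exact isOpen_ne_fun (by fun_prop) (by fun_prop)
  · exact isOpen_ne_fun (by fun_prop) (by fun_prop)

theorem perm_mem_regular {N : ℕ} {x : Fin N → ℝ} (hx : x ∈ regular N)
    (σ : Equiv.Perm (Fin N)) : x ∘ σ ∈ regular N :=
  ⟨fun i => hx.1 (σ i), fun i j hij => hx.2 (σ i) (σ j) (fun h => hij (σ.injective h))⟩

theorem flip_mem_regular {N : ℕ} {x : Fin N → ℝ} (hx : x ∈ regular N)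
    (T : Finset (Fin N)) : flipCoords T x ∈ regular N := by
  refine ⟨fun i => ?_, fun i j hij => ?_⟩
  · have := hx.1 i
    unfold flipCoords
    split_ifs <;> simpa using this
  · obtain ⟨h1, h2⟩ := hx.2 i j hij
    unfold flipCoords
    split_ifs
    · exact ⟨fun h => h1 (by linarith), fun h => h2 (by linarith)⟩
    · exact ⟨fun h => h2 (by linarith), fun h => h1 (by linarith)⟩
    · exact ⟨fun h => h2 (by linarith), fun h => h1 (by linarith)⟩
    · exact ⟨h1, h2⟩

theorem flip_flip {N : ℕ} (T : Finset (Fin N)) (x : Fin N → ℝ) :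
    flipCoords T (flipCoords T x) = x := by
  funext i
  unfold flipCoords
  split_ifs <;> simp

theorem weyl_mem_regular_iff {N : ℕ} (T : Finset (Fin N)) (σ : Equiv.Perm (Fin N))
    (x : Fin N → ℝ) : flipCoords T x ∘ σ ∈ regular N ↔ x ∈ regular N := by
  refine ⟨fun h => ?_, fun h => perm_mem_regular (flip_mem_regular h T) σ⟩
  have h1 := flip_mem_regular (perm_mem_regular h σ⁻¹) T
  have h2 : (flipCoords T x ∘ σ) ∘ (σ⁻¹ : Equiv.Perm (Fin N)) = flipCoords T x := by
    funext i
    simp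
  rwa [h2, flip_flip] at h1

/-- The space `C^∞(regular N, F)`. A function on `regular N` is represented by its extension by
zero to `ℝ ^ N`, so that equality of elements is equality on `regular N`. -/
def smoothFun (N : ℕ) (F : Type*) [NormedAddCommGroup F] [NormedSpace ℂ F] [NormedSpace ℝ F]
    [SMulCommClass ℝ ℂ F] : Submodule ℂ ((Fin N → ℝ) → F) where
  carrier := {ψ | ContDiffOn ℝ ∞ ψ (regular N) ∧ ∀ x, x ∉ regular N → ψ x = 0}
  add_mem' := fun {f g} hf hg => ⟨hf.1.add hg.1, fun x hx => by simp [hf.2 x hx, hg.2 x hx]⟩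
  zero_mem' := ⟨contDiffOn_const, fun _ _ => rfl⟩
  smul_mem' := fun c f hf => ⟨hf.1.const_smul c, fun x hx => by simp [hf.2 x hx]⟩

/-- `C^∞(regular N, F)` as a type. -/
def SmoothFun (N : ℕ) (F : Type*) [NormedAddCommGroup F] [NormedSpace ℂ F] [NormedSpace ℝ F]
    [SMulCommClass ℝ ℂ F] : Type _ := ↥(smoothFun N F)

instance (N : ℕ) (F : Type*) [NormedAddCommGroup F] [NormedSpace ℂ F] [NormedSpace ℝ F]
    [SMulCommClass ℝ ℂ F] : AddCommGroup (SmoothFun N F) :=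
  inferInstanceAs (AddCommGroup ↥(smoothFun N F))

instance (N : ℕ) (F : Type*) [NormedAddCommGroup F] [NormedSpace ℂ F] [NormedSpace ℝ F]
    [SMulCommClass ℝ ℂ F] : Module ℂ (SmoothFun N F) :=
  inferInstanceAs (Module ℂ ↥(smoothFun N F))

section

variable {N : ℕ} {F : Type*} [NormedAddCommGroup F] [NormedSpace ℂ F] [NormedSpace ℝ F]
  [SMulCommClass ℝ ℂ F]

/-- Build an element of `C^∞(regular N, F)` from a function on `ℝ ^ N`. -/
def SmoothFun.mk (f : (Fin N → ℝ) → F) (h : ContDiffOn ℝ ∞ f (regular N))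
    (h0 : ∀ x, x ∉ regular N → f x = 0) : SmoothFun N F := ⟨f, h, h0⟩

@[simp] theorem SmoothFun.mk_val (f : (Fin N → ℝ) → F) (h : ContDiffOn ℝ ∞ f (regular N))
    (h0 : ∀ x, x ∉ regular N → f x = 0) : (SmoothFun.mk f h h0).1 = f := rfl

theorem SmoothFun.ext {ψ φ : SmoothFun N F} (h : ∀ x, ψ.1 x = φ.1 x) : ψ = φ :=
  Subtype.ext (funext h)

@[simp] theorem SmoothFun.add_val (ψ φ : SmoothFun N F) (x : Fin N → ℝ) :
    (ψ + φ).1 x = ψ.1 x + φ.1 x := rfl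

@[simp] theorem SmoothFun.smul_val (c : ℂ) (ψ : SmoothFun N F) (x : Fin N → ℝ) :
    (c • ψ).1 x = c • ψ.1 x := rfl

end

/-- Wave functions with values in the spin space. -/
abbrev WaveFun (N d : ℕ) : Type := SmoothFun N (SpinSpace N d)

theorem differentiableAt_of_mem {N : ℕ} {F : Type*} [NormedAddCommGroup F] [NormedSpace ℂ F]
    [NormedSpace ℝ F] [SMulCommClass ℝ ℂ F] (ψ : SmoothFun N F) {x : Fin N → ℝ}
    (hx : x ∈ regular N) : DifferentiableAt ℝ ψ.1 x :=
  (ψ.2.1.contDiffAt ((isOpen_regular N).mem_nhds hx)).differentiableAt (by simp)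

open Classical in
/-- The partial derivative `∂_{x_i}` on `C^∞(regular N, F)`. -/
def partialDeriv {N : ℕ} {F : Type*} [NormedAddCommGroup F] [NormedSpace ℂ F]
    [NormedSpace ℝ F] [SMulCommClass ℝ ℂ F] (i : Fin N) : Module.End ℂ (SmoothFun N F) where
  toFun ψ :=
    SmoothFun.mk (fun x => if x ∈ regular N then fderiv ℝ ψ.1 x (Pi.single i 1) else 0) (by
      have h1 : ContDiffOn ℝ ∞ (fun x => fderiv ℝ ψ.1 x (Pi.single i 1))
          (regular N) :=
        (ψ.2.1.fderiv_of_isOpen (isOpen_regular N) (by simp)).clm_apply contDiffOn_const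
      exact h1.congr fun x hx => if_pos hx) (fun x hx => if_neg hx)
  map_add' ψ φ := by
    refine SmoothFun.ext fun x => ?_
    by_cases hx : x ∈ regular N
    · have h := fderiv_add (differentiableAt_of_mem ψ hx) (differentiableAt_of_mem φ hx)
      have h2 : (ψ + φ).1 = ψ.1 + φ.1 := rfl
      simp [hx, h2, h]
    · simp [hx]
  map_smul' c ψ := by
    refine SmoothFun.ext fun x => ?_
    by_cases hx : x ∈ regular N
    · have h := fderiv_const_smul (differentiableAt_of_mem ψ hx) c
      have h2 : (c • ψ).1 = c • ψ.1 := rfl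
      simp [hx, h2, h]
    · simp [hx]

/-! ### The Hamiltonian -/

/-- The matrix potential of the Hamiltonian at the point `x`. -/
def potential (N d : ℕ) (a b b' : ℝ) (x : Fin N → ℝ) : Module.End ℂ (SpinSpace N d) :=
  ((2 * a : ℝ) : ℂ) • ∑ i : Fin N, ∑ j ∈ Finset.Ioi i,
      ((((Real.sinh (x i - x j) ^ 2)⁻¹ : ℝ) : ℂ) • ((a : ℂ) • 1 + spinExchange N d i j)
        + (((Real.sinh (x i + x j) ^ 2)⁻¹ : ℝ) : ℂ) • ((a : ℂ) • 1 + spinExchangeTilde N d i j))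
    + (b : ℂ) • ∑ i : Fin N,
        (((Real.sinh (x i) ^ 2)⁻¹ : ℝ) : ℂ) • ((b : ℂ) • 1 + spinReverse N d i)
    - (b' : ℂ) • ∑ i : Fin N,
        (((Real.cosh (x i) ^ 2)⁻¹ : ℝ) : ℂ) • ((b' : ℂ) • 1 + spinReverse N d i)

theorem contDiffOn_ofReal_smul {N : ℕ} {F : Type*} [NormedAddCommGroup F] [NormedSpace ℂ F]
    {g : (Fin N → ℝ) → ℝ} {ψ : (Fin N → ℝ) → F} {s : Set (Fin N → ℝ)}
    (hg : ContDiffOn ℝ ∞ g s) (hψ : ContDiffOn ℝ ∞ ψ s) :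
    ContDiffOn ℝ ∞ (fun x => ((g x : ℝ) : ℂ) • ψ x) s := by
  have h : (fun x => ((g x : ℝ) : ℂ) • ψ x) = fun x => g x • ψ x := by
    funext x
    exact Complex.coe_smul _ _
  rw [h]
  exact hg.smul hψ

theorem contDiffOn_spinEnd {N d : ℕ} (A : Module.End ℂ (SpinSpace N d))
    {ψ : (Fin N → ℝ) → SpinSpace N d} {s : Set (Fin N → ℝ)} (hψ : ContDiffOn ℝ ∞ ψ s) :
    ContDiffOn ℝ ∞ (fun x => A (ψ x)) s :=
  (LinearMap.toContinuousLinearMap (A.restrictScalars ℝ)).contDiff.comp_contDiffOn hψ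

theorem contDiffOn_potential {N d : ℕ} (a b b' : ℝ) (ψ : WaveFun N d) :
    ContDiffOn ℝ ∞ (fun x => potential N d a b b' x (ψ.1 x)) (regular N) := by
  have hψ := ψ.2.1
  have hinv : ∀ g : (Fin N → ℝ) → ℝ, ContDiff ℝ ∞ g → (∀ x ∈ regular N, g x ≠ 0) →
      ContDiffOn ℝ ∞ (fun x => (g x ^ 2)⁻¹) (regular N) := fun g hg h0 =>
    (hg.pow 2).contDiffOn.inv fun x hx => pow_ne_zero 2 (h0 x hx)
  simp only [potential, LinearMap.sub_apply, LinearMap.add_apply, LinearMap.smul_apply,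
    LinearMap.sum_apply]
  refine ContDiffOn.sub (ContDiffOn.add ?_ ?_) ?_
  · refine ContDiffOn.const_smul _ (ContDiffOn.sum fun i _ => ContDiffOn.sum fun j hj => ?_)
    have hij : i ≠ j := (Finset.mem_Ioi.1 hj).ne
    refine ContDiffOn.add ?_ ?_
    · refine contDiffOn_ofReal_smul (hinv (fun x => Real.sinh (x i - x j)) (by fun_prop) ?_)
        ((hψ.const_smul _).add (contDiffOn_spinEnd _ hψ))
      intro x hx h
      exact (hx.2 i j hij).1 (sub_eq_zero.1 (Real.sinh_eq_zero.1 h))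
    · refine contDiffOn_ofReal_smul (hinv (fun x => Real.sinh (x i + x j)) (by fun_prop) ?_)
        ((hψ.const_smul _).add (contDiffOn_spinEnd _ hψ))
      intro x hx h
      exact (hx.2 i j hij).2 (eq_neg_of_add_eq_zero_left (Real.sinh_eq_zero.1 h))
  · refine ContDiffOn.const_smul _ (ContDiffOn.sum fun i _ => ?_)
    refine contDiffOn_ofReal_smul (hinv (fun x => Real.sinh (x i)) (by fun_prop) ?_)
      ((hψ.const_smul _).add (contDiffOn_spinEnd _ hψ))
    intro x hx h
    exact hx.1 i (Real.sinh_eq_zero.1 h)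
  · refine ContDiffOn.const_smul _ (ContDiffOn.sum fun i _ => ?_)
    exact contDiffOn_ofReal_smul (hinv (fun x => Real.cosh (x i)) (by fun_prop)
      (fun x _ => (Real.cosh_pos _).ne')) ((hψ.const_smul _).add (contDiffOn_spinEnd _ hψ))

/-- Multiplication by the matrix potential. -/
def potentialOp (N d : ℕ) (a b b' : ℝ) : Module.End ℂ (WaveFun N d) where
  toFun ψ := SmoothFun.mk (fun x => potential N d a b b' x (ψ.1 x))
    (contDiffOn_potential a b b' ψ) (fun x hx => by simp [ψ.2.2 x hx])
  map_add' ψ φ := by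
    refine SmoothFun.ext fun x => ?_
    simp
  map_smul' c ψ := by
    refine SmoothFun.ext fun x => ?_
    simp

/-- The Hamiltonian `H*` of the hyperbolic `B_N` Sutherland spin model. -/
def hamiltonian (N d : ℕ) (a b b' : ℝ) : Module.End ℂ (WaveFun N d) :=
  -∑ i : Fin N, partialDeriv i * partialDeriv i + potentialOp N d a b b'

/-! ### The total antisymmetriser -/

/-- The element `(∏_{i ∈ T} Π_i) P_σ` of the Weyl group of type `B_N`, acting simultaneously on
coordinates and spins: `(W ψ)(x)(s) = ψ(y)(t)` with `y = (flipCoords T x) ∘ σ` and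
`t = (flipSpins T s) ∘ σ`. For `T = ∅`, `σ = (i j)` this is `Π_{ij} = K_{ij} S_{ij}`, and for
`T = {i}`, `σ = 1` it is `Π_i = K_i S_i`. -/
def weylOp (N d : ℕ) (T : Finset (Fin N)) (σ : Equiv.Perm (Fin N)) :
    Module.End ℂ (WaveFun N d) where
  toFun ψ := SmoothFun.mk
    (fun x => spinSign N d T (spinPerm N d σ (ψ.1 (flipCoords T x ∘ σ))))
    (by
      refine contDiffOn_spinEnd _ (contDiffOn_spinEnd _ (ψ.2.1.comp ?_ ?_))
      · refine ContDiff.contDiffOn (contDiff_pi.2 fun i => ?_)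
        simp only [flipCoords, Function.comp_apply]
        split_ifs <;> fun_prop
      · exact fun x hx => (weyl_mem_regular_iff T σ x).2 hx)
    (fun x hx => by
      have h0 := ψ.2.2 _ (fun h => hx ((weyl_mem_regular_iff T σ x).1 h))
      simp [h0])
  map_add' ψ φ := by
    refine SmoothFun.ext fun x => ?_
    simp
  map_smul' c ψ := by
    refine SmoothFun.ext fun x => ?_
    simp

/-- The total antisymmetriser
`Λ = 2^{-N} (∏_i (1 - Π_i)) Λ₀`, `Λ₀ = (N!)⁻¹ ∑_σ sgn(σ) P_σ`, with the product expanded. -/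
def antisymmetriser (N d : ℕ) : Module.End ℂ (WaveFun N d) :=
  ((2 ^ N * (N.factorial : ℂ))⁻¹) •
    ∑ T : Finset (Fin N), ∑ σ : Equiv.Perm (Fin N),
      ((-1) ^ T.card * ((Equiv.Perm.sign σ : ℤ) : ℂ)) • weylOp N d T σ

/-! ### The invariant spaces -/

/-- The gauge factor `μ`. -/
def mu (N : ℕ) (a b b' : ℝ) (x : Fin N → ℝ) : ℝ :=
  (∏ i : Fin N, ∏ j ∈ Finset.Ioi i, |Real.sinh (x i - x j) * Real.sinh (x i + x j)| ^ a) *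
    ∏ i : Fin N, |Real.sinh (x i)| ^ b * |Real.cosh (x i)| ^ b'

theorem contDiffOn_mu (N : ℕ) (a b b' : ℝ) : ContDiffOn ℝ ∞ (mu N a b b') (regular N) := by
  have habs : ∀ (g : (Fin N → ℝ) → ℝ) (c : ℝ), ContDiff ℝ ∞ g →
      (∀ x ∈ regular N, g x ≠ 0) → ContDiffOn ℝ ∞ (fun x => |g x| ^ c) (regular N) := by
    intro g c hg h0 x hx
    have h1 : ContDiffAt ℝ ∞ (fun x => |g x|) x := hg.contDiffAt.abs (h0 x hx)
    exact (h1.rpow_const_of_ne (abs_ne_zero.2 (h0 x hx))).contDiffWithinAt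
  unfold mu
  refine ContDiffOn.mul (contDiffOn_prod fun i _ => contDiffOn_prod fun j hj => ?_)
    (contDiffOn_prod fun i _ => ContDiffOn.mul ?_ ?_)
  · have hij : i ≠ j := (Finset.mem_Ioi.1 hj).ne
    refine habs (fun x => Real.sinh (x i - x j) * Real.sinh (x i + x j)) a (by fun_prop) ?_
    intro x hx
    refine mul_ne_zero (fun h => ?_) (fun h => ?_)
    · exact (hx.2 i j hij).1 (sub_eq_zero.1 (Real.sinh_eq_zero.1 h))
    · exact (hx.2 i j hij).2 (eq_neg_of_add_eq_zero_left (Real.sinh_eq_zero.1 h))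
  · exact habs (fun x => Real.sinh (x i)) b (by fun_prop)
      fun x hx h => hx.1 i (Real.sinh_eq_zero.1 h)
  · exact habs (fun x => Real.cosh (x i)) b' (by fun_prop) fun x _ => (Real.cosh_pos _).ne'

open Classical in
/-- The exponential monomials `f_n(x) = μ(x) exp(2 ∑ n_i x_i)`, as functions on `regular N`. -/
def expMonomial (N : ℕ) (a b b' : ℝ) (n : Fin N → ℤ) : SmoothFun N ℂ :=
  SmoothFun.mk (fun x => if x ∈ regular N then
      ((mu N a b b' x * Real.exp (2 * ∑ i, (n i : ℝ) * x i) : ℝ) : ℂ) else 0)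
    (by
      have h1 : ContDiffOn ℝ ∞
          (fun x => mu N a b b' x * Real.exp (2 * ∑ i, (n i : ℝ) * x i)) (regular N) :=
        (contDiffOn_mu N a b b').mul (ContDiff.contDiffOn (by fun_prop))
      exact (Complex.ofRealCLM.contDiff.comp_contDiffOn h1).congr fun x hx => if_pos hx)
    (fun x hx => if_neg hx)

/-- The space `R_m`. -/
def scalarSpace (N : ℕ) (a b b' : ℝ) (m : ℕ) : Submodule ℂ (SmoothFun N ℂ) :=
  Submodule.span ℂ {f | ∃ n : Fin N → ℤ, (∀ i, -(m : ℤ) ≤ n i ∧ n i ≤ m) ∧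
    f = expMonomial N a b b' n}

/-- The bilinear map `(φ, v) ↦ φ(x) v`, which identifies `C^∞(regular N) ⊗ S` with
`C^∞(regular N, S)`. -/
def tensorSpin (N d : ℕ) : SmoothFun N ℂ →ₗ[ℂ] SpinSpace N d →ₗ[ℂ] WaveFun N d :=
  LinearMap.mk₂ ℂ
    (fun φ v => SmoothFun.mk (fun x => φ.1 x • v)
      (φ.2.1.smul contDiffOn_const) (fun x hx => by simp [φ.2.2 x hx]))
    (fun φ φ' v => by
      refine SmoothFun.ext fun x => ?_
      simp [add_smul])
    (fun c φ v => by
      refine SmoothFun.ext fun x => ?_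
      simp [mul_smul])
    (fun φ v w => by
      refine SmoothFun.ext fun x => ?_
      simp)
    (fun c φ v => by
      refine SmoothFun.ext fun x => ?_
      exact smul_comm _ _ _)

/-- The space `M_m = Λ(R_m ⊗ S)`. -/
def spinFlag (N d : ℕ) (a b b' : ℝ) (m : ℕ) : Submodule ℂ (WaveFun N d) :=
  (Submodule.map₂ (tensorSpin N d) (scalarSpace N a b b' m) ⊤).map (antisymmetriser N d)

instance finiteDimensional_scalarSpace (N : ℕ) (a b b' : ℝ) (m : ℕ) :
    FiniteDimensional ℂ (scalarSpace N a b b' m) := by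
  have hfin : {n : Fin N → ℤ | ∀ i, -(m : ℤ) ≤ n i ∧ n i ≤ m}.Finite :=
    (Set.finite_Icc (fun _ => -(m : ℤ)) (fun _ => (m : ℤ))).subset
      fun n hn => ⟨fun i => (hn i).1, fun i => (hn i).2⟩
  refine FiniteDimensional.span_of_finite ℂ ((hfin.image (expMonomial N a b b')).subset ?_)
  rintro f ⟨n, hn, rfl⟩
  exact ⟨n, hn, rfl⟩

instance finiteDimensional_spinFlag (N d : ℕ) (a b b' : ℝ) (m : ℕ) :
    FiniteDimensional ℂ (spinFlag N d a b b' m) := by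
  have h : (Submodule.map₂ (tensorSpin N d) (scalarSpace N a b b' m) ⊤).FG :=
    Submodule.FG.map₂ _ (Module.Finite.iff_fg.1 inferInstance) (Module.Finite.fg_top)
  exact Module.Finite.iff_fg.2 (h.map _)

/-- The restriction of `H*` to `M_m`, given that `M_m` is invariant. -/
def hamiltonianOn (N d : ℕ) (a b b' : ℝ) (m : ℕ)
    (hinv : ∀ ψ ∈ spinFlag N d a b b' m, hamiltonian N d a b b' ψ ∈ spinFlag N d a b b' m) :
    Module.End ℂ (spinFlag N d a b b' m) :=
  LinearMap.restrict (hamiltonian N d a b b') hinv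

/-! ### Multi-indices and energies -/

/-- `#(k)`: the number of components of `n` equal to `k`. -/
def multiplicity {N : ℕ} (n : Fin N → ℕ) (k : ℕ) : ℕ :=
  (Finset.univ.filter fun j => n j = k).card

/-- `ℓ(k)`: the first position, counted from `1`, at which `n` takes the value `k` (only used for
values `k` that `n` does take). -/
def firstPosition {N : ℕ} (n : Fin N → ℕ) (k : ℕ) : ℕ :=
  sInf {p : ℕ | ∃ j : Fin N, n j = k ∧ p = (j : ℕ) + 1}

/-- `λ_{n,i}`. The index `i : Fin N` starts from `0`, so the position of `i` is `i + 1`. -/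
def lam {N : ℕ} (a b b' : ℝ) (n : Fin N → ℕ) (i : Fin N) : ℝ :=
  if 0 < n i then
    2 * (n i : ℝ) + b + b' +
      2 * a * ((N : ℝ) + ((i : ℝ) + 1) + 1 - multiplicity n (n i) - 2 * firstPosition n (n i))
  else
    -b - b' + 2 * a * (((i : ℝ) + 1) - N)

/-- `E*_n = -∑_i λ_{n,i}²`. -/
def energy {N : ℕ} (a b b' : ℝ) (n : Fin N → ℕ) : ℝ :=
  -∑ i, lam a b b' n i ^ 2

/-- The multi-indices allowed in the spectrum: nonincreasing, with components at most `m₁`,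
every positive value being taken at most `2 M + 1` times and the value `0` at most `⌈M⌉` times. -/
def Admissible {N : ℕ} (d m₁ : ℕ) (n : Fin N → ℕ) : Prop :=
  Antitone n ∧ (∀ i, n i ≤ m₁) ∧
    (∀ i, 0 < n i → (multiplicity n (n i) : ℚ) ≤ 2 * spinM d + 1) ∧
    (∀ i, n i = 0 → (multiplicity n (n i) : ℤ) ≤ ⌈spinM d⌉)

/-- The pairs `(n, s)` with `n` admissible, `s_i > s_j` whenever `n_i = n_j` and `i < j`, and
`s_i > 0` whenever `n_i = 0`. -/
def IsLabel {N : ℕ} (d m₁ : ℕ) (p : (Fin N → ℕ) × Spins N d) : Prop :=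
  Admissible d m₁ p.1 ∧
    (∀ i j, p.1 i = p.1 j → i < j → spinValue d (p.2 j) < spinValue d (p.2 i)) ∧
    (∀ i, p.1 i = 0 → 0 < spinValue d (p.2 i))

theorem finite_isLabel (N d m₁ : ℕ) :
    {p : (Fin N → ℕ) × Spins N d | IsLabel d m₁ p}.Finite := by
  refine ((Set.finite_Icc (fun _ => 0) (fun _ => m₁)).prod Set.finite_univ).subset ?_
  rintro ⟨n, s⟩ h
  exact ⟨⟨fun i => Nat.zero_le _, fun i => h.1.2.1 i⟩, Set.mem_univ _⟩

/-- The finite set of labels `(n, s)`. -/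
def labels (N d m₁ : ℕ) : Finset ((Fin N → ℕ) × Spins N d) := (finite_isLabel N d m₁).toFinset

/-- `m₀ = ⌈(N - ⌈M⌉) / (2 M + 1)⌉`. -/
def mZero (N d : ℕ) : ℤ := ⌈((N : ℚ) - (⌈spinM d⌉ : ℚ)) / (2 * spinM d + 1)⌉

end SutherlandBN

end

noncomputable section

namespace SutherlandBN

/-! ### The Weyl group action -/

/-! The mechanism is that a total antisymmetriser turns spin operators into coordinate operators.
Since `Λ w = sgn(w) Λ` for every Weyl element `w` (`antisymmetriser_mul_weylOp`), an odd `w = K S`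
(coordinate part times spin part) that fixes a multiplier `g` gives `Λ (g f ⊗ S v) = -Λ (g K f ⊗ v)`
(`antisymmetriser_realMul`). As `H*` commutes with `Λ` (`hamiltonian_antisymmetriser`), its action
on `Λ (f_n ⊗ v)` is found by letting a scalar operator, `H*` with each `S` replaced by `-K`, act on
`f_n`; the discrepancy is `exchangePart`, which `Λ` kills.

The scalar operator is triangular (`scalar_triangular`). Differentiating `f_n = μ exp(2 n·x)` twice
brings in the logarithmic derivative of `μ`. Its square sum is a constant plus inverse squares of
sinh and cosh (`sum_logDeriv_sq`, resting on `cothPair_cyclic`), and these combine with the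
potential into terms `(1 - K)/sinh²` and `(1 - K)/cosh²`. Together with the cross terms `coth` and
`tanh`, each of them becomes a finite sum of exponentials on the root string from `n` to its
reflection (`coth_identity`, `tanh_identity`). For `n` nonnegative and nonincreasing, only the term
at `n` and terms strictly inside the string occur; the latter have smaller `∑ n_i²` and stay in the
box `[-m, m]^N` (`sum_sq_sub_smul_lt`). The terms at `n` add up to `scalarEnergy`, which equals the
stated energy once each block of equal positive entries is reversed (`energy_eq_scalarEnergy`).

It remains to find a basis of `M_m`. Every pair `(n, s)` can be moved by the Weyl group to a sorted
one; either an odd element fixes the sorted pair, and then `Λ` kills it, or it is a label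
(`antisymmetriser_waveMonomial_eq`). Labels lie in distinct orbits with trivial stabilisers
(`weylIndex_label_eq`), and the functions `f_n` are independent, so the antisymmetrised labels form
a basis. Ordered by `∑ n_i²`, it makes `H*` triangular with the energies on the diagonal, which
gives the characteristic polynomial and hence the eigenvalues. -/

theorem weylOp_val {N d : ℕ} (T : Finset (Fin N)) (σ : Equiv.Perm (Fin N)) (ψ : WaveFun N d)
    (x : Fin N → ℝ) (s : Spins N d) :
    (weylOp N d T σ ψ).1 x s = ψ.1 (flipCoords T x ∘ σ) (flipSpins T s ∘ σ) := rfl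

theorem flipCoords_comp {N : ℕ} (T U : Finset (Fin N)) (σ : Equiv.Perm (Fin N))
    (x : Fin N → ℝ) :
    flipCoords U (flipCoords T x ∘ σ) =
      flipCoords (symmDiff T (U.map σ.toEmbedding)) x ∘ σ := by
  funext i
  simp only [flipCoords, Function.comp_apply, Finset.mem_symmDiff, Finset.mem_map_equiv,
    Equiv.symm_apply_apply]
  by_cases h1 : σ i ∈ T <;> by_cases h2 : i ∈ U <;> simp [h1, h2]

theorem flipSpins_comp {N d : ℕ} (T U : Finset (Fin N)) (σ : Equiv.Perm (Fin N))
    (s : Spins N d) :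
    flipSpins U (flipSpins T s ∘ σ) =
      flipSpins (symmDiff T (U.map σ.toEmbedding)) s ∘ σ := by
  funext i
  simp only [flipSpins, Function.comp_apply, Finset.mem_symmDiff, Finset.mem_map_equiv,
    Equiv.symm_apply_apply]
  by_cases h1 : σ i ∈ T <;> by_cases h2 : i ∈ U <;> simp [h1, h2]

/-- This is the semidirect product law: a sign change on `U` carried past `σ` becomes one on `σ(U)`,
and sign changes compose by symmetric difference. -/
theorem weylOp_mul {N d : ℕ} (T U : Finset (Fin N)) (σ τ : Equiv.Perm (Fin N)) :
    weylOp N d T σ * weylOp N d U τ =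
      weylOp N d (symmDiff T (U.map σ.toEmbedding)) (σ * τ) := by
  refine LinearMap.ext fun ψ => SmoothFun.ext fun x => funext fun s => ?_
  simp only [Module.End.mul_apply, weylOp_val, flipCoords_comp, flipSpins_comp]
  rfl

theorem neg_one_pow_card_symmDiff {α : Type*} [DecidableEq α] (T U : Finset α) :
    (-1 : ℂ) ^ (symmDiff T U).card = (-1) ^ T.card * (-1) ^ U.card := by
  have h : (symmDiff T U).card + 2 * (T ∩ U).card = T.card + U.card := by
    have h1 := Finset.card_sdiff_add_card_inter T U
    have h2 := Finset.card_sdiff_add_card_inter U T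
    rw [Finset.inter_comm] at h2
    rw [symmDiff_def, Finset.sup_eq_union, Finset.card_union_of_disjoint
      (disjoint_sdiff_sdiff)]
    omega
  rw [← pow_add, ← h, pow_add, pow_mul]
  simp

/-- Right translation permutes the terms of the group sum, and `(-1)^|T| sgn σ` is a character of
the Weyl group. -/
theorem antisymmetriser_mul_weylOp {N d : ℕ} (U : Finset (Fin N)) (τ : Equiv.Perm (Fin N)) :
    antisymmetriser N d * weylOp N d U τ =
      ((-1) ^ U.card * ((Equiv.Perm.sign τ : ℤ) : ℂ)) • antisymmetriser N d := by
  have hU : ((-1 : ℂ) ^ U.card) * (-1) ^ U.card = 1 := by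
    rw [← mul_pow]; simp
  have hτ : ((Equiv.Perm.sign τ : ℤ) : ℂ) * ((Equiv.Perm.sign τ : ℤ) : ℂ) = 1 := by
    rw [← Int.cast_mul, ← Units.val_mul, Int.units_mul_self]; simp
  unfold antisymmetriser
  rw [smul_mul_assoc, smul_comm _ (_⁻¹)]
  congr 1
  rw [Finset.sum_comm, Finset.sum_mul, Finset.smul_sum]
  refine Fintype.sum_equiv (Equiv.mulRight τ) _ _ fun σ => ?_
  rw [Finset.sum_mul, Finset.smul_sum]
  -- For fixed `σ`, adding `σ(U)` to `T` by symmetric difference is its own inverse, so it reindexes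
  -- the sum over `T`.
  have hinv : Function.Involutive
      (fun T : Finset (Fin N) => symmDiff T (U.map σ.toEmbedding)) := fun T => by simp
  refine Fintype.sum_equiv hinv.toPerm _ _ fun T => ?_
  rw [smul_mul_assoc, weylOp_mul, smul_smul]
  simp only [Function.Involutive.coe_toPerm, Equiv.coe_mulRight]
  rw [neg_one_pow_card_symmDiff, Finset.card_map, Equiv.Perm.sign_mul]
  congr 1
  push_cast
  linear_combination (-(-1 : ℂ) ^ T.card * ((Equiv.Perm.sign σ : ℤ) : ℂ)) *
    (((Equiv.Perm.sign τ : ℤ) : ℂ) * ((Equiv.Perm.sign τ : ℤ) : ℂ) * hU + hτ)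

/-! ### The Hamiltonian commutes with the Weyl group -/

theorem partialDeriv_val {N : ℕ} {F : Type*} [NormedAddCommGroup F] [NormedSpace ℂ F]
    [NormedSpace ℝ F] [SMulCommClass ℝ ℂ F] (i : Fin N) (ψ : SmoothFun N F) {x : Fin N → ℝ}
    (hx : x ∈ regular N) : (partialDeriv i ψ).1 x = fderiv ℝ ψ.1 x (Pi.single i 1) :=
  if_pos hx

theorem SmoothFun.ext_regular {N : ℕ} {F : Type*} [NormedAddCommGroup F] [NormedSpace ℂ F]
    [NormedSpace ℝ F] [SMulCommClass ℝ ℂ F] {ψ φ : SmoothFun N F}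
    (h : ∀ x ∈ regular N, ψ.1 x = φ.1 x) : ψ = φ := by
  refine SmoothFun.ext fun x => ?_
  by_cases hx : x ∈ regular N
  · exact h x hx
  · rw [ψ.2.2 x hx, φ.2.2 x hx]

/-- Chain rule along the signed permutation `x ↦ flipCoords T x ∘ σ`, which sends the `i`-th unit
vector to plus or minus the one at `σ⁻¹ i`. The sign squares away in the Laplacian. -/
theorem partialDeriv_weylOp {N d : ℕ} (T : Finset (Fin N)) (σ : Equiv.Perm (Fin N))
    (ψ : WaveFun N d) (i : Fin N) :
    partialDeriv i (weylOp N d T σ ψ) =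
      (if i ∈ T then (-1 : ℂ) else 1) • weylOp N d T σ (partialDeriv (σ⁻¹ i) ψ) := by
  refine SmoothFun.ext_regular fun x hx => ?_
  let L : (Fin N → ℝ) →L[ℝ] (Fin N → ℝ) := ContinuousLinearMap.pi fun j =>
    (if σ j ∈ T then (-1 : ℝ) else 1) • ContinuousLinearMap.proj (σ j)
  have hL : ∀ y, L y = flipCoords T y ∘ σ := fun y => by
    funext j
    simp only [L, ContinuousLinearMap.coe_pi', smul_apply,
      ContinuousLinearMap.proj_apply, flipCoords, Function.comp_apply]
    split_ifs <;> simp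
  have hy : L x ∈ regular N := by rw [hL]; exact (weyl_mem_regular_iff T σ x).2 hx
  let A : SpinSpace N d →L[ℝ] SpinSpace N d := LinearMap.toContinuousLinearMap
    ((spinSign N d T * spinPerm N d σ).restrictScalars ℝ)
  have hA : ∀ v, A v = spinSign N d T (spinPerm N d σ v) := fun v => rfl
  have h1 : (weylOp N d T σ ψ).1 = fun y => A (ψ.1 (L y)) := by
    funext y
    rw [hL, hA]
    rfl
  have h2 : HasFDerivAt (weylOp N d T σ ψ).1 (A.comp ((fderiv ℝ ψ.1 (L x)).comp L)) x := by
    rw [h1]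
    exact A.hasFDerivAt.comp x
      ((differentiableAt_of_mem ψ hy).hasFDerivAt.comp x L.hasFDerivAt)
  have h3 : L (Pi.single i 1) = (if i ∈ T then (-1 : ℝ) else 1) • Pi.single (σ⁻¹ i) 1 := by
    rw [hL]
    funext j
    by_cases hj : σ j = i
    · have : j = σ⁻¹ i := by rw [← hj]; simp
      subst this
      simp [flipCoords]
    · have : j ≠ σ⁻¹ i := fun h => hj (by rw [h]; simp)
      simp only [flipCoords, Function.comp_apply, Pi.single_eq_of_ne hj, Pi.smul_apply,
        Pi.single_eq_of_ne this]
      simp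
  have h4 : (weylOp N d T σ (partialDeriv (σ⁻¹ i) ψ)).1 x =
      A (fderiv ℝ ψ.1 (L x) (Pi.single (σ⁻¹ i) 1)) := by
    rw [← partialDeriv_val _ _ hy, hL]
    rfl
  rw [partialDeriv_val _ _ hx, h2.fderiv, SmoothFun.smul_val, h4]
  simp only [ContinuousLinearMap.comp_apply, h3]
  split_ifs <;> simp

theorem laplacian_weylOp {N d : ℕ} (T : Finset (Fin N)) (σ : Equiv.Perm (Fin N)) :
    (∑ i : Fin N, partialDeriv i * partialDeriv i) * weylOp N d T σ =
      weylOp N d T σ * ∑ i : Fin N, partialDeriv i * partialDeriv i := by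
  rw [Finset.sum_mul, Finset.mul_sum]
  refine Fintype.sum_equiv σ⁻¹ _ _ fun i => LinearMap.ext fun ψ => ?_
  simp only [Module.End.mul_apply]
  rw [partialDeriv_weylOp, map_smul, partialDeriv_weylOp, smul_smul]
  split_ifs <;> simp

/-! ### Conjugation of the potential by permutations and sign changes. -/

theorem spinPerm_apply {N d : ℕ} (σ : Equiv.Perm (Fin N)) (v : SpinSpace N d) (s : Spins N d) :
    spinPerm N d σ v s = v (s ∘ σ) := rfl

theorem spinSign_apply {N d : ℕ} (T : Finset (Fin N)) (v : SpinSpace N d) (s : Spins N d) :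
    spinSign N d T v s = v (flipSpins T s) := rfl

theorem flipSpins_flipSpins {N d : ℕ} (T U : Finset (Fin N)) (s : Spins N d) :
    flipSpins T (flipSpins U s) = flipSpins (symmDiff U T) s := by
  funext i
  by_cases h1 : i ∈ T <;> by_cases h2 : i ∈ U <;>
    simp [flipSpins, Finset.mem_symmDiff, h1, h2]

theorem flipSpins_comp_perm {N d : ℕ} (T : Finset (Fin N)) (σ : Equiv.Perm (Fin N))
    (s : Spins N d) :
    flipSpins T (s ∘ σ) = flipSpins (T.map σ.toEmbedding) s ∘ σ := by
  funext i
  simp [flipSpins]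

/-- The pair of terms of the potential that couples the particles `i` and `j`. -/
def pairPotential (N d : ℕ) (a : ℝ) (x : Fin N → ℝ) (i j : Fin N) :
    Module.End ℂ (SpinSpace N d) :=
  (((Real.sinh (x i - x j) ^ 2)⁻¹ : ℝ) : ℂ) • ((a : ℂ) • 1 + spinExchange N d i j)
    + (((Real.sinh (x i + x j) ^ 2)⁻¹ : ℝ) : ℂ) • ((a : ℂ) • 1 + spinExchangeTilde N d i j)

theorem potential_eq (N d : ℕ) (a b b' : ℝ) (x : Fin N → ℝ) :
    potential N d a b b' x = ((2 * a : ℝ) : ℂ) • ∑ i : Fin N, ∑ j ∈ Finset.Ioi i,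
      pairPotential N d a x i j
    + (b : ℂ) • ∑ i : Fin N,
        (((Real.sinh (x i) ^ 2)⁻¹ : ℝ) : ℂ) • ((b : ℂ) • 1 + spinReverse N d i)
    - (b' : ℂ) • ∑ i : Fin N,
        (((Real.cosh (x i) ^ 2)⁻¹ : ℝ) : ℂ) • ((b' : ℂ) • 1 + spinReverse N d i) := rfl

theorem spinExchange_comm (N d : ℕ) (i j : Fin N) :
    spinExchange N d i j = spinExchange N d j i := by
  rw [spinExchange, Equiv.swap_comm, spinExchange]

theorem spinExchangeTilde_comm (N d : ℕ) (i j : Fin N) :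
    spinExchangeTilde N d i j = spinExchangeTilde N d j i := by
  refine LinearMap.ext fun v => funext fun s => ?_
  simp only [spinExchangeTilde, spinReverse, spinExchange, Module.End.mul_apply, spinSign_apply,
    spinPerm_apply, flipSpins_flipSpins]
  rw [symmDiff_comm, Equiv.swap_comm]

theorem spinExchangeTilde_apply {N d : ℕ} {i j : Fin N} (hij : i ≠ j) (v : SpinSpace N d)
    (s : Spins N d) :
    spinExchangeTilde N d i j v s = v (flipSpins {i, j} s ∘ Equiv.swap i j) := by
  simp only [spinExchangeTilde, spinReverse, spinExchange, Module.End.mul_apply, spinSign_apply,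
    spinPerm_apply, flipSpins_flipSpins]
  congr 3
  ext k
  simp only [Finset.mem_symmDiff, Finset.mem_singleton, Finset.mem_insert]
  grind

theorem pairPotential_comm (N d : ℕ) (a : ℝ) (x : Fin N → ℝ) (i j : Fin N) :
    pairPotential N d a x i j = pairPotential N d a x j i := by
  unfold pairPotential
  rw [spinExchange_comm, spinExchangeTilde_comm, add_comm (x i), ← neg_sub (x j), Real.sinh_neg,
    neg_sq]

/-- Each ordered pair off the diagonal arises once from its unordered pair. This converts between
sums over `i < j` and full double sums. -/
theorem sum_Ioi_add_swap {N : ℕ} {M : Type*} [AddCommMonoid M] (G : Fin N → Fin N → M) :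
    ∑ i, ∑ j ∈ Finset.Ioi i, (G i j + G j i) = ∑ i, ∑ j, if i = j then 0 else G i j := by
  have h1 : ∀ F : Fin N → Fin N → M,
      ∑ i, ∑ j ∈ Finset.Ioi i, F i j = ∑ i, ∑ j, if i < j then F i j else 0 := fun F => by
    refine Finset.sum_congr rfl fun i _ => ?_
    rw [← Finset.sum_filter]
    congr 1
    ext j; simp
  simp only [Finset.sum_add_distrib]
  rw [h1, h1, Finset.sum_comm (f := fun i j => if i < j then G j i else 0),
    ← Finset.sum_add_distrib]
  refine Finset.sum_congr rfl fun i _ => ?_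
  rw [← Finset.sum_add_distrib]
  refine Finset.sum_congr rfl fun j _ => ?_
  rcases lt_trichotomy i j with h | h | h
  · simp [h.ne, h, not_lt.2 h.le]
  · simp [h]
  · simp [h.ne', h, not_lt.2 h.le]

/-- Reindexing by `σ` destroys the condition `i < j`. Doubling a symmetric sum turns it into one
over all ordered pairs, where reindexing is harmless. -/
theorem sum_Ioi_perm {N : ℕ} {M : Type*} [AddCommGroup M] [Module ℝ M]
    (σ : Equiv.Perm (Fin N)) (F : Fin N → Fin N → M) (hF : ∀ i j, F i j = F j i) :
    ∑ i, ∑ j ∈ Finset.Ioi i, F (σ i) (σ j) = ∑ i, ∑ j ∈ Finset.Ioi i, F i j := by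
  have key : ∀ G : Fin N → Fin N → M, (∀ i j, G i j = G j i) →
      (2 : ℝ) • ∑ i, ∑ j ∈ Finset.Ioi i, G i j = ∑ i, ∑ j, if i = j then 0 else G i j := by
    intro G hG
    rw [← sum_Ioi_add_swap]
    simp only [hG _ _, ← two_smul ℝ, Finset.smul_sum]
  refine smul_right_injective M (two_ne_zero (α := ℝ)) ?_
  simp only
  rw [key (fun i j => F (σ i) (σ j)) (fun i j => hF _ _), key F hF]
  refine Fintype.sum_equiv σ _ _ fun i => Fintype.sum_equiv σ _ _ fun j => ?_
  simp

theorem spinPerm_spinExchange {N d : ℕ} (σ : Equiv.Perm (Fin N)) (i j : Fin N)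
    (v : SpinSpace N d) :
    spinPerm N d σ (spinExchange N d i j v) =
      spinExchange N d (σ i) (σ j) (spinPerm N d σ v) := by
  funext s
  simp only [spinExchange, spinPerm_apply]
  congr 1
  funext k
  simp only [Function.comp_apply]
  rw [Equiv.swap_apply_apply]
  simp

theorem spinPerm_spinReverse {N d : ℕ} (σ : Equiv.Perm (Fin N)) (i : Fin N)
    (v : SpinSpace N d) :
    spinPerm N d σ (spinReverse N d i v) = spinReverse N d (σ i) (spinPerm N d σ v) := by
  funext s
  simp only [spinReverse, spinPerm_apply, spinSign_apply, flipSpins_comp_perm]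
  congr 2

theorem spinPerm_spinExchangeTilde {N d : ℕ} (σ : Equiv.Perm (Fin N)) (i j : Fin N)
    (v : SpinSpace N d) :
    spinPerm N d σ (spinExchangeTilde N d i j v) =
      spinExchangeTilde N d (σ i) (σ j) (spinPerm N d σ v) := by
  simp only [spinExchangeTilde, Module.End.mul_apply, spinPerm_spinReverse,
    spinPerm_spinExchange]

theorem spinPerm_pairPotential {N d : ℕ} (a : ℝ) (σ : Equiv.Perm (Fin N)) (x : Fin N → ℝ)
    (i j : Fin N) (v : SpinSpace N d) :
    spinPerm N d σ (pairPotential N d a (x ∘ σ) i j v) =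
      pairPotential N d a x (σ i) (σ j) (spinPerm N d σ v) := by
  simp only [pairPotential, LinearMap.add_apply, LinearMap.smul_apply, map_add, map_smul,
    spinPerm_spinExchange, spinPerm_spinExchangeTilde, Module.End.one_apply, Function.comp_apply]

theorem spinPerm_potential {N d : ℕ} (a b b' : ℝ) (σ : Equiv.Perm (Fin N)) (x : Fin N → ℝ)
    (v : SpinSpace N d) :
    spinPerm N d σ (potential N d a b b' (x ∘ σ) v) =
      potential N d a b b' x (spinPerm N d σ v) := by
  simp only [potential_eq, LinearMap.add_apply, LinearMap.sub_apply, LinearMap.smul_apply,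
    LinearMap.sum_apply, map_add, map_sub, map_smul, map_sum, spinPerm_pairPotential,
    spinPerm_spinReverse, Module.End.one_apply, Function.comp_apply]
  congr 1
  · congr 1
    · congr 1
      exact sum_Ioi_perm σ (fun i j => pairPotential N d a x i j (spinPerm N d σ v))
        (fun i j => by rw [pairPotential_comm])
    · congr 1
      exact Fintype.sum_equiv σ _ _ fun i => rfl
  · congr 1
    exact Fintype.sum_equiv σ _ _ fun i => rfl

theorem spinSign_spinReverse {N d : ℕ} (T : Finset (Fin N)) (i : Fin N) (v : SpinSpace N d) :
    spinSign N d T (spinReverse N d i v) = spinReverse N d i (spinSign N d T v) := by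
  funext s
  simp only [spinReverse, spinSign_apply, flipSpins_flipSpins, symmDiff_comm]

/-- Reversing exactly one of the two particles interchanges `x_i - x_j` and `x_i + x_j` up to sign,
and conjugates `S_ij` into `S̃_ij`, so the two halves of the pair term trade places. Reversing both
or neither fixes each half. -/
theorem spinSign_pairPotential {N d : ℕ} (a : ℝ) (T : Finset (Fin N)) (x : Fin N → ℝ)
    {i j : Fin N} (hij : i ≠ j) (v : SpinSpace N d) :
    spinSign N d T (pairPotential N d a (flipCoords T x) i j v) =
      pairPotential N d a x i j (spinSign N d T v) := by
  have hE : ∀ s : Spins N d, flipSpins T s ∘ Equiv.swap i j =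
      (if (i ∈ T ↔ j ∈ T) then flipSpins T (s ∘ Equiv.swap i j)
        else flipSpins T (flipSpins {i, j} s ∘ Equiv.swap i j)) := by
    intro s
    funext k
    by_cases hk : k = i
    · subst hk
      by_cases h1 : k ∈ T <;> by_cases h2 : j ∈ T <;> simp [flipSpins, h1, h2]
    · by_cases hk' : k = j
      · subst hk'
        by_cases h1 : i ∈ T <;> by_cases h2 : k ∈ T <;> simp [flipSpins, h1, h2]
      · by_cases h1 : i ∈ T <;> by_cases h2 : j ∈ T <;>
          simp [flipSpins, h1, h2, Equiv.swap_apply_of_ne_of_ne hk hk', hk, hk']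
  have hE' : ∀ s : Spins N d, flipSpins {i, j} (flipSpins T s) ∘ Equiv.swap i j =
      (if (i ∈ T ↔ j ∈ T) then flipSpins T (flipSpins {i, j} s ∘ Equiv.swap i j)
        else flipSpins T (s ∘ Equiv.swap i j)) := by
    intro s
    funext k
    by_cases hk : k = i
    · subst hk
      by_cases h1 : k ∈ T <;> by_cases h2 : j ∈ T <;> simp [flipSpins, h1, h2]
    · by_cases hk' : k = j
      · subst hk'
        by_cases h1 : i ∈ T <;> by_cases h2 : k ∈ T <;> simp [flipSpins, h1, h2]
      · by_cases h1 : i ∈ T <;> by_cases h2 : j ∈ T <;>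
          simp [flipSpins, h1, h2, Equiv.swap_apply_of_ne_of_ne hk hk', hk, hk']
  have hs1 : Real.sinh (-x i - x j) ^ 2 = Real.sinh (x i + x j) ^ 2 := by
    rw [← neg_add', Real.sinh_neg, neg_sq]
  have hs2 : Real.sinh (-x i + x j) ^ 2 = Real.sinh (x i - x j) ^ 2 := by
    rw [neg_add_eq_sub, ← neg_sub, Real.sinh_neg, neg_sq]
  funext s
  simp only [pairPotential, LinearMap.add_apply, LinearMap.smul_apply,
    Module.End.one_apply, spinSign_apply, Pi.add_apply, Pi.smul_apply,
    spinExchangeTilde_apply hij, spinExchange, spinPerm_apply, hE, hE', flipCoords]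
  by_cases h1 : i ∈ T <;> by_cases h2 : j ∈ T <;>
    simp only [h1, h2, if_true, if_false, iff_true, iff_false, hs1, hs2,
      not_true, sub_neg_eq_add, ← sub_eq_add_neg]
  · rw [add_comm]
  · rw [add_comm]

theorem spinSign_potential {N d : ℕ} (a b b' : ℝ) (T : Finset (Fin N)) (x : Fin N → ℝ)
    (v : SpinSpace N d) :
    spinSign N d T (potential N d a b b' (flipCoords T x) v) =
      potential N d a b b' x (spinSign N d T v) := by
  have h1 : ∀ i, Real.sinh (flipCoords T x i) ^ 2 = Real.sinh (x i) ^ 2 := fun i => by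
    unfold flipCoords; split_ifs <;> simp
  have h2 : ∀ i, Real.cosh (flipCoords T x i) ^ 2 = Real.cosh (x i) ^ 2 := fun i => by
    unfold flipCoords; split_ifs <;> simp
  simp only [potential_eq, LinearMap.add_apply, LinearMap.sub_apply, LinearMap.smul_apply,
    LinearMap.sum_apply, map_add, map_sub, map_smul, map_sum,
    spinSign_spinReverse, Module.End.one_apply, h1, h2]
  congr 3
  refine Finset.sum_congr rfl fun i _ => Finset.sum_congr rfl fun j hj => ?_
  exact spinSign_pairPotential a T x (Finset.mem_Ioi.1 hj).ne v

theorem potentialOp_weylOp {N d : ℕ} (a b b' : ℝ) (T : Finset (Fin N))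
    (σ : Equiv.Perm (Fin N)) :
    potentialOp N d a b b' * weylOp N d T σ = weylOp N d T σ * potentialOp N d a b b' := by
  refine LinearMap.ext fun ψ => SmoothFun.ext fun x => ?_
  change potential N d a b b' x (spinSign N d T (spinPerm N d σ (ψ.1 (flipCoords T x ∘ σ)))) =
    spinSign N d T (spinPerm N d σ (potential N d a b b' (flipCoords T x ∘ σ)
      (ψ.1 (flipCoords T x ∘ σ))))
  rw [spinPerm_potential, spinSign_potential]

theorem hamiltonian_weylOp {N d : ℕ} (a b b' : ℝ) (T : Finset (Fin N))
    (σ : Equiv.Perm (Fin N)) :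
    hamiltonian N d a b b' * weylOp N d T σ = weylOp N d T σ * hamiltonian N d a b b' := by
  rw [hamiltonian, add_mul, mul_add, neg_mul, mul_neg, laplacian_weylOp, potentialOp_weylOp]

theorem hamiltonian_antisymmetriser {N d : ℕ} (a b b' : ℝ) :
    hamiltonian N d a b b' * antisymmetriser N d =
      antisymmetriser N d * hamiltonian N d a b b' := by
  simp only [antisymmetriser, mul_smul_comm, smul_mul_assoc, Finset.mul_sum, Finset.sum_mul,
    hamiltonian_weylOp]

/-! ### Sums over pairs -/

theorem sum_Ioi_const {N : ℕ} (c : ℝ) :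
    ∑ i : Fin N, ∑ _j ∈ Finset.Ioi i, c = c * (N * (N - 1) / 2) := by
  have h := sum_Ioi_add_swap (N := N) (fun _ _ => c / 2)
  simp only [add_halves] at h
  rw [h]
  have h2 : ∀ i j : Fin N, (if i = j then 0 else c / 2) = c / 2 - if i = j then c / 2 else 0 :=
    fun i j => by split_ifs <;> simp
  simp only [h2, Finset.sum_sub_distrib, Finset.sum_ite_eq, Finset.mem_univ, if_true,
    Finset.sum_const, Finset.card_univ, Fintype.card_fin, nsmul_eq_mul]
  ring

/-- The constant produced by the cyclic identities has this polynomial form; the lemma recognises it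
as the squared length of the shift vector in `scalarEnergy`. -/
theorem sum_sq_affine (N : ℕ) (a c : ℝ) :
    ∑ i : Fin N, (c + 2 * a * ((N : ℝ) - 1 - (i : ℝ))) ^ 2 =
      N * c ^ 2 + 2 * a * c * (N * (N - 1)) + a ^ 2 * (N * (N - 1) * (4 * N - 2)) / 3 := by
  induction N with
  | zero => simp
  | succ N ih =>
    rw [Fin.sum_univ_succ]
    have h : ∀ i : Fin N, (c + 2 * a * (((N + 1 : ℕ) : ℝ) - 1 - ((i.succ : Fin (N + 1)) : ℝ))) =
        (c + 2 * a * ((N : ℝ) - 1 - (i : ℝ))) := fun i => by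
      push_cast [Fin.val_succ]; ring
    simp only [h, ih]
    push_cast [Fin.val_zero]
    ring

/-! ### Hyperbolic identities -/

/-- Raising `k` by one adds a geometric sum to the weighted sum, so induction applies. -/
theorem sum_range_sub_mul_pow (w : ℝ) (k : ℕ) :
    (1 - w) ^ 2 * ∑ q ∈ Finset.range k, ((k : ℝ) - q) * w ^ q = k * (1 - w) - w * (1 - w ^ k) := by
  induction k with
  | zero => simp
  | succ k ih =>
    have h : ∑ q ∈ Finset.range (k + 1), (((k + 1 : ℕ) : ℝ) - q) * w ^ q =
        ∑ q ∈ Finset.range k, ((k : ℝ) - q) * w ^ q + ∑ q ∈ Finset.range (k + 1), w ^ q := by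
      have h1 : ∑ q ∈ Finset.range k, ((k : ℝ) - q) * w ^ q =
          ∑ q ∈ Finset.range (k + 1), ((k : ℝ) - q) * w ^ q := by
        rw [Finset.sum_range_succ]; simp
      rw [h1, ← Finset.sum_add_distrib]
      refine Finset.sum_congr rfl fun q _ => ?_
      push_cast; ring
    have h2 := mul_neg_geom_sum w (k + 1)
    rw [h, mul_add, ih, pow_two, mul_assoc, h2]
    push_cast; ring

/-- The hyperbolic cotangent. -/
def coth (y : ℝ) : ℝ := Real.cosh y / Real.sinh y

/-- In `w = exp(-2y)` both sides are rational. On the right, the term `q = 0` cancels `k` and the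
coefficient at `q = k` would be `0`, so only the interior `0 < q < k` of the root string survives.
-/
theorem coth_identity {y : ℝ} (hy : Real.sinh y ≠ 0) (k : ℕ) :
    -(k : ℝ) * coth y + (1 - Real.exp (-2 * y) ^ k) / (2 * Real.sinh y ^ 2) + k =
      2 * (k - ∑ q ∈ Finset.range k, ((k : ℝ) - q) * Real.exp (-2 * y) ^ q) := by
  set w := Real.exp (-2 * y) with hw
  have he : Real.exp y ≠ 0 := (Real.exp_pos y).ne'
  have hw2 : w = (Real.exp y)⁻¹ ^ 2 := by
    rw [hw, ← Real.exp_neg, ← Real.exp_nat_mul]; congr 1; push_cast; ring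
  have hs : Real.sinh y = Real.exp y * (1 - w) / 2 := by
    rw [Real.sinh_eq, hw2, Real.exp_neg]; field_simp
  have hc : Real.cosh y = Real.exp y * (1 + w) / 2 := by
    rw [Real.cosh_eq, hw2, Real.exp_neg]; field_simp
  have h1w : 1 - w ≠ 0 := by
    intro h
    exact hy (by rw [hs, h]; ring)
  have hes : Real.exp y ^ 2 = w⁻¹ := by rw [hw2]; field_simp
  have hw0 : w ≠ 0 := (Real.exp_pos _).ne'
  have h := sum_range_sub_mul_pow w k
  set S := ∑ q ∈ Finset.range k, ((k : ℝ) - q) * w ^ q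
  have hS : S = (k * (1 - w) - w * (1 - w ^ k)) / (1 - w) ^ 2 := by
    rw [← h]; field_simp
  have h2 : 2 * Real.sinh y ^ 2 = (1 - w) ^ 2 / (2 * w) := by
    rw [hs, div_pow, mul_pow, hes]; field_simp
  rw [hS, h2, coth, hs, hc]
  field_simp
  ring

/-- The coth identity with `w` replaced by `-w`; evenness of `k` is what keeps `w ^ k` unchanged. -/
theorem tanh_identity (y : ℝ) (k : ℕ) (hk : Even k) :
    -(k : ℝ) * (Real.sinh y / Real.cosh y)
        - (1 - Real.exp (-2 * y) ^ k) / (2 * Real.cosh y ^ 2) + k =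
      2 * (k - ∑ q ∈ Finset.range k, ((k : ℝ) - q) * ((-1) ^ q * Real.exp (-2 * y) ^ q)) := by
  set w := Real.exp (-2 * y) with hw
  have he : Real.exp y ≠ 0 := (Real.exp_pos y).ne'
  have hw2 : w = (Real.exp y)⁻¹ ^ 2 := by
    rw [hw, ← Real.exp_neg, ← Real.exp_nat_mul]; congr 1; push_cast; ring
  have hs : Real.sinh y = Real.exp y * (1 - w) / 2 := by
    rw [Real.sinh_eq, hw2, Real.exp_neg]; field_simp
  have hc : Real.cosh y = Real.exp y * (1 + w) / 2 := by
    rw [Real.cosh_eq, hw2, Real.exp_neg]; field_simp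
  have hw0 : 0 < w := Real.exp_pos _
  have h1w : 1 + w ≠ 0 := by positivity
  have hes : Real.exp y ^ 2 = w⁻¹ := by rw [hw2]; field_simp
  have h := sum_range_sub_mul_pow (-w) k
  have hq : ∀ q : ℕ, (-1 : ℝ) ^ q * w ^ q = (-w) ^ q := fun q => by rw [← mul_pow]; simp
  simp only [hq]
  rw [hk.neg_pow, sub_neg_eq_add] at h
  set S := ∑ q ∈ Finset.range k, ((k : ℝ) - q) * (-w) ^ q
  have hS : S = (k * (1 + w) - -w * (1 - w ^ k)) / (1 + w) ^ 2 := by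
    rw [← h]; field_simp
  have h2 : 2 * Real.cosh y ^ 2 = (1 + w) ^ 2 / (2 * w) := by
    rw [hc, div_pow, mul_pow, hes]; field_simp
  rw [hS, h2, hs, hc]
  field_simp
  ring

/-! ### Rational forms in the variables `cosh 2x_i`. -/

theorem cosh_two_sub_cosh_two (x y : ℝ) :
    Real.cosh (2 * x) - Real.cosh (2 * y) = 2 * (Real.sinh (x - y) * Real.sinh (x + y)) := by
  have h1 : 2 * x = (x + y) + (x - y) := by ring
  have h2 : 2 * y = (x + y) - (x - y) := by ring
  rw [h1, h2]
  generalize x + y = u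
  generalize x - y = v
  rw [Real.cosh_add, Real.cosh_sub]
  ring

theorem coth_sub_add_coth_add {x y : ℝ} (h1 : Real.sinh (x - y) ≠ 0) (h2 : Real.sinh (x + y) ≠ 0) :
    coth (x - y) + coth (x + y) =
      2 * Real.sinh (2 * x) / (Real.cosh (2 * x) - Real.cosh (2 * y)) := by
  have h3 : 2 * x = (x - y) + (x + y) := by ring
  rw [cosh_two_sub_cosh_two, coth, coth, h3]
  generalize x + y = u at *
  generalize x - y = v at *
  rw [Real.sinh_add]
  field_simp
  ring

theorem coth_neg (y : ℝ) : coth (-y) = -coth y := by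
  rw [coth, coth, Real.cosh_neg, Real.sinh_neg, div_neg]

theorem coth_sq {y : ℝ} (h : Real.sinh y ≠ 0) : coth y ^ 2 = 1 + (Real.sinh y ^ 2)⁻¹ := by
  rw [coth, div_pow, Real.cosh_sq]
  field_simp

theorem coth_eq_half {y : ℝ} (h : Real.sinh y ≠ 0) :
    coth y = Real.sinh (2 * y) / (Real.cosh (2 * y) - 1) := by
  have h2 : Real.cosh (2 * y) - 1 = 2 * Real.sinh y ^ 2 := by
    rw [Real.cosh_two_mul, Real.cosh_sq]; ring
  rw [h2, Real.sinh_two_mul, coth]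
  field_simp

theorem tanh_eq_half (y : ℝ) :
    Real.sinh y / Real.cosh y = Real.sinh (2 * y) / (Real.cosh (2 * y) + 1) := by
  have h2 : Real.cosh (2 * y) + 1 = 2 * Real.cosh y ^ 2 := by
    rw [Real.cosh_two_mul, Real.cosh_sq]; ring
  have := (Real.cosh_pos y).ne'
  rw [h2, Real.sinh_two_mul]
  field_simp

/-! ### The logarithmic derivative of the gauge factor -/

theorem sinh_sub_ne_zero {N : ℕ} {x : Fin N → ℝ} (hx : x ∈ regular N) {i j : Fin N}
    (hij : i ≠ j) : Real.sinh (x i - x j) ≠ 0 := fun h =>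
  (hx.2 i j hij).1 (sub_eq_zero.1 (Real.sinh_eq_zero.1 h))

theorem sinh_add_ne_zero {N : ℕ} {x : Fin N → ℝ} (hx : x ∈ regular N) {i j : Fin N}
    (hij : i ≠ j) : Real.sinh (x i + x j) ≠ 0 := fun h =>
  (hx.2 i j hij).2 (eq_neg_of_add_eq_zero_left (Real.sinh_eq_zero.1 h))

theorem sinh_ne_zero_of_regular {N : ℕ} {x : Fin N → ℝ} (hx : x ∈ regular N) (i : Fin N) :
    Real.sinh (x i) ≠ 0 := fun h => hx.1 i (Real.sinh_eq_zero.1 h)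

/-- `coth (x_i - x_j) + coth (x_i + x_j)` off the diagonal. -/
def cothPair {N : ℕ} (x : Fin N → ℝ) (i j : Fin N) : ℝ :=
  if i = j then 0 else coth (x i - x j) + coth (x i + x j)

/-- `b coth x_i + b' tanh x_i`. -/
def cothSingle {N : ℕ} (b b' : ℝ) (x : Fin N → ℝ) (i : Fin N) : ℝ :=
  b * coth (x i) + b' * (Real.sinh (x i) / Real.cosh (x i))

/-- The logarithmic derivative of the gauge factor in the direction of `x_i`. -/
def logDeriv {N : ℕ} (a b b' : ℝ) (x : Fin N → ℝ) (i : Fin N) : ℝ :=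
  a * ∑ j, cothPair x i j + cothSingle b b' x i

theorem cothPair_eq {N : ℕ} {x : Fin N → ℝ} (hx : x ∈ regular N) {i j : Fin N} (hij : i ≠ j) :
    cothPair x i j =
      2 * Real.sinh (2 * x i) / (Real.cosh (2 * x i) - Real.cosh (2 * x j)) := by
  rw [cothPair, if_neg hij, coth_sub_add_coth_add (sinh_sub_ne_zero hx hij)
    (sinh_add_ne_zero hx hij)]

theorem cosh_two_sub_ne_zero {N : ℕ} {x : Fin N → ℝ} (hx : x ∈ regular N) {i j : Fin N}
    (hij : i ≠ j) : Real.cosh (2 * x i) - Real.cosh (2 * x j) ≠ 0 := by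
  rw [cosh_two_sub_cosh_two]
  exact mul_ne_zero two_ne_zero (mul_ne_zero (sinh_sub_ne_zero hx hij) (sinh_add_ne_zero hx hij))

/-- With `X, Y, Z` the values of `cosh 2x`, the first product is `4(X² - 1)/((X - Y)(X - Z))`. The
cyclic sum is therefore the second divided difference of `4(X² - 1)`, its leading coefficient. -/
theorem cothPair_cyclic {N : ℕ} {x : Fin N → ℝ} (hx : x ∈ regular N) {i j l : Fin N}
    (hij : i ≠ j) (hjl : j ≠ l) (hil : i ≠ l) :
    cothPair x i j * cothPair x i l + cothPair x j l * cothPair x j i +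
      cothPair x l i * cothPair x l j = 4 := by
  rw [cothPair_eq hx hij, cothPair_eq hx hil, cothPair_eq hx hjl, cothPair_eq hx hij.symm,
    cothPair_eq hx hil.symm, cothPair_eq hx hjl.symm]
  have h1 := cosh_two_sub_ne_zero hx hij
  have h2 := cosh_two_sub_ne_zero hx hil
  have h3 := cosh_two_sub_ne_zero hx hjl
  have h4 := cosh_two_sub_ne_zero hx hij.symm
  have h5 := cosh_two_sub_ne_zero hx hil.symm
  have h6 := cosh_two_sub_ne_zero hx hjl.symm
  have e1 := Real.cosh_sq (2 * x i)
  have e2 := Real.cosh_sq (2 * x j)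
  have e3 := Real.cosh_sq (2 * x l)
  set X := Real.cosh (2 * x i)
  set Y := Real.cosh (2 * x j)
  set Z := Real.cosh (2 * x l)
  have h : ∀ s A B : ℝ, 2 * s / A * (2 * s / B) = 4 * s ^ 2 / (A * B) := fun s A B => by
    rw [div_mul_div_comm]; ring
  rw [h, h, h, eq_sub_iff_add_eq.2 e1.symm, eq_sub_iff_add_eq.2 e2.symm,
    eq_sub_iff_add_eq.2 e3.symm]
  rw [← neg_sub X Y, ← neg_sub X Z, ← neg_sub Y Z]
  field_simp
  ring

/-- Exchanging `i` and `j` changes the sign of `coth (x_i - x_j)` only, so the cross terms cancel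
and `coth² = 1 + 1/sinh²` finishes. -/
theorem cothPair_sq_add {N : ℕ} {x : Fin N → ℝ} (hx : x ∈ regular N) {i j : Fin N}
    (hij : i ≠ j) :
    cothPair x i j ^ 2 + cothPair x j i ^ 2 =
      4 + 2 * ((Real.sinh (x i - x j) ^ 2)⁻¹ + (Real.sinh (x i + x j) ^ 2)⁻¹) := by
  rw [cothPair, cothPair, if_neg hij, if_neg hij.symm, ← neg_sub (x i), coth_neg,
    add_comm (x j)]
  linear_combination 2 * coth_sq (sinh_sub_ne_zero hx hij) + 2 * coth_sq (sinh_add_ne_zero hx hij)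

/-- Each product is `2(b(X + 1) + b'(X - 1))/(X - Y)` with `X = cosh 2x_i`, `Y = cosh 2x_j`. The sum
is the divided difference of a linear polynomial, hence constant. -/
theorem cothPair_mul_cothSingle {N : ℕ} (b b' : ℝ) {x : Fin N → ℝ} (hx : x ∈ regular N)
    {i j : Fin N} (hij : i ≠ j) :
    cothPair x i j * cothSingle b b' x i + cothPair x j i * cothSingle b b' x j =
      2 * (b + b') := by
  have key : ∀ i j : Fin N, i ≠ j → cothPair x i j * cothSingle b b' x i =
      2 * (b * (Real.cosh (2 * x i) + 1) + b' * (Real.cosh (2 * x i) - 1)) /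
        (Real.cosh (2 * x i) - Real.cosh (2 * x j)) := by
    intro i j hij
    rw [cothPair_eq hx hij, cothSingle, coth_eq_half (sinh_ne_zero_of_regular hx i), tanh_eq_half]
    have h1 := cosh_two_sub_ne_zero hx hij
    have e1 := Real.cosh_sq (2 * x i)
    have hm : Real.cosh (2 * x i) - 1 ≠ 0 := by
      rw [Real.cosh_two_mul, Real.cosh_sq]
      ring_nf
      exact mul_ne_zero (pow_ne_zero 2 (sinh_ne_zero_of_regular hx i)) two_ne_zero
    have hp : Real.cosh (2 * x i) + 1 ≠ 0 := by
      have := Real.cosh_pos (2 * x i)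
      positivity
    have e2 : Real.sinh (2 * x i) ^ 2 = (Real.cosh (2 * x i) - 1) * (Real.cosh (2 * x i) + 1) := by
      rw [eq_sub_of_add_eq e1.symm]; ring
    generalize Real.cosh (2 * x i) = X at *
    generalize Real.sinh (2 * x i) = s at *
    have e3 : 2 * s / (X - Real.cosh (2 * x j)) * (b * (s / (X - 1)) + b' * (s / (X + 1))) =
      s ^ 2 * (2 / (X - Real.cosh (2 * x j)) * (b / (X - 1) + b' / (X + 1))) := by ring
    rw [e3, e2]
    field_simp
  rw [key i j hij, key j i hij.symm]
  have h1 := cosh_two_sub_ne_zero hx hij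
  rw [← neg_sub (Real.cosh (2 * x i)) (Real.cosh (2 * x j))]
  field_simp
  ring

/-- The diagonal part of the expanded square supplies the inverse squares of sinh; the part with
three distinct indices is constant by the cyclic identity. -/
theorem sum_cothPair_sq {N : ℕ} {x : Fin N → ℝ} (hx : x ∈ regular N) :
    ∑ k, (∑ j, cothPair x k j) ^ 2 =
      ∑ i, ∑ j ∈ Finset.Ioi i,
        2 * ((Real.sinh (x i - x j) ^ 2)⁻¹ + (Real.sinh (x i + x j) ^ 2)⁻¹) +
      N * (N - 1) * (4 * N - 2) / 3 := by
  set p := cothPair x with hp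
  have hp0 : ∀ i, p i i = 0 := fun i => by simp [hp, cothPair]
  let t : Fin N → Fin N → Fin N → ℝ := fun k j l => if j = l then 0 else p k j * p k l
  have h1 : ∑ k, (∑ j, p k j) ^ 2 = ∑ k, ∑ j, p k j ^ 2 + ∑ k, ∑ j, ∑ l, t k j l := by
    rw [← Finset.sum_add_distrib]
    refine Finset.sum_congr rfl fun k _ => ?_
    rw [pow_two, Finset.sum_mul_sum, ← Finset.sum_add_distrib]
    refine Finset.sum_congr rfl fun j _ => ?_
    have : ∀ l, p k j * p k l = (if j = l then p k j ^ 2 else 0) + t k j l := fun l => by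
      simp only [t]
      split_ifs with h
      · rw [h]; ring
      · ring
    simp only [this, Finset.sum_add_distrib, Finset.sum_ite_eq, Finset.mem_univ, if_true]
  have h2 : ∑ k, ∑ j, p k j ^ 2 = ∑ i, ∑ j ∈ Finset.Ioi i,
      (4 + 2 * ((Real.sinh (x i - x j) ^ 2)⁻¹ + (Real.sinh (x i + x j) ^ 2)⁻¹)) := by
    have : ∀ k j, p k j ^ 2 = if k = j then 0 else p k j ^ 2 := fun k j => by
      split_ifs with h
      · rw [h, hp0]; ring
      · rfl
    rw [Finset.sum_congr rfl fun k _ => Finset.sum_congr rfl fun j _ => this k j,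
      ← sum_Ioi_add_swap]
    exact Finset.sum_congr rfl fun i _ => Finset.sum_congr rfl fun j hj =>
      cothPair_sq_add hx (Finset.mem_Ioi.1 hj).ne
  have h3 : ∑ k, ∑ j, ∑ l, t k j l = 4 / 3 * (N * (N - 1) * (N - 2)) := by
    -- Summation over all triples is invariant under rotation of the indices, so three times the sum
    -- is the sum of the three rotations.
    have hrot : ∀ f : Fin N → Fin N → Fin N → ℝ,
        ∑ k, ∑ j, ∑ l, f k j l = ∑ k, ∑ j, ∑ l, f j l k := fun f => by
      symm
      rw [Finset.sum_comm]
      refine Finset.sum_congr rfl fun j _ => ?_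
      rw [Finset.sum_comm]
    have hc1 := hrot t
    have hc2 : ∑ k, ∑ j, ∑ l, t k j l = ∑ k, ∑ j, ∑ l, t l k j :=
      hc1.trans (hrot fun k j l => t j l k)
    -- The right side is `4` times the indicator that `k`, `j`, `l` are pairwise distinct; the last
    -- product of indicators corrects for all three being equal.
    have hcyc : ∀ k j l, t k j l + t j l k + t l k j =
        4 * (1 - (if k = j then 1 else 0) - (if j = l then 1 else 0) - (if k = l then 1 else 0)
          + 2 * ((if k = j then 1 else 0) * (if j = l then 1 else 0))) := by
      intro k j l
      by_cases h1 : k = j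
      · subst h1
        by_cases h2 : k = l
        · subst h2; simp [t]; ring
        · simp [t, h2, hp0, Ne.symm h2]
      · by_cases h2 : j = l
        · subst h2; simp [t, h1, Ne.symm h1, hp0]
        · by_cases h3 : k = l
          · subst h3; simp [t, h1, h2, hp0]
          · have := cothPair_cyclic hx h1 h2 h3
            simp only [t, h1, h2, h3, Ne.symm h3, if_false]
            rw [← hp] at this
            linarith
    have h3 : 3 * ∑ k, ∑ j, ∑ l, t k j l = ∑ k, ∑ j, ∑ l, (t k j l + t j l k + t l k j) := by
      simp only [Finset.sum_add_distrib]
      rw [← hc1, ← hc2]; ring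
    simp only [hcyc, ← Finset.mul_sum, Finset.sum_add_distrib, Finset.sum_sub_distrib,
      Finset.sum_ite_eq, Finset.mem_univ, if_true, Finset.sum_const, Finset.card_univ,
      Fintype.card_fin, nsmul_eq_mul, mul_one] at h3
    linarith
  rw [h1, h2, h3]
  simp only [Finset.sum_add_distrib, sum_Ioi_const]
  ring

theorem sum_cothPair_mul_cothSingle {N : ℕ} (b b' : ℝ) {x : Fin N → ℝ} (hx : x ∈ regular N) :
    ∑ k, (∑ j, cothPair x k j) * cothSingle b b' x k = (b + b') * (N * (N - 1)) := by
  have h : ∀ k j, cothPair x k j * cothSingle b b' x k =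
      if k = j then 0 else cothPair x k j * cothSingle b b' x k := fun k j => by
    split_ifs with h
    · simp [cothPair, h]
    · rfl
  simp only [Finset.sum_mul]
  rw [Finset.sum_congr rfl fun k _ => Finset.sum_congr rfl fun j _ => h k j, ← sum_Ioi_add_swap,
    Finset.sum_congr rfl fun i _ => Finset.sum_congr rfl fun j hj =>
      cothPair_mul_cothSingle b b' hx (Finset.mem_Ioi.1 hj).ne, sum_Ioi_const]
  ring

theorem cothSingle_sq {N : ℕ} (b b' : ℝ) {x : Fin N → ℝ} (hx : x ∈ regular N) (i : Fin N) :
    cothSingle b b' x i ^ 2 = (b + b') ^ 2 + b ^ 2 * (Real.sinh (x i) ^ 2)⁻¹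
      - b' ^ 2 * (Real.cosh (x i) ^ 2)⁻¹ := by
  have h1 := sinh_ne_zero_of_regular hx i
  have h2 := (Real.cosh_pos (x i)).ne'
  have h3 := Real.cosh_sq (x i)
  have h4 : (Real.sinh (x i) / Real.cosh (x i)) ^ 2 = 1 - (Real.cosh (x i) ^ 2)⁻¹ := by
    rw [div_pow]; field_simp; linarith
  have h5 : coth (x i) * (Real.sinh (x i) / Real.cosh (x i)) = 1 := by
    rw [coth]; field_simp
  rw [cothSingle]
  linear_combination b ^ 2 * coth_sq h1 + b' ^ 2 * h4 + 2 * b * b' * h5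

theorem sum_logDeriv_sq {N : ℕ} (a b b' : ℝ) {x : Fin N → ℝ} (hx : x ∈ regular N) :
    ∑ k, logDeriv a b b' x k ^ 2 =
      ∑ i : Fin N, (b + b' + 2 * a * ((N : ℝ) - 1 - (i : ℝ))) ^ 2 +
      2 * a ^ 2 * ∑ i, ∑ j ∈ Finset.Ioi i,
        ((Real.sinh (x i - x j) ^ 2)⁻¹ + (Real.sinh (x i + x j) ^ 2)⁻¹) +
      b ^ 2 * ∑ i, (Real.sinh (x i) ^ 2)⁻¹ - b' ^ 2 * ∑ i, (Real.cosh (x i) ^ 2)⁻¹ := by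
  have h : ∀ k, logDeriv a b b' x k ^ 2 = a ^ 2 * (∑ j, cothPair x k j) ^ 2 +
      2 * a * ((∑ j, cothPair x k j) * cothSingle b b' x k) + cothSingle b b' x k ^ 2 :=
    fun k => by rw [logDeriv]; ring
  simp only [h, Finset.sum_add_distrib, ← Finset.mul_sum, sum_cothPair_sq hx,
    sum_cothPair_mul_cothSingle b b' hx, cothSingle_sq b b' hx, Finset.sum_sub_distrib,
    sum_sq_affine, Finset.sum_const, Finset.card_univ, Fintype.card_fin, nsmul_eq_mul]
  ring

/-- Used twice: with `n` a multi-index for the cross term of the Laplacian, and with a unit vector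
to identify the derivative of `logMu`. -/
theorem sum_logDeriv_mul {N : ℕ} (a b b' : ℝ) (x n : Fin N → ℝ) :
    ∑ k, logDeriv a b b' x k * n k =
      a * ∑ i, ∑ j ∈ Finset.Ioi i,
        ((n i - n j) * coth (x i - x j) + (n i + n j) * coth (x i + x j)) +
      ∑ i, cothSingle b b' x i * n i := by
  have h : ∀ k, logDeriv a b b' x k * n k =
      a * ∑ j, (if k = j then 0 else (coth (x k - x j) + coth (x k + x j)) * n k) +
        cothSingle b b' x k * n k := fun k => by
    rw [logDeriv, add_mul, mul_assoc, Finset.sum_mul]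
    congr 2
    refine Finset.sum_congr rfl fun j _ => ?_
    rw [cothPair]
    split_ifs <;> ring
  simp only [h, Finset.sum_add_distrib, ← Finset.mul_sum]
  congr 2
  rw [← sum_Ioi_add_swap (N := N) (M := ℝ) (fun k j => (coth (x k - x j) + coth (x k + x j)) * n k)]
  simp only [← Finset.sum_add_distrib]
  refine Finset.sum_congr rfl fun i _ => ?_
  refine Finset.sum_congr rfl fun j _ => ?_
  rw [← neg_sub (x i), coth_neg, add_comm (x j)]
  ring

/-! ### Derivatives of the exponential monomials -/

/-- The real function `μ(x) exp(2 ∑ n_i x_i)`. -/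
def expFun (N : ℕ) (a b b' : ℝ) (n : Fin N → ℤ) (x : Fin N → ℝ) : ℝ :=
  mu N a b b' x * Real.exp (2 * ∑ i, (n i : ℝ) * x i)

theorem expMonomial_val {N : ℕ} (a b b' : ℝ) (n : Fin N → ℤ) {x : Fin N → ℝ}
    (hx : x ∈ regular N) : (expMonomial N a b b' n).1 x = (expFun N a b b' n x : ℂ) :=
  if_pos hx

/-- Reduces a partial derivative to one variable. Agreement with `g` on the open set `regular N`
suffices, since the line stays there for small `t`. -/
theorem partialDeriv_of_hasDerivAt {N : ℕ} (ψ : SmoothFun N ℂ) (g : (Fin N → ℝ) → ℝ)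
    (hg : ∀ y ∈ regular N, ψ.1 y = (g y : ℂ)) {x : Fin N → ℝ} (hx : x ∈ regular N) (k : Fin N)
    {v : ℝ} (h : HasDerivAt (fun t : ℝ => g (x + t • Pi.single k 1)) v 0) :
    (partialDeriv k ψ).1 x = (v : ℂ) := by
  have hline : HasDerivAt (fun t : ℝ => x + t • (Pi.single k 1 : Fin N → ℝ)) (Pi.single k 1) 0 := by
    simpa using ((hasDerivAt_id (0 : ℝ)).smul_const (Pi.single k 1 : Fin N → ℝ)).const_add x
  have h0 : x + (0 : ℝ) • (Pi.single k 1 : Fin N → ℝ) = x := by simp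
  have h1 : HasDerivAt (fun t : ℝ => ψ.1 (x + t • Pi.single k 1))
      (fderiv ℝ ψ.1 x (Pi.single k 1)) 0 := by
    have hd := (differentiableAt_of_mem ψ hx).hasFDerivAt
    rw [← h0] at hd
    have := hd.comp_hasDerivAt (0 : ℝ) hline
    rwa [h0] at this
  have h2 : HasDerivAt (fun t : ℝ => ψ.1 (x + t • Pi.single k 1)) (v : ℂ) 0 := by
    refine h.ofReal_comp.congr_of_eventuallyEq ?_
    have hn : ∀ᶠ y in nhds (x + (0 : ℝ) • (Pi.single k 1 : Fin N → ℝ)), y ∈ regular N := by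
      rw [h0]
      exact (isOpen_regular N).mem_nhds hx
    filter_upwards [hline.continuousAt.eventually hn] with t ht
    exact hg _ ht
  rw [partialDeriv_val _ _ hx, h1.unique h2]

/-- The logarithm of the gauge factor. -/
def logMu (N : ℕ) (a b b' : ℝ) (x : Fin N → ℝ) : ℝ :=
  a * ∑ i : Fin N, ∑ j ∈ Finset.Ioi i,
      (Real.log (Real.sinh (x i - x j)) + Real.log (Real.sinh (x i + x j))) +
    ∑ i, (b * Real.log (Real.sinh (x i)) + b' * Real.log (Real.cosh (x i)))

/-- `Real.log` ignores signs, so the absolute values in `mu` disappear in `logMu` and no case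
distinction between chambers is needed. -/
theorem mu_eq_exp {N : ℕ} (a b b' : ℝ) {x : Fin N → ℝ} (hx : x ∈ regular N) :
    mu N a b b' x = Real.exp (logMu N a b b' x) := by
  have h : ∀ y c : ℝ, y ≠ 0 → |y| ^ c = Real.exp (c * Real.log y) := fun y c hy => by
    rw [Real.rpow_def_of_pos (abs_pos.2 hy), Real.log_abs, mul_comm]
  rw [mu, logMu, Real.exp_add, Finset.mul_sum, Real.exp_sum, Real.exp_sum]
  congr 1
  · refine Finset.prod_congr rfl fun i _ => ?_
    rw [Finset.mul_sum, Real.exp_sum]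
    refine Finset.prod_congr rfl fun j hj => ?_
    have hij := (Finset.mem_Ioi.1 hj).ne
    rw [h _ _ (mul_ne_zero (sinh_sub_ne_zero hx hij) (sinh_add_ne_zero hx hij)),
      Real.log_mul (sinh_sub_ne_zero hx hij) (sinh_add_ne_zero hx hij)]
  · refine Finset.prod_congr rfl fun i _ => ?_
    rw [h _ _ (sinh_ne_zero_of_regular hx i), h _ _ (Real.cosh_pos _).ne', Real.exp_add]

theorem hasDerivAt_line {N : ℕ} (x : Fin N → ℝ) (k i : Fin N) :
    HasDerivAt (fun t : ℝ => (x + t • (Pi.single k 1 : Fin N → ℝ)) i)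
      ((Pi.single k 1 : Fin N → ℝ) i) 0 := by
  simpa using ((hasDerivAt_id (0 : ℝ)).mul_const ((Pi.single k 1 : Fin N → ℝ) i)).const_add (x i)

theorem hasDerivAt_logMu {N : ℕ} (a b b' : ℝ) {x : Fin N → ℝ} (hx : x ∈ regular N) (k : Fin N) :
    HasDerivAt (fun t : ℝ => logMu N a b b' (x + t • Pi.single k 1)) (logDeriv a b b' x k) 0 := by
  set e : Fin N → ℝ := Pi.single k 1 with he
  have hl := hasDerivAt_line x k
  rw [← he] at hl
  have h0 : ∀ i, (x + (0 : ℝ) • e) i = x i := fun i => by simp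
  have hlog : ∀ (u : ℝ → ℝ) (u' : ℝ), HasDerivAt u u' 0 → Real.sinh (u 0) ≠ 0 →
      HasDerivAt (fun t => Real.log (Real.sinh (u t))) (u' * coth (u 0)) 0 := fun u u' hu hs => by
    have := hu.sinh.log hs
    convert this using 1
    rw [coth]; ring
  have hval : logDeriv a b b' x k = a * ∑ i, ∑ j ∈ Finset.Ioi i,
        ((e i - e j) * coth (x i - x j) + (e i + e j) * coth (x i + x j)) +
      ∑ i, (b * (e i * coth (x i)) + b' * (Real.sinh (x i) * e i / Real.cosh (x i))) := by
    have h := sum_logDeriv_mul a b b' x e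
    have h1 : ∑ k', logDeriv a b b' x k' * e k' = logDeriv a b b' x k := by
      simp [he, Pi.single_apply]
    rw [← h1, h]
    congr 1
    refine Finset.sum_congr rfl fun i _ => ?_
    rw [cothSingle]; ring
  rw [hval]
  unfold logMu
  refine HasDerivAt.add (HasDerivAt.const_mul _ (HasDerivAt.fun_sum fun i _ =>
    HasDerivAt.fun_sum fun j hj => ?_)) (HasDerivAt.fun_sum fun i _ => ?_)
  · have hij := (Finset.mem_Ioi.1 hj).ne
    refine HasDerivAt.add ?_ ?_
    · have := hlog _ _ ((hl i).sub (hl j)) (by simpa using sinh_sub_ne_zero hx hij)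
      simpa using this
    · have := hlog _ _ ((hl i).add (hl j)) (by simpa using sinh_add_ne_zero hx hij)
      simpa using this
  · refine HasDerivAt.add (HasDerivAt.const_mul _ ?_) (HasDerivAt.const_mul _ ?_)
    · have := hlog _ _ (hl i) (by simpa using sinh_ne_zero_of_regular hx i)
      simpa using this
    · have := (hl i).cosh.log (Real.cosh_pos _).ne'
      simpa using this

theorem hasDerivAt_expFun {N : ℕ} (a b b' : ℝ) (n : Fin N → ℤ) {x : Fin N → ℝ}
    (hx : x ∈ regular N) (k : Fin N) :
    HasDerivAt (fun t : ℝ => expFun N a b b' n (x + t • Pi.single k 1))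
      ((logDeriv a b b' x k + 2 * n k) * expFun N a b b' n x) 0 := by
  have h0 : x + (0 : ℝ) • (Pi.single k 1 : Fin N → ℝ) = x := by simp
  have hlin : HasDerivAt (fun t : ℝ => 2 * ∑ i, (n i : ℝ) * (x + t • (Pi.single k 1 : Fin N → ℝ)) i)
      (2 * n k) 0 := by
    have h := HasDerivAt.const_mul (2 : ℝ) (HasDerivAt.fun_sum (u := Finset.univ)
      fun i _ => (hasDerivAt_line x k i).const_mul (n i : ℝ))
    exact h.congr_deriv (by simp [Pi.single_apply])
  have h := ((hasDerivAt_logMu a b b' hx k).add hlin).exp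
  refine HasDerivAt.congr_of_eventuallyEq (f₁ := _) (h.congr_deriv ?_) ?_
  · change Real.exp (logMu N a b b' (x + (0 : ℝ) • (Pi.single k 1 : Fin N → ℝ)) +
      2 * ∑ i, (n i : ℝ) * (x + (0 : ℝ) • (Pi.single k 1 : Fin N → ℝ)) i) * _ = _
    rw [h0, expFun, mu_eq_exp a b b' hx, Real.exp_add]
    ring
  · have hn : ∀ᶠ y in nhds (x + (0 : ℝ) • (Pi.single k 1 : Fin N → ℝ)), y ∈ regular N := by
      rw [h0]
      exact (isOpen_regular N).mem_nhds hx
    have hc : ContinuousAt (fun t : ℝ => x + t • (Pi.single k 1 : Fin N → ℝ)) 0 := by fun_prop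
    filter_upwards [hc.eventually hn] with t ht
    simp only [Pi.add_apply, expFun, mu_eq_exp a b b' ht, Real.exp_add]

/-- The derivative of `logDeriv a b b' x k` in the direction of `x_k`. -/
def logDerivDeriv {N : ℕ} (a b b' : ℝ) (x : Fin N → ℝ) (k : Fin N) : ℝ :=
  a * ∑ j, (if k = j then 0 else
      -((Real.sinh (x k - x j) ^ 2)⁻¹ + (Real.sinh (x k + x j) ^ 2)⁻¹)) +
    (b * -(Real.sinh (x k) ^ 2)⁻¹ + b' * (Real.cosh (x k) ^ 2)⁻¹)

theorem hasDerivAt_coth {y : ℝ} (hy : Real.sinh y ≠ 0) :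
    HasDerivAt coth (-(Real.sinh y ^ 2)⁻¹) y := by
  refine ((Real.hasDerivAt_cosh y).div (Real.hasDerivAt_sinh y) hy).congr_deriv ?_
  have := Real.cosh_sq y
  field_simp
  linarith

theorem hasDerivAt_tanh (y : ℝ) :
    HasDerivAt (fun y => Real.sinh y / Real.cosh y) ((Real.cosh y ^ 2)⁻¹) y := by
  refine ((Real.hasDerivAt_sinh y).div (Real.hasDerivAt_cosh y)
    (Real.cosh_pos y).ne').congr_deriv ?_
  have := Real.cosh_sq y
  have := (Real.cosh_pos y).ne'
  field_simp
  linarith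

theorem hasDerivAt_logDeriv {N : ℕ} (a b b' : ℝ) {x : Fin N → ℝ} (hx : x ∈ regular N)
    (k : Fin N) :
    HasDerivAt (fun t : ℝ => logDeriv a b b' (x + t • Pi.single k 1) k)
      (logDerivDeriv a b b' x k) 0 := by
  set e : Fin N → ℝ := Pi.single k 1 with he
  have hl := hasDerivAt_line x k
  rw [← he] at hl
  have hk : e k = 1 := by simp [he]
  have hcoth : ∀ (u : ℝ → ℝ) (u' y : ℝ), HasDerivAt u u' 0 → u 0 = y → u' = 1 →
      Real.sinh y ≠ 0 → HasDerivAt (fun t => coth (u t)) (-(Real.sinh y ^ 2)⁻¹) 0 := by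
    intro u u' y hu hy hu' hs
    subst hy hu'
    have := (hasDerivAt_coth hs).comp (0 : ℝ) hu
    rwa [mul_one] at this
  unfold logDeriv logDerivDeriv
  refine HasDerivAt.add (HasDerivAt.const_mul _ (HasDerivAt.fun_sum fun j _ => ?_))
    (HasDerivAt.add (HasDerivAt.const_mul _ ?_) (HasDerivAt.const_mul _ ?_))
  · unfold cothPair
    split_ifs with h
    · exact hasDerivAt_const _ _
    · have hj : e j = 0 := by simp [he, Ne.symm h]
      rw [neg_add]
      exact (hcoth _ _ _ ((hl k).sub (hl j)) (by simp) (by simp [hk, hj])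
        (sinh_sub_ne_zero hx h)).add (hcoth _ _ _ ((hl k).add (hl j)) (by simp) (by simp [hk, hj])
        (sinh_add_ne_zero hx h))
  · exact hcoth _ _ _ (hl k) (by simp) hk (sinh_ne_zero_of_regular hx k)
  · have := (hasDerivAt_tanh ((x + (0 : ℝ) • e) k)).comp (0 : ℝ) (hl k)
    simpa [hk, Function.comp_def] using this

theorem partialDeriv_partialDeriv_expMonomial {N : ℕ} (a b b' : ℝ) (n : Fin N → ℤ)
    {x : Fin N → ℝ} (hx : x ∈ regular N) (k : Fin N) :
    (partialDeriv k (partialDeriv k (expMonomial N a b b' n))).1 x =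
      (((logDerivDeriv a b b' x k + (logDeriv a b b' x k + 2 * n k) ^ 2) *
        expFun N a b b' n x : ℝ) : ℂ) := by
  refine partialDeriv_of_hasDerivAt _
    (fun y => (logDeriv a b b' y k + 2 * n k) * expFun N a b b' n y) (fun y hy => ?_) hx k ?_
  · exact partialDeriv_of_hasDerivAt _ _ (fun z hz => expMonomial_val a b b' n hz) hy k
      (hasDerivAt_expFun a b b' n hy k)
  · have h := ((hasDerivAt_logDeriv a b b' hx k).add_const (2 * n k : ℝ)).mul
      (hasDerivAt_expFun a b b' n hx k)
    refine h.congr_deriv ?_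
    have h0 : x + (0 : ℝ) • (Pi.single k 1 : Fin N → ℝ) = x := by simp
    simp only [h0]
    ring

theorem sum_logDerivDeriv {N : ℕ} (a b b' : ℝ) (x : Fin N → ℝ) :
    ∑ k, logDerivDeriv a b b' x k = -(2 * a * ∑ i, ∑ j ∈ Finset.Ioi i,
        ((Real.sinh (x i - x j) ^ 2)⁻¹ + (Real.sinh (x i + x j) ^ 2)⁻¹)) -
      b * ∑ i, (Real.sinh (x i) ^ 2)⁻¹ + b' * ∑ i, (Real.cosh (x i) ^ 2)⁻¹ := by
  simp only [logDerivDeriv, Finset.sum_add_distrib (s := Finset.univ (α := Fin N)),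
    ← Finset.mul_sum]
  rw [← sum_Ioi_add_swap (N := N) (M := ℝ) (fun k j =>
    -((Real.sinh (x k - x j) ^ 2)⁻¹ + (Real.sinh (x k + x j) ^ 2)⁻¹))]
  have h : ∀ i j : Fin N, -((Real.sinh (x i - x j) ^ 2)⁻¹ + (Real.sinh (x i + x j) ^ 2)⁻¹) +
      -((Real.sinh (x j - x i) ^ 2)⁻¹ + (Real.sinh (x j + x i) ^ 2)⁻¹) =
      -2 * ((Real.sinh (x i - x j) ^ 2)⁻¹ + (Real.sinh (x i + x j) ^ 2)⁻¹) := fun i j => by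
    rw [← neg_sub (x i), Real.sinh_neg, neg_sq, add_comm (x j)]; ring
  simp only [h, ← Finset.mul_sum, Finset.sum_neg_distrib]
  ring

/-! ### The scalar operator is triangular -/

/-- The span of the exponential monomials in `R_m` with exponent shorter than `n`. -/
def lowerSpace (N : ℕ) (a b b' : ℝ) (m : ℕ) (n : Fin N → ℤ) : Submodule ℂ (SmoothFun N ℂ) :=
  Submodule.span ℂ {f | ∃ n' : Fin N → ℤ, (∀ i, -(m : ℤ) ≤ n' i ∧ n' i ≤ m) ∧
    ∑ i, n' i ^ 2 < ∑ i, n i ^ 2 ∧ f = expMonomial N a b b' n'}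

theorem expFun_sub_smul {N : ℕ} (a b b' : ℝ) (n r : Fin N → ℤ) (q : ℕ) (x : Fin N → ℝ) :
    expFun N a b b' (n - q • r) x =
      Real.exp (-2 * ∑ i, (r i : ℝ) * x i) ^ q * expFun N a b b' n x := by
  rw [expFun, expFun, ← Real.exp_nat_mul, mul_left_comm, ← Real.exp_add]
  congr 2
  have h : ∀ i, (((n - q • r) i : ℤ) : ℝ) = n i - q * r i := fun i => by simp
  simp only [h, sub_mul, Finset.sum_sub_distrib, mul_assoc, ← Finset.mul_sum]
  ring

/-- Multiplying `f_n` by the `q`-th power of the exponential gives `f_{n - q r}`, and the term `q =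
0` of the sum cancels `k`. The sign `ε` is `1` for coth and `-1` for tanh. -/
theorem lower_sum {N : ℕ} (a b b' : ℝ) {m : ℕ} {n r : Fin N → ℤ} {k : ℕ} (ε : ℝ)
    (hr : ∀ q : ℕ, 0 < q → q < k → (∀ i, -(m : ℤ) ≤ (n - q • r) i ∧ (n - q • r) i ≤ m) ∧
      ∑ i, (n - q • r) i ^ 2 < ∑ i, n i ^ 2) :
    ∃ φ ∈ lowerSpace N a b b' m n, ∀ x ∈ regular N, φ.1 x =
      ((2 * (k - ∑ q ∈ Finset.range k,
        ((k : ℝ) - q) * (ε ^ q * Real.exp (-2 * ∑ i, (r i : ℝ) * x i) ^ q)) *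
          expFun N a b b' n x : ℝ) : ℂ) := by
  rcases k with _ | k
  · exact ⟨0, Submodule.zero_mem _, fun x _ => by simp; rfl⟩
  refine ⟨∑ q ∈ Finset.range k, ((-2 * (((k + 1 : ℕ) : ℝ) - (q + 1 : ℕ)) * ε ^ (q + 1) : ℝ) : ℂ) •
    expMonomial N a b b' (n - (q + 1) • r), Submodule.sum_mem _ fun q hq =>
      Submodule.smul_mem _ _ (Submodule.subset_span ⟨_, (hr (q + 1) q.succ_pos ?_).1,
        (hr (q + 1) q.succ_pos ?_).2, rfl⟩), fun x hx => ?_⟩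
  · simpa using hq
  · simpa using hq
  · have hsum : ∀ (s : Finset ℕ) (f : ℕ → SmoothFun N ℂ),
        (∑ q ∈ s, f q).1 x = ∑ q ∈ s, (f q).1 x := fun s f => by
      induction s using Finset.induction_on with
      | empty => simp; rfl
      | insert q s hq ih => rw [Finset.sum_insert hq, Finset.sum_insert hq, SmoothFun.add_val, ih]
    rw [hsum]
    simp only [SmoothFun.smul_val, expMonomial_val a b b' _ hx, expFun_sub_smul, smul_eq_mul,
      ← Complex.ofReal_mul, ← Complex.ofReal_sum]
    congr 1
    generalize Real.exp (-2 * ∑ i, (r i : ℝ) * x i) = W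
    rw [Finset.sum_range_succ']
    simp only [Nat.cast_zero, sub_zero, pow_zero, mul_one]
    rw [sub_add_cancel_right, mul_neg, neg_mul, Finset.mul_sum, Finset.sum_mul,
      ← Finset.sum_neg_distrib]
    refine Finset.sum_congr rfl fun q _ => ?_
    ring

theorem lower_coth {N : ℕ} (a b b' : ℝ) {m : ℕ} {n r : Fin N → ℤ} {k : ℕ}
    (hr : ∀ q : ℕ, 0 < q → q < k → (∀ i, -(m : ℤ) ≤ (n - q • r) i ∧ (n - q • r) i ≤ m) ∧
      ∑ i, (n - q • r) i ^ 2 < ∑ i, n i ^ 2)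
    (y : (Fin N → ℝ) → ℝ) (hy : ∀ x, ∑ i, (r i : ℝ) * x i = y x)
    (hs : ∀ x ∈ regular N, Real.sinh (y x) ≠ 0) :
    ∃ φ ∈ lowerSpace N a b b' m n, ∀ x ∈ regular N, φ.1 x =
      ((-(k : ℝ) * coth (y x) * expFun N a b b' n x +
        (expFun N a b b' n x - expFun N a b b' (n - k • r) x) / (2 * Real.sinh (y x) ^ 2) +
        k * expFun N a b b' n x : ℝ) : ℂ) := by
  obtain ⟨φ, h1, h2⟩ := lower_sum a b b' 1 hr
  refine ⟨φ, h1, fun x hx => ?_⟩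
  rw [h2 x hx, hy, expFun_sub_smul, hy]
  simp only [one_pow, one_mul]
  rw [← coth_identity (hs x hx)]
  congr 1
  ring

theorem lower_tanh {N : ℕ} (a b b' : ℝ) {m : ℕ} {n r : Fin N → ℤ} {k : ℕ} (hk : Even k)
    (hr : ∀ q : ℕ, 0 < q → q < k → (∀ i, -(m : ℤ) ≤ (n - q • r) i ∧ (n - q • r) i ≤ m) ∧
      ∑ i, (n - q • r) i ^ 2 < ∑ i, n i ^ 2)
    (y : (Fin N → ℝ) → ℝ) (hy : ∀ x, ∑ i, (r i : ℝ) * x i = y x) :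
    ∃ φ ∈ lowerSpace N a b b' m n, ∀ x ∈ regular N, φ.1 x =
      ((-(k : ℝ) * (Real.sinh (y x) / Real.cosh (y x)) * expFun N a b b' n x -
        (expFun N a b b' n x - expFun N a b b' (n - k • r) x) / (2 * Real.cosh (y x) ^ 2) +
        k * expFun N a b b' n x : ℝ) : ℂ) := by
  obtain ⟨φ, h1, h2⟩ := lower_sum a b b' (-1) hr
  refine ⟨φ, h1, fun x hx => ?_⟩
  rw [h2 x hx, hy, expFun_sub_smul, hy, ← tanh_identity _ _ hk]
  congr 1
  ring

/-- Reverse the signs of the entries of a multi-index with position in `T`. -/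
def flipInts {N : ℕ} (T : Finset (Fin N)) (n : Fin N → ℤ) : Fin N → ℤ :=
  fun i => if i ∈ T then -n i else n i

/-- The hypothesis says that `n - k r` is the reflection of `n` in `r`. Then `|n - q r|² = |n|² - q
(k - q) |r|²`, which is smaller strictly inside the string. -/
theorem sum_sq_sub_smul_lt {N : ℕ} {n r : Fin N → ℤ} {k : ℕ}
    (h : 2 * ∑ i, n i * r i = k * ∑ i, r i * r i) (hr : 0 < ∑ i, r i * r i) {q : ℕ} (hq : 0 < q)
    (hqk : q < k) : ∑ i, (n - q • r) i ^ 2 < ∑ i, n i ^ 2 := by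
  have h1 : ∑ i, (n - q • r) i ^ 2 =
      ∑ i, n i ^ 2 - q * (2 * ∑ i, n i * r i) + q ^ 2 * ∑ i, r i * r i := by
    rw [Finset.mul_sum, Finset.mul_sum, Finset.mul_sum, ← Finset.sum_sub_distrib,
      ← Finset.sum_add_distrib]
    refine Finset.sum_congr rfl fun i _ => ?_
    have e : (n - q • r) i = n i - q * r i := by simp
    rw [e]
    ring
  have h2 : (0 : ℤ) < q * ((k : ℤ) - q) * ∑ i, r i * r i := by
    have : (0 : ℤ) < (k : ℤ) - q := by omega
    positivity
  rw [h1, h]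
  nlinarith

/-- Minus the sum of the squares of the leading asymptotics. -/
def scalarEnergy {N : ℕ} (a b b' : ℝ) (n : Fin N → ℤ) : ℝ :=
  -∑ i : Fin N, (2 * (n i : ℝ) + b + b' + 2 * a * ((N : ℝ) - 1 - (i : ℝ))) ^ 2

section roots

variable {N : ℕ} (a b b' : ℝ) {m : ℕ} {n : Fin N → ℤ}

/-- Root `e_i - e_j` with string length `n_i - n_j`. The entries on the string stay between `n_j`
and `n_i`, hence in the box. -/
theorem lower_sub (h0 : ∀ i, 0 ≤ n i) (hm : ∀ i, n i ≤ m) {i j : Fin N} (hij : i ≠ j)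
    (hle : n j ≤ n i) :
    ∃ φ ∈ lowerSpace N a b b' m n, ∀ x ∈ regular N, φ.1 x =
      ((-((n i : ℝ) - n j) * coth (x i - x j) * expFun N a b b' n x +
        (expFun N a b b' n x - expFun N a b b' (n ∘ Equiv.swap i j) x) /
          (2 * Real.sinh (x i - x j) ^ 2) +
        ((n i : ℝ) - n j) * expFun N a b b' n x : ℝ) : ℂ) := by
  set r : Fin N → ℤ := Pi.single i 1 - Pi.single j 1 with hr
  obtain ⟨k, hk⟩ := Int.eq_ofNat_of_zero_le (sub_nonneg.2 hle)
  have hri : r i = 1 := by simp [hr, hij]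
  have hrj : r j = -1 := by simp [hr, hij.symm]
  have hrl : ∀ l, l ≠ i → l ≠ j → r l = 0 := fun l h1 h2 => by simp [hr, h1, h2]
  have hv : ∀ v : Fin N → ℤ, ∑ l, v l * r l = v i - v j := fun v => by
    simp [hr, mul_sub, Finset.sum_sub_distrib, Pi.single_apply]
  have hswap : n - k • r = n ∘ Equiv.swap i j := by
    funext l
    by_cases h1 : l = i
    · subst h1; simp [hri]; linarith
    by_cases h2 : l = j
    · subst h2; simp [hrj]; linarith
    simp [hrl l h1 h2, Equiv.swap_apply_of_ne_of_ne h1 h2]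
  have hkR : (n i : ℝ) - n j = k := by exact_mod_cast hk
  obtain ⟨φ, h1, h2⟩ := lower_coth a b b' (m := m) (n := n) (r := r) (k := k) (fun q hq hqk => by
    refine ⟨fun l => ?_, sum_sq_sub_smul_lt (by rw [hv, hv, hri, hrj, hk]; ring)
      (by rw [hv, hri, hrj]; norm_num) hq hqk⟩
    have e : (n - q • r) l = n l - q * r l := by simp
    rw [e]
    have := hm i; have := hm j; have := h0 i; have := h0 j; have := hm l; have := h0 l
    by_cases h1 : l = i
    · subst h1; rw [hri]; omega
    by_cases h2 : l = j
    · subst h2; rw [hrj]; omega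
    rw [hrl l h1 h2]; omega) (fun x => x i - x j)
    (fun x => by simp [hr, sub_mul, Finset.sum_sub_distrib, Pi.single_apply])
    (fun x hx => sinh_sub_ne_zero hx hij)
  refine ⟨φ, h1, fun x hx => ?_⟩
  rw [h2 x hx, hswap, hkR]

/-- Root `e_i + e_j` with string length `n_i + n_j`. The entries descend no further than `-n_j` and
`-n_i`, which is why the box must be symmetric about `0`. -/
theorem lower_add (h0 : ∀ i, 0 ≤ n i) (hm : ∀ i, n i ≤ m) {i j : Fin N} (hij : i ≠ j) :
    ∃ φ ∈ lowerSpace N a b b' m n, ∀ x ∈ regular N, φ.1 x =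
      ((-((n i : ℝ) + n j) * coth (x i + x j) * expFun N a b b' n x +
        (expFun N a b b' n x - expFun N a b b' (flipInts {i, j} (n ∘ Equiv.swap i j)) x) /
          (2 * Real.sinh (x i + x j) ^ 2) +
        ((n i : ℝ) + n j) * expFun N a b b' n x : ℝ) : ℂ) := by
  set r : Fin N → ℤ := Pi.single i 1 + Pi.single j 1 with hr
  obtain ⟨k, hk⟩ := Int.eq_ofNat_of_zero_le (add_nonneg (h0 i) (h0 j))
  have hri : r i = 1 := by simp [hr, hij]
  have hrj : r j = 1 := by simp [hr, hij.symm]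
  have hrl : ∀ l, l ≠ i → l ≠ j → r l = 0 := fun l h1 h2 => by simp [hr, h1, h2]
  have hv : ∀ v : Fin N → ℤ, ∑ l, v l * r l = v i + v j := fun v => by
    simp [hr, mul_add, Finset.sum_add_distrib, Pi.single_apply]
  have hswap : n - k • r = flipInts {i, j} (n ∘ Equiv.swap i j) := by
    funext l
    by_cases h1 : l = i
    · subst h1; simp [flipInts, hri]; linarith
    by_cases h2 : l = j
    · subst h2; simp [flipInts, hrj]; linarith
    simp [flipInts, hrl l h1 h2, h1, h2, Equiv.swap_apply_of_ne_of_ne h1 h2]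
  have hkR : (n i : ℝ) + n j = k := by exact_mod_cast hk
  obtain ⟨φ, h1, h2⟩ := lower_coth a b b' (m := m) (n := n) (r := r) (k := k) (fun q hq hqk => by
    refine ⟨fun l => ?_, sum_sq_sub_smul_lt (by rw [hv, hv, hri, hrj, hk]; ring)
      (by rw [hv, hri, hrj]; norm_num) hq hqk⟩
    have e : (n - q • r) l = n l - q * r l := by simp
    rw [e]
    have := hm i; have := hm j; have := h0 i; have := h0 j; have := hm l; have := h0 l
    by_cases h1 : l = i
    · subst h1; rw [hri]; omega
    by_cases h2 : l = j
    · subst h2; rw [hrj]; omega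
    rw [hrl l h1 h2]; omega) (fun x => x i + x j)
    (fun x => by simp [hr, add_mul, Finset.sum_add_distrib, Pi.single_apply])
    (fun x hx => sinh_add_ne_zero hx hij)
  refine ⟨φ, h1, fun x hx => ?_⟩
  rw [h2 x hx, hswap, hkR]

/-- Root `e_i` with string length `2 n_i`, whose evenness is what the tanh version needs. -/
theorem lower_single (h0 : ∀ i, 0 ≤ n i) (hm : ∀ i, n i ≤ m) (i : Fin N) :
    (∃ φ ∈ lowerSpace N a b b' m n, ∀ x ∈ regular N, φ.1 x =
      ((-(2 * (n i : ℝ)) * coth (x i) * expFun N a b b' n x +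
        (expFun N a b b' n x - expFun N a b b' (flipInts {i} n) x) /
          (2 * Real.sinh (x i) ^ 2) + (2 * (n i : ℝ)) * expFun N a b b' n x : ℝ) : ℂ)) ∧
    ∃ φ ∈ lowerSpace N a b b' m n, ∀ x ∈ regular N, φ.1 x =
      ((-(2 * (n i : ℝ)) * (Real.sinh (x i) / Real.cosh (x i)) * expFun N a b b' n x -
        (expFun N a b b' n x - expFun N a b b' (flipInts {i} n) x) /
          (2 * Real.cosh (x i) ^ 2) + (2 * (n i : ℝ)) * expFun N a b b' n x : ℝ) : ℂ) := by
  set r : Fin N → ℤ := Pi.single i 1 with hr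
  obtain ⟨p, hp⟩ := Int.eq_ofNat_of_zero_le (h0 i)
  have hk : 2 * n i = ((2 * p : ℕ) : ℤ) := by rw [hp]; push_cast; ring
  have hri : r i = 1 := by simp [hr]
  have hrl : ∀ l, l ≠ i → r l = 0 := fun l h1 => by simp [hr, h1]
  have hv : ∀ v : Fin N → ℤ, ∑ l, v l * r l = v i := fun v => by
    simp [hr, Pi.single_apply]
  have hflip : n - (2 * p) • r = flipInts {i} n := by
    funext l
    by_cases h1 : l = i
    · subst h1; simp [flipInts, hri]; linarith
    simp [flipInts, hrl l h1, h1]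
  have hkR : 2 * (n i : ℝ) = (2 * p : ℕ) := by exact_mod_cast hk
  have hq : ∀ q : ℕ, 0 < q → q < 2 * p →
      (∀ i, -(m : ℤ) ≤ (n - q • r) i ∧ (n - q • r) i ≤ m) ∧
        ∑ i, (n - q • r) i ^ 2 < ∑ i, n i ^ 2 := fun q hq hqk => by
    refine ⟨fun l => ?_, sum_sq_sub_smul_lt (by rw [hv, hv, hri, hk]; ring)
      (by rw [hv, hri]; norm_num) hq hqk⟩
    have e : (n - q • r) l = n l - q * r l := by simp
    rw [e]
    have := hm i; have := h0 i; have := hm l; have := h0 l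
    by_cases h1 : l = i
    · subst h1; rw [hri]; omega
    rw [hrl l h1]; omega
  have hy : ∀ x : Fin N → ℝ, ∑ l, (r l : ℝ) * x l = x i := fun x => by
    simp [hr, Pi.single_apply]
  constructor
  · obtain ⟨φ, h1, h2⟩ := lower_coth a b b' hq (fun x => x i) hy
      (fun x hx => sinh_ne_zero_of_regular hx i)
    refine ⟨φ, h1, fun x hx => ?_⟩
    rw [h2 x hx, hflip, hkR]
  · obtain ⟨φ, h1, h2⟩ := lower_tanh a b b' (even_two_mul p) hq (fun x => x i) hy
    refine ⟨φ, h1, fun x hx => ?_⟩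
    rw [h2 x hx, hflip, hkR]

end roots

/-- The scalar part of the potential, with the spin operators replaced by the opposites of the
coordinate operators, applied to `expFun N a b b' n`. -/
def scalarPotential {N : ℕ} (a b b' : ℝ) (n : Fin N → ℤ) (x : Fin N → ℝ) : ℝ :=
  2 * a * ∑ i, ∑ j ∈ Finset.Ioi i,
      ((Real.sinh (x i - x j) ^ 2)⁻¹ * (a * expFun N a b b' n x -
          expFun N a b b' (n ∘ Equiv.swap i j) x) +
        (Real.sinh (x i + x j) ^ 2)⁻¹ * (a * expFun N a b b' n x -
          expFun N a b b' (flipInts {i, j} (n ∘ Equiv.swap i j)) x)) +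
    b * ∑ i, (Real.sinh (x i) ^ 2)⁻¹ * (b * expFun N a b b' n x -
          expFun N a b b' (flipInts {i} n) x) -
    b' * ∑ i, (Real.cosh (x i) ^ 2)⁻¹ * (b' * expFun N a b b' n x -
          expFun N a b b' (flipInts {i} n) x)

/-- The number of `j > i` is `N - 1 - i`; this is the origin of the position-dependent shift in the
energy. -/
theorem sum_Ioi_mul_left {N : ℕ} (f : Fin N → ℝ) :
    ∑ i : Fin N, ∑ _j ∈ Finset.Ioi i, f i = ∑ i : Fin N, f i * ((N : ℝ) - 1 - (i : ℝ)) := by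
  refine Finset.sum_congr rfl fun i _ => ?_
  rw [Finset.sum_const, Fin.card_Ioi, nsmul_eq_mul, Nat.sub_sub, Nat.cast_sub (by omega)]
  push_cast; ring

theorem smoothFun_sum_val {N : ℕ} {F ι : Type*} [NormedAddCommGroup F] [NormedSpace ℂ F]
    [NormedSpace ℝ F] [SMulCommClass ℝ ℂ F] (s : Finset ι) (f : ι → SmoothFun N F)
    (x : Fin N → ℝ) : (∑ i ∈ s, f i).1 x = ∑ i ∈ s, (f i).1 x :=
  map_sum ((LinearMap.proj x : ((Fin N → ℝ) → F) →ₗ[ℂ] F) ∘ₗ (smoothFun N F).subtype) f s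

/-- In `(L_k + 2 n_k)²` the squares `L_k²` cancel the `a²`, `b²`, `b'²` parts of the potential, and
the derivatives of `L_k` turn each `-K` into `1 - K`. What is left, apart from constants, is the
coth and tanh terms from `4 n_k L_k`, so the root-string lemmas apply; the multiples of `f_n` that
they need add up to the `n`-linear part of the energy. -/
theorem scalar_triangular {N : ℕ} (a b b' : ℝ) {m : ℕ} {n : Fin N → ℤ} (hn : Antitone n)
    (h0 : ∀ i, 0 ≤ n i) (hm : ∀ i, n i ≤ m) :
    ∃ φ ∈ lowerSpace N a b b' m n, ∀ x ∈ regular N, φ.1 x =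
      ((-∑ k, (logDerivDeriv a b b' x k + (logDeriv a b b' x k + 2 * n k) ^ 2) *
        expFun N a b b' n x + scalarPotential a b b' n x -
          scalarEnergy a b b' n * expFun N a b b' n x : ℝ) : ℂ) := by
  have hsub : ∀ i j : Fin N, ∃ φ ∈ lowerSpace N a b b' m n, i < j → ∀ x ∈ regular N, φ.1 x =
      ((-((n i : ℝ) - n j) * coth (x i - x j) * expFun N a b b' n x +
        (expFun N a b b' n x - expFun N a b b' (n ∘ Equiv.swap i j) x) /
          (2 * Real.sinh (x i - x j) ^ 2) +
        ((n i : ℝ) - n j) * expFun N a b b' n x : ℝ) : ℂ) := fun i j => by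
    by_cases hij : i < j
    · obtain ⟨φ, h1, h2⟩ := lower_sub a b b' h0 hm hij.ne (hn hij.le)
      exact ⟨φ, h1, fun _ => h2⟩
    · exact ⟨0, Submodule.zero_mem _, fun h => absurd h hij⟩
  have hadd : ∀ i j : Fin N, ∃ φ ∈ lowerSpace N a b b' m n, i < j → ∀ x ∈ regular N, φ.1 x =
      ((-((n i : ℝ) + n j) * coth (x i + x j) * expFun N a b b' n x +
        (expFun N a b b' n x - expFun N a b b' (flipInts {i, j} (n ∘ Equiv.swap i j)) x) /
          (2 * Real.sinh (x i + x j) ^ 2) +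
        ((n i : ℝ) + n j) * expFun N a b b' n x : ℝ) : ℂ) := fun i j => by
    by_cases hij : i < j
    · obtain ⟨φ, h1, h2⟩ := lower_add a b b' h0 hm hij.ne
      exact ⟨φ, h1, fun _ => h2⟩
    · exact ⟨0, Submodule.zero_mem _, fun h => absurd h hij⟩
  choose φ₁ hφ₁ hv₁ using hsub
  choose φ₂ hφ₂ hv₂ using hadd
  choose φ₃ hφ₃ hv₃ using fun i => (lower_single a b b' h0 hm i).1
  choose φ₄ hφ₄ hv₄ using fun i => (lower_single a b b' h0 hm i).2
  -- The weights are forced by `(1 - K)/(2 sinh²)` in the string lemmas against `2a (1 - K)/sinh²`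
  -- and `b (1 - K)/sinh²` here, and likewise for cosh.
  refine ⟨((4 * a : ℝ) : ℂ) • (∑ i, ∑ j ∈ Finset.Ioi i, (φ₁ i j + φ₂ i j)) +
    ∑ i, (((2 * b : ℝ) : ℂ) • φ₃ i + ((2 * b' : ℝ) : ℂ) • φ₄ i), ?_, fun x hx => ?_⟩
  · exact Submodule.add_mem _ (Submodule.smul_mem _ _ (Submodule.sum_mem _ fun i _ =>
      Submodule.sum_mem _ fun j _ => Submodule.add_mem _ (hφ₁ i j) (hφ₂ i j)))
      (Submodule.sum_mem _ fun i _ => Submodule.add_mem _ (Submodule.smul_mem _ _ (hφ₃ i))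
        (Submodule.smul_mem _ _ (hφ₄ i)))
  simp only [SmoothFun.add_val, SmoothFun.smul_val, smoothFun_sum_val, hv₃ _ x hx, hv₄ _ x hx]
  rw [Finset.sum_congr rfl fun i _ => Finset.sum_congr rfl fun j hj => by
    rw [hv₁ i j (Finset.mem_Ioi.1 hj) x hx, hv₂ i j (Finset.mem_Ioi.1 hj) x hx]]
  simp only [smul_eq_mul, ← Complex.ofReal_mul, ← Complex.ofReal_add, ← Complex.ofReal_sum]
  congr 1
  rw [← Finset.sum_mul]
  have hsq : ∑ k, (logDerivDeriv a b b' x k + (logDeriv a b b' x k + 2 * n k) ^ 2) =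
      ∑ k, logDerivDeriv a b b' x k + ∑ k, logDeriv a b b' x k ^ 2 +
        4 * ∑ k, logDeriv a b b' x k * n k + 4 * ∑ k, (n k : ℝ) ^ 2 := by
    simp only [Finset.mul_sum, ← Finset.sum_add_distrib]
    exact Finset.sum_congr rfl fun k _ => by ring
  rw [hsq, sum_logDerivDeriv, sum_logDeriv_sq a b b' hx,
    sum_logDeriv_mul a b b' x (fun i => (n i : ℝ)), scalarPotential, scalarEnergy]
  set F := expFun N a b b' n x
  have hE : ∑ i : Fin N, (2 * (n i : ℝ) + b + b' + 2 * a * ((N : ℝ) - 1 - (i : ℝ))) ^ 2 =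
      4 * ∑ k, (n k : ℝ) ^ 2 + 4 * (b + b') * ∑ k, (n k : ℝ) +
        8 * a * ∑ i : Fin N, (n i : ℝ) * ((N : ℝ) - 1 - (i : ℝ)) +
        ∑ i : Fin N, (b + b' + 2 * a * ((N : ℝ) - 1 - (i : ℝ))) ^ 2 := by
    simp only [Finset.mul_sum, ← Finset.sum_add_distrib]
    exact Finset.sum_congr rfl fun k _ => by ring
  rw [hE, ← sum_Ioi_mul_left fun i => (n i : ℝ)]
  generalize ∑ i : Fin N, (b + b' + 2 * a * ((N : ℝ) - 1 - (i : ℝ))) ^ 2 = E0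
  have hpair1 : ∑ i, ∑ j ∈ Finset.Ioi i,
      (-((n i : ℝ) - n j) * coth (x i - x j) * F +
        (F - expFun N a b b' (n ∘ Equiv.swap i j) x) / (2 * Real.sinh (x i - x j) ^ 2) +
        ((n i : ℝ) - n j) * F +
      (-((n i : ℝ) + n j) * coth (x i + x j) * F +
        (F - expFun N a b b' (flipInts {i, j} (n ∘ Equiv.swap i j)) x) /
          (2 * Real.sinh (x i + x j) ^ 2) + ((n i : ℝ) + n j) * F)) =
      (-F) * (∑ i, ∑ j ∈ Finset.Ioi i, (((n i : ℝ) - n j) * coth (x i - x j) +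
        ((n i : ℝ) + n j) * coth (x i + x j))) +
      1 / 2 * (∑ i, ∑ j ∈ Finset.Ioi i,
      ((Real.sinh (x i - x j) ^ 2)⁻¹ * (a * F - expFun N a b b' (n ∘ Equiv.swap i j) x) +
        (Real.sinh (x i + x j) ^ 2)⁻¹ * (a * F -
          expFun N a b b' (flipInts {i, j} (n ∘ Equiv.swap i j)) x))) +
      ((1 - a) / 2 * F) * (∑ i, ∑ j ∈ Finset.Ioi i,
        ((Real.sinh (x i - x j) ^ 2)⁻¹ + (Real.sinh (x i + x j) ^ 2)⁻¹)) +
      2 * F * ∑ i, ∑ j ∈ Finset.Ioi i, (n i : ℝ) := by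
    simp only [Finset.mul_sum]
    simp only [← Finset.sum_add_distrib]
    refine Finset.sum_congr rfl fun i _ => Finset.sum_congr rfl fun j _ => ?_
    simp only [div_eq_mul_inv, mul_inv]
    ring
  have hsingle : ∑ i, (2 * b * (-(2 * (n i : ℝ)) * coth (x i) * F +
        (F - expFun N a b b' (flipInts {i} n) x) /
          (2 * Real.sinh (x i) ^ 2) + (2 * (n i : ℝ)) * F) +
        2 * b' * (-(2 * (n i : ℝ)) * (Real.sinh (x i) / Real.cosh (x i)) * F -
        (F - expFun N a b b' (flipInts {i} n) x) /
          (2 * Real.cosh (x i) ^ 2) + (2 * (n i : ℝ)) * F)) =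
      (-4 * F) * (∑ i, cothSingle b b' x i * n i) +
      b * (∑ i, (Real.sinh (x i) ^ 2)⁻¹ * (b * F - expFun N a b b' (flipInts {i} n) x)) +
      (b * (1 - b) * F) * ∑ i, (Real.sinh (x i) ^ 2)⁻¹ -
      b' * (∑ i, (Real.cosh (x i) ^ 2)⁻¹ * (b' * F - expFun N a b b' (flipInts {i} n) x)) -
      (b' * (1 - b') * F) * (∑ i, (Real.cosh (x i) ^ 2)⁻¹) +
      4 * (b + b') * F * ∑ i, (n i : ℝ) := by
    simp only [Finset.mul_sum]
    simp only [← Finset.sum_add_distrib, ← Finset.sum_sub_distrib]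
    refine Finset.sum_congr rfl fun i _ => ?_
    simp only [div_eq_mul_inv, mul_inv, cothSingle]
    ring
  rw [hpair1, hsingle]
  ring

/-! ### The Hamiltonian on the exponential monomials -/

theorem tensorSpin_val {N d : ℕ} (φ : SmoothFun N ℂ) (v : SpinSpace N d) (x : Fin N → ℝ) :
    (tensorSpin N d φ v).1 x = φ.1 x • v := rfl

theorem partialDeriv_tensorSpin {N d : ℕ} (k : Fin N) (φ : SmoothFun N ℂ) (v : SpinSpace N d) :
    partialDeriv k (tensorSpin N d φ v) = tensorSpin N d (partialDeriv k φ) v := by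
  refine SmoothFun.ext_regular fun x hx => ?_
  have h := (differentiableAt_of_mem φ hx).hasFDerivAt.smul_const v
  rw [partialDeriv_val _ _ hx, tensorSpin_val, partialDeriv_val _ _ hx]
  have h' : HasFDerivAt (tensorSpin N d φ v).1 _ x := h
  rw [h'.fderiv]
  rfl

/-- Multiplication by a real function that is smooth on `regular N`. -/
def realMul {N d : ℕ} (g : (Fin N → ℝ) → ℝ) (hg : ContDiffOn ℝ ∞ g (regular N))
    (ψ : WaveFun N d) : WaveFun N d :=
  SmoothFun.mk (fun x => ((g x : ℝ) : ℂ) • ψ.1 x) (contDiffOn_ofReal_smul hg ψ.2.1)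
    (fun x hx => by simp [ψ.2.2 x hx])

theorem realMul_val {N d : ℕ} (g : (Fin N → ℝ) → ℝ) (hg : ContDiffOn ℝ ∞ g (regular N))
    (ψ : WaveFun N d) (x : Fin N → ℝ) : (realMul g hg ψ).1 x = (g x : ℂ) • ψ.1 x := rfl

/-! ### The Weyl group on monomials, and the trade of spin operators for coordinate operators. -/

theorem mu_flipCoords {N : ℕ} (a b b' : ℝ) (T : Finset (Fin N)) (x : Fin N → ℝ) :
    mu N a b b' (flipCoords T x) = mu N a b b' x := by
  unfold mu
  congr 1
  · refine Finset.prod_congr rfl fun i _ => Finset.prod_congr rfl fun j _ => ?_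
    congr 1
    have h1 : Real.sinh (-x i - x j) = -Real.sinh (x i + x j) := by
      rw [← Real.sinh_neg]; congr 1; ring
    have h2 : Real.sinh (-x i + x j) = -Real.sinh (x i - x j) := by
      rw [← Real.sinh_neg]; congr 1; ring
    have h3 : Real.sinh (-x i - -x j) = -Real.sinh (x i - x j) := by
      rw [← Real.sinh_neg]; congr 1; ring
    have h4 : Real.sinh (-x i + -x j) = -Real.sinh (x i + x j) := by
      rw [← Real.sinh_neg]; congr 1; ring
    unfold flipCoords
    split_ifs
    · rw [h3, h4, neg_mul_neg]
    · rw [h1, h2, neg_mul_neg, mul_comm]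
    · rw [sub_neg_eq_add, ← sub_eq_add_neg, mul_comm]
    · rfl
  · refine Finset.prod_congr rfl fun i _ => ?_
    unfold flipCoords
    split_ifs <;> simp

theorem mu_comp_perm {N : ℕ} (a b b' : ℝ) {x : Fin N → ℝ} (hx : x ∈ regular N)
    (σ : Equiv.Perm (Fin N)) : mu N a b b' (x ∘ σ) = mu N a b b' x := by
  rw [mu_eq_exp a b b' hx, mu_eq_exp a b b' (perm_mem_regular hx σ), logMu, logMu]
  congr 1
  congr 1
  · congr 1
    exact sum_Ioi_perm (M := ℝ) σ
      (fun i j => Real.log (Real.sinh (x i - x j)) + Real.log (Real.sinh (x i + x j)))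
      (fun i j => by
        rw [← neg_sub, Real.sinh_neg, Real.log_neg_eq_log, add_comm (x i)])
  · exact Fintype.sum_equiv σ _ _ fun i => rfl

theorem weylOp_tensorSpin {N d : ℕ} (a b b' : ℝ) (T : Finset (Fin N)) (σ : Equiv.Perm (Fin N))
    (n : Fin N → ℤ) (v : SpinSpace N d) :
    weylOp N d T σ (tensorSpin N d (expMonomial N a b b' n) v) =
      tensorSpin N d (expMonomial N a b b' (flipInts T (n ∘ ⇑σ⁻¹)))
        (spinSign N d T (spinPerm N d σ v)) := by
  refine SmoothFun.ext_regular fun x hx => ?_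
  change spinSign N d T (spinPerm N d σ
    ((expMonomial N a b b' n).1 (flipCoords T x ∘ σ) • v)) = _
  rw [tensorSpin_val, map_smul, map_smul, expMonomial_val _ _ _ _ hx,
    expMonomial_val _ _ _ _ ((weyl_mem_regular_iff T σ x).2 hx), expFun, expFun,
    mu_comp_perm a b b' (flip_mem_regular hx T), mu_flipCoords]
  congr 5
  refine Fintype.sum_equiv σ _ _ fun i => ?_
  simp only [flipInts, flipCoords, Function.comp_apply]
  split_ifs <;> simp

/-- The odd element given by `T` and `σ` carries the second argument of `Λ` to the first, because it
fixes `g`; absorbing it costs a sign. This is the rule that replaces `S` by `-K` under `Λ`. -/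
theorem antisymmetriser_realMul {N d : ℕ} (a b b' : ℝ) {g : (Fin N → ℝ) → ℝ}
    (hg : ContDiffOn ℝ ∞ g (regular N)) {T : Finset (Fin N)} {σ : Equiv.Perm (Fin N)}
    (hsgn : (-1 : ℂ) ^ T.card * ((Equiv.Perm.sign σ : ℤ) : ℂ) = -1)
    (hinv : ∀ x, g (flipCoords T x ∘ σ) = g x) {n n' : Fin N → ℤ}
    (hn : flipInts T (n' ∘ ⇑σ⁻¹) = n) (v : SpinSpace N d) :
    antisymmetriser N d (realMul g hg (tensorSpin N d (expMonomial N a b b' n)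
        (spinSign N d T (spinPerm N d σ v)))) +
      antisymmetriser N d (realMul g hg (tensorSpin N d (expMonomial N a b b' n') v)) = 0 := by
  have h : weylOp N d T σ (realMul g hg (tensorSpin N d (expMonomial N a b b' n') v)) =
      realMul g hg (tensorSpin N d (expMonomial N a b b' n)
        (spinSign N d T (spinPerm N d σ v))) := by
    rw [← hn, ← weylOp_tensorSpin]
    refine SmoothFun.ext fun x => ?_
    change spinSign N d T (spinPerm N d σ (((g (flipCoords T x ∘ σ) : ℝ) : ℂ) • _)) =
      ((g x : ℝ) : ℂ) • spinSign N d T (spinPerm N d σ _)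
    rw [map_smul, map_smul, hinv]
  rw [← h, ← Module.End.mul_apply, antisymmetriser_mul_weylOp, hsgn]
  simp

theorem contDiffOn_inv_sinh_sub {N : ℕ} (i j : Fin N) :
    ContDiffOn ℝ ∞ (fun x : Fin N → ℝ => (Real.sinh (x i - x j) ^ 2)⁻¹) (regular N) := by
  by_cases hij : i = j
  -- On the diagonal `sinh 0 = 0` and `0⁻¹ = 0`, so the function is constant; `exchangePart` forms
  -- this multiplier without access to `i < j`.
  · subst hij
    simpa using contDiffOn_const
  · exact ContDiffOn.inv (ContDiff.contDiffOn (by fun_prop)) fun x hx =>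
      pow_ne_zero 2 (sinh_sub_ne_zero hx hij)

theorem contDiffOn_inv_sinh_add {N : ℕ} (i j : Fin N) :
    ContDiffOn ℝ ∞ (fun x : Fin N → ℝ => (Real.sinh (x i + x j) ^ 2)⁻¹) (regular N) := by
  refine ContDiffOn.inv (ContDiff.contDiffOn (by fun_prop)) fun x hx => pow_ne_zero 2 ?_
  by_cases hij : i = j
  · subst hij
    rw [Ne, Real.sinh_eq_zero, ← two_mul]
    simpa using hx.1 i
  · exact sinh_add_ne_zero hx hij

theorem contDiffOn_inv_sinh {N : ℕ} (i : Fin N) :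
    ContDiffOn ℝ ∞ (fun x : Fin N → ℝ => (Real.sinh (x i) ^ 2)⁻¹) (regular N) :=
  ContDiffOn.inv (ContDiff.contDiffOn (by fun_prop)) fun _ hx =>
    pow_ne_zero 2 (sinh_ne_zero_of_regular hx i)

theorem contDiffOn_inv_cosh {N : ℕ} (i : Fin N) :
    ContDiffOn ℝ ∞ (fun x : Fin N → ℝ => (Real.cosh (x i) ^ 2)⁻¹) (regular N) :=
  ContDiffOn.inv (ContDiff.contDiffOn (by fun_prop)) fun _ _ =>
    pow_ne_zero 2 (Real.cosh_pos _).ne'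

theorem flipCoords_empty {N : ℕ} (x : Fin N → ℝ) : flipCoords ∅ x = x := by
  funext i; simp [flipCoords]

theorem spinSign_empty {N d : ℕ} (v : SpinSpace N d) : spinSign N d ∅ v = v := by
  funext s
  have h : flipSpins ∅ s = s := by funext i; simp [flipSpins]
  rw [spinSign_apply, h]

/-- The part of `H* ψ`, for `ψ = f_n ⊗ v`, that the antisymmetriser annihilates. -/
def exchangePart {N d : ℕ} (a b b' : ℝ) (n : Fin N → ℤ) (v : SpinSpace N d) : WaveFun N d :=
  ((2 * a : ℝ) : ℂ) • ∑ i : Fin N, ∑ j ∈ Finset.Ioi i,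
      ((realMul _ (contDiffOn_inv_sinh_sub i j) (tensorSpin N d (expMonomial N a b b' n)
          (spinExchange N d i j v)) +
        realMul _ (contDiffOn_inv_sinh_sub i j) (tensorSpin N d
          (expMonomial N a b b' (n ∘ Equiv.swap i j)) v)) +
      (realMul _ (contDiffOn_inv_sinh_add i j) (tensorSpin N d (expMonomial N a b b' n)
          (spinExchangeTilde N d i j v)) +
        realMul _ (contDiffOn_inv_sinh_add i j) (tensorSpin N d
          (expMonomial N a b b' (flipInts {i, j} (n ∘ Equiv.swap i j))) v))) +
    (b : ℂ) • ∑ i : Fin N,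
      (realMul _ (contDiffOn_inv_sinh i) (tensorSpin N d (expMonomial N a b b' n)
          (spinReverse N d i v)) +
        realMul _ (contDiffOn_inv_sinh i) (tensorSpin N d
          (expMonomial N a b b' (flipInts {i} n)) v)) -
    (b' : ℂ) • ∑ i : Fin N,
      (realMul _ (contDiffOn_inv_cosh i) (tensorSpin N d (expMonomial N a b b' n)
          (spinReverse N d i v)) +
        realMul _ (contDiffOn_inv_cosh i) (tensorSpin N d
          (expMonomial N a b b' (flipInts {i} n)) v))

theorem antisymmetriser_exchangePart {N d : ℕ} (a b b' : ℝ) (n : Fin N → ℤ)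
    (v : SpinSpace N d) : antisymmetriser N d (exchangePart a b b' n v) = 0 := by
  have h1 : ∀ i j : Fin N, i ≠ j → antisymmetriser N d
      (realMul _ (contDiffOn_inv_sinh_sub i j) (tensorSpin N d (expMonomial N a b b' n)
          (spinExchange N d i j v))) +
      antisymmetriser N d (realMul _ (contDiffOn_inv_sinh_sub i j) (tensorSpin N d
          (expMonomial N a b b' (n ∘ Equiv.swap i j)) v)) = 0 := fun i j hij => by
    have := antisymmetriser_realMul (d := d) a b b' (contDiffOn_inv_sinh_sub i j)
      (T := ∅) (σ := Equiv.swap i j) (n := n) (n' := n ∘ Equiv.swap i j)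
      (by simp [Equiv.Perm.sign_swap hij])
      (fun x => by
        simp only [flipCoords_empty, Function.comp_apply, Equiv.swap_apply_left,
          Equiv.swap_apply_right]
        rw [← neg_sub, Real.sinh_neg, neg_sq]) (by funext l; simp [flipInts]) v
    rwa [spinSign_empty] at this
  have h2 : ∀ i j : Fin N, i ≠ j → antisymmetriser N d
      (realMul _ (contDiffOn_inv_sinh_add i j) (tensorSpin N d (expMonomial N a b b' n)
          (spinExchangeTilde N d i j v))) +
      antisymmetriser N d (realMul _ (contDiffOn_inv_sinh_add i j) (tensorSpin N d
          (expMonomial N a b b' (flipInts {i, j} (n ∘ Equiv.swap i j))) v)) = 0 :=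
      fun i j hij => by
    have := antisymmetriser_realMul (d := d) a b b' (contDiffOn_inv_sinh_add i j)
      (T := {i, j}) (σ := Equiv.swap i j) (n := n)
      (n' := flipInts {i, j} (n ∘ Equiv.swap i j))
      -- Two sign changes contribute `+1` and the transposition `-1`, so the element is odd.
      (by simp [Equiv.Perm.sign_swap hij, Finset.card_pair hij])
      (fun x => by
        have e : flipCoords {i, j} x j + flipCoords {i, j} x i = -(x i + x j) := by
          simp [flipCoords]
        simp only [Function.comp_apply, Equiv.swap_apply_left, Equiv.swap_apply_right]
        rw [e, Real.sinh_neg, neg_sq])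
      (by
        funext l
        by_cases hi : l = i
        · subst hi; simp [flipInts]
        by_cases hj : l = j
        · subst hj; simp [flipInts]
        simp [flipInts, hi, hj, Equiv.swap_apply_of_ne_of_ne hi hj]) v
    have e : spinSign N d {i, j} (spinPerm N d (Equiv.swap i j) v) =
        spinExchangeTilde N d i j v := by
      funext s
      rw [spinExchangeTilde_apply hij]; rfl
    rwa [e] at this
  have h3 : ∀ (i : Fin N) (g : (Fin N → ℝ) → ℝ) (hg : ContDiffOn ℝ ∞ g (regular N)),
      (∀ x, g (flipCoords {i} x) = g x) → antisymmetriser N d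
      (realMul g hg (tensorSpin N d (expMonomial N a b b' n) (spinReverse N d i v))) +
      antisymmetriser N d (realMul g hg (tensorSpin N d
          (expMonomial N a b b' (flipInts {i} n)) v)) = 0 := fun i g hg hinv =>
    antisymmetriser_realMul (d := d) a b b' hg
      (T := {i}) (σ := 1) (n := n) (n' := flipInts {i} n) (by simp) (fun x => hinv x)
      (by funext l; by_cases h : l = i <;> simp [flipInts, h]) v
  simp only [exchangePart, map_add, map_sub, map_smul, map_sum]
  rw [Finset.sum_eq_zero fun i _ => Finset.sum_eq_zero fun j hj => by
      rw [h1 i j (Finset.mem_Ioi.1 hj).ne, h2 i j (Finset.mem_Ioi.1 hj).ne, add_zero],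
    Finset.sum_eq_zero fun i _ => h3 i _ _ fun x => by simp [flipCoords],
    Finset.sum_eq_zero fun i _ => h3 i _ _ fun x => by simp [flipCoords]]
  simp

/-- Each `K f_n ⊗ v` is subtracted in `scalarPotential` and added back in `exchangePart`, where it
is paired with the matching `f_n ⊗ S v`. -/
theorem hamiltonian_tensorSpin {N d : ℕ} (a b b' : ℝ) (n : Fin N → ℤ) (v : SpinSpace N d)
    {x : Fin N → ℝ} (hx : x ∈ regular N) :
    (hamiltonian N d a b b' (tensorSpin N d (expMonomial N a b b' n) v)).1 x =
      ((-∑ k, (logDerivDeriv a b b' x k + (logDeriv a b b' x k + 2 * n k) ^ 2) *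
        expFun N a b b' n x + scalarPotential a b b' n x : ℝ) : ℂ) • v +
      (exchangePart a b b' n v).1 x := by
  have hneg : ∀ ψ : WaveFun N d, (-ψ).1 x = -ψ.1 x := fun ψ => rfl
  have hsub : ∀ ψ φ : WaveFun N d, (ψ - φ).1 x = ψ.1 x - φ.1 x := fun ψ φ => rfl
  have hpot : (potentialOp N d a b b' (tensorSpin N d (expMonomial N a b b' n) v)).1 x =
      potential N d a b b' x ((expFun N a b b' n x : ℂ) • v) := by
    rw [← expMonomial_val a b b' n hx]; rfl
  rw [hamiltonian, LinearMap.add_apply, SmoothFun.add_val, LinearMap.neg_apply, hneg,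
    LinearMap.sum_apply, smoothFun_sum_val, hpot]
  simp only [Module.End.mul_apply, partialDeriv_tensorSpin, tensorSpin_val,
    partialDeriv_partialDeriv_expMonomial a b b' n hx, exchangePart, SmoothFun.add_val, hsub,
    SmoothFun.smul_val, smoothFun_sum_val, realMul_val, expMonomial_val a b b' _ hx,
    potential_eq, pairPotential, LinearMap.add_apply, LinearMap.sub_apply, LinearMap.smul_apply,
    LinearMap.sum_apply, Module.End.one_apply, map_smul, scalarPotential]
  rw [← Finset.sum_smul, ← sub_eq_zero]
  funext s
  simp only [Pi.add_apply, Pi.sub_apply, Pi.smul_apply, Pi.neg_apply, Finset.sum_apply,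
    smul_eq_mul, Pi.zero_apply]
  push_cast
  set F : ℂ := (expFun N a b b' n x : ℂ)
  have h1 : ∀ (g S f' : Fin N → ℂ) (c : ℂ), F * ∑ i, g i * (c * v s + S i) =
      (∑ i, g i * (c * F - f' i)) * v s + ∑ i, (g i * (F * S i) + g i * (f' i * v s)) := by
    intro g S f' c
    rw [Finset.mul_sum, Finset.sum_mul, ← Finset.sum_add_distrib]
    exact Finset.sum_congr rfl fun i _ => by ring
  have h2 : ∀ (g S f' g₂ S₂ f₂' : Fin N → Fin N → ℂ) (c : ℂ),
      F * ∑ i, ∑ j ∈ Finset.Ioi i, (g i j * (c * v s + S i j) + g₂ i j * (c * v s + S₂ i j)) =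
      (∑ i, ∑ j ∈ Finset.Ioi i, (g i j * (c * F - f' i j) + g₂ i j * (c * F - f₂' i j))) * v s +
      ∑ i, ∑ j ∈ Finset.Ioi i, ((g i j * (F * S i j) + g i j * (f' i j * v s)) +
        (g₂ i j * (F * S₂ i j) + g₂ i j * (f₂' i j * v s))) := by
    intro g S f' g₂ S₂ f₂' c
    simp only [Finset.mul_sum, Finset.sum_mul]
    simp only [← Finset.sum_add_distrib]
    exact Finset.sum_congr rfl fun i _ => Finset.sum_congr rfl fun j _ => by ring
  linear_combination (2 * (a : ℂ)) *
      h2 (fun i j => (Complex.sinh (x i - x j) ^ 2)⁻¹) (fun i j => spinExchange N d i j v s)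
        (fun i j => (expFun N a b b' (n ∘ Equiv.swap i j) x : ℂ))
        (fun i j => (Complex.sinh (x i + x j) ^ 2)⁻¹) (fun i j => spinExchangeTilde N d i j v s)
        (fun i j => (expFun N a b b' (flipInts {i, j} (n ∘ Equiv.swap i j)) x : ℂ)) a +
    (b : ℂ) * h1 (fun i => (Complex.sinh (x i) ^ 2)⁻¹) (fun i => spinReverse N d i v s)
      (fun i => (expFun N a b b' (flipInts {i} n) x : ℂ)) b -
    (b' : ℂ) * h1 (fun i => (Complex.cosh (x i) ^ 2)⁻¹) (fun i => spinReverse N d i v s)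
      (fun i => (expFun N a b b' (flipInts {i} n) x : ℂ)) b'

theorem antisymmetriser_hamiltonian_tensorSpin {N d : ℕ} (a b b' : ℝ) {m : ℕ} {n : Fin N → ℤ}
    (hn : Antitone n) (h0 : ∀ i, 0 ≤ n i) (hm : ∀ i, n i ≤ m) :
    ∃ φ ∈ lowerSpace N a b b' m n, ∀ v : SpinSpace N d,
      hamiltonian N d a b b' (antisymmetriser N d (tensorSpin N d (expMonomial N a b b' n) v)) =
        (scalarEnergy a b b' n : ℂ) •
          antisymmetriser N d (tensorSpin N d (expMonomial N a b b' n) v) +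
        antisymmetriser N d (tensorSpin N d φ v) := by
  obtain ⟨φ, h1, h2⟩ := scalar_triangular a b b' hn h0 hm
  refine ⟨φ, h1, fun v => ?_⟩
  have key : hamiltonian N d a b b' (tensorSpin N d (expMonomial N a b b' n) v) =
      (scalarEnergy a b b' n : ℂ) • tensorSpin N d (expMonomial N a b b' n) v +
        tensorSpin N d φ v + exchangePart a b b' n v := by
    refine SmoothFun.ext_regular fun x hx => ?_
    rw [hamiltonian_tensorSpin a b b' n v hx]
    simp only [SmoothFun.add_val, SmoothFun.smul_val, tensorSpin_val, h2 x hx,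
      expMonomial_val a b b' n hx]
    rw [smul_smul, ← add_smul, ← Complex.ofReal_mul, ← Complex.ofReal_add]
    congr 3
    ring
  rw [← Module.End.mul_apply, hamiltonian_antisymmetriser, Module.End.mul_apply, key, map_add,
    map_add, map_smul, antisymmetriser_exchangePart, add_zero]

/-! ### Multi-indices, labels and energies -/

theorem spinValue_lt_iff {d : ℕ} (k l : Fin (d + 1)) :
    spinValue d k < spinValue d l ↔ k < l := by
  rw [spinValue, spinValue, sub_lt_sub_iff_right, Nat.cast_lt, Fin.val_fin_lt]

theorem spinValue_pos_iff {d : ℕ} (k : Fin (d + 1)) : 0 < spinValue d k ↔ d < 2 * (k : ℕ) := by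
  rw [spinValue, spinM, sub_pos, div_lt_iff₀ two_pos, ← Nat.cast_ofNat (n := 2), ← Nat.cast_mul,
    Nat.cast_lt, mul_comm]

theorem le_two_spinM_add_one_iff (d c : ℕ) : (c : ℚ) ≤ 2 * spinM d + 1 ↔ c ≤ d + 1 := by
  rw [spinM, mul_div_cancel₀ _ two_ne_zero]
  exact_mod_cast Iff.rfl

/-- The number of positive spin values is `⌈M⌉`, the integer part of `(d + 1)/2`; this form is
within reach of `omega`. -/
theorem le_ceil_spinM_iff (d c : ℕ) : (c : ℤ) ≤ ⌈spinM d⌉ ↔ 2 * c ≤ d + 1 := by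
  rw [Int.le_ceil_iff, spinM, lt_div_iff₀ two_pos]
  constructor
  · intro h
    have : (2 * c : ℚ) < d + 2 := by push_cast at h; linarith
    have : 2 * c < d + 2 := by exact_mod_cast this
    omega
  · intro h
    have : 2 * c < d + 2 := by omega
    have : (2 * c : ℚ) < d + 2 := by exact_mod_cast this
    push_cast
    linarith

/-- The number of components of `n` greater than `k`. -/
def countGt {N : ℕ} (n : Fin N → ℕ) (k : ℕ) : ℕ := (Finset.univ.filter fun j => k < n j).card

theorem lt_countGt_iff {N : ℕ} {n : Fin N → ℕ} (hn : Antitone n) (k : ℕ) (j : Fin N) :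
    (j : ℕ) < countGt n k ↔ k < n j :=
  Tuple.lt_card_gt_iff_apply_gt_of_antitone hn

theorem lt_countGt_add_multiplicity_iff {N : ℕ} {n : Fin N → ℕ} (hn : Antitone n) (k : ℕ)
    (j : Fin N) : (j : ℕ) < countGt n k + multiplicity n k ↔ k ≤ n j := by
  rw [← Tuple.lt_card_ge_iff_apply_ge_of_antitone hn, countGt, multiplicity,
    ← Finset.card_union_of_disjoint]
  · have : (Finset.univ.filter fun j => k < n j) ∪ (Finset.univ.filter fun j => n j = k) =
        Finset.univ.filter fun j => k ≤ n j := by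
      ext i
      simp only [Finset.mem_union, Finset.mem_filter, Finset.mem_univ, true_and]
      omega
    rw [this]
  · rw [Finset.disjoint_filter]
    intro i _ h
    omega

/-- In a nonincreasing sequence, the positions of a value form an interval that begins after all
larger entries. -/
theorem eq_iff_mem_block {N : ℕ} {n : Fin N → ℕ} (hn : Antitone n) (k : ℕ) (j : Fin N) :
    n j = k ↔ countGt n k ≤ j ∧ (j : ℕ) < countGt n k + multiplicity n k := by
  rw [lt_countGt_add_multiplicity_iff hn, ← not_lt, lt_countGt_iff hn]
  omega

theorem firstPosition_eq {N : ℕ} {n : Fin N → ℕ} (hn : Antitone n) (i : Fin N) :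
    firstPosition n (n i) = countGt n (n i) + 1 := by
  have hi := (eq_iff_mem_block hn (n i) i).1 rfl
  refine IsLeast.csInf_eq ⟨⟨⟨countGt n (n i), hi.1.trans_lt i.2⟩, ?_, rfl⟩, ?_⟩
  · exact (eq_iff_mem_block hn _ _).2 ⟨le_rfl, hi.1.trans_lt hi.2⟩
  · rintro p ⟨j, hj, rfl⟩
    exact Nat.succ_le_succ ((eq_iff_mem_block hn _ _).1 hj).1

/-- The two lists of squares agree up to a permutation: the stated `lam` runs backwards through each
block of equal positive entries. On the zero block it is minus the other expression, which squaring
hides. -/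
theorem energy_eq_scalarEnergy {N : ℕ} (a b b' : ℝ) {n : Fin N → ℕ} (hn : Antitone n) :
    energy a b b' n = scalarEnergy a b b' (fun i => (n i : ℤ)) := by
  have hblock : ∀ i, countGt n (n i) ≤ i ∧
      (i : ℕ) < countGt n (n i) + multiplicity n (n i) := fun i =>
    (eq_iff_mem_block hn (n i) i).1 rfl
  have hlt : ∀ i : Fin N, 2 * countGt n (n i) + multiplicity n (n i) - 1 - (i : ℕ) < N := by
    intro i
    by_contra hcon
    have hi := hblock i
    have hlast : N ≤ countGt n (n i) + multiplicity n (n i) - 1 := by omega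
    have hle : countGt n (n i) + multiplicity n (n i) ≤ N := by
      have : countGt n (n i) + multiplicity n (n i) =
          ((Finset.univ.filter fun j => n i < n j) ∪
            (Finset.univ.filter fun j => n j = n i)).card := by
        rw [Finset.card_union_of_disjoint]
        · rfl
        · rw [Finset.disjoint_filter]
          intro j _ h
          omega
      rw [this]
      exact (Finset.card_le_univ _).trans (Fintype.card_fin N).le
    have := i.2
    omega
  -- Reflection of the block `c, …, c + # - 1`, where `c` counts the larger entries; the zero block
  -- stays fixed.
  let ρ : Fin N → Fin N := fun i => if 0 < n i then
    ⟨2 * countGt n (n i) + multiplicity n (n i) - 1 - (i : ℕ), hlt i⟩ else i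
  have hnρ : ∀ i, n (ρ i) = n i := fun i => by
    simp only [ρ]
    split_ifs with h
    · have := hblock i
      refine (eq_iff_mem_block hn (n i) _).2 ⟨?_, ?_⟩ <;> simp only <;> omega
    · rfl
  have hρ : Function.Involutive ρ := fun i => by
    by_cases h : 0 < n i
    · have h1 : (ρ i : ℕ) = 2 * countGt n (n i) + multiplicity n (n i) - 1 - (i : ℕ) := by
        simp only [ρ, if_pos h]
      have h2 : (ρ (ρ i) : ℕ) = 2 * countGt n (n (ρ i)) + multiplicity n (n (ρ i)) - 1 -
          (ρ i : ℕ) := by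
        simp only [ρ]
        rw [if_pos (show 0 < n (ρ i) by rw [hnρ]; exact h)]
      refine Fin.ext ?_
      have := hblock i
      rw [h2, hnρ, h1]
      omega
    · simp only [ρ, if_neg h]
  rw [energy, scalarEnergy]
  congr 1
  conv_rhs => rw [← Equiv.sum_comp hρ.toPerm]
  refine Finset.sum_congr rfl fun i _ => ?_
  rw [Function.Involutive.coe_toPerm, hnρ, lam]
  split_ifs with h
  · have h1 : (ρ i : ℕ) + 1 + i = 2 * countGt n (n i) + multiplicity n (n i) := by
      have := hblock i
      simp only [ρ, if_pos h]
      omega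
    have h2 : ((ρ i : ℕ) : ℝ) + 1 + i = 2 * countGt n (n i) + multiplicity n (n i) := by
      exact_mod_cast h1
    rw [firstPosition_eq hn]
    congr 1
    push_cast
    linear_combination (2 * a) * h2
  · have h1 : ρ i = i := if_neg h
    have h2 : n i = 0 := by omega
    rw [h1, h2]
    push_cast
    ring

theorem exists_isLabel {N d m : ℕ} {n : Fin N → ℕ} (hn : Admissible d m n) :
    ∃ s : Spins N d, IsLabel d m (n, s) := by
  have hblock : ∀ i, countGt n (n i) ≤ i ∧
      (i : ℕ) < countGt n (n i) + multiplicity n (n i) := fun i =>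
    (eq_iff_mem_block hn.1 (n i) i).1 rfl
  have hmul : ∀ i, multiplicity n (n i) ≤ d + 1 ∧
      (n i = 0 → 2 * multiplicity n (n i) ≤ d + 1) := fun i => by
    have h0 : n i = 0 → 2 * multiplicity n (n i) ≤ d + 1 := fun h =>
      (le_ceil_spinM_iff _ _).1 (hn.2.2.2 i h)
    rcases Nat.eq_zero_or_pos (n i) with h | h
    · exact ⟨by have := h0 h; omega, h0⟩
    · exact ⟨(le_two_spinM_add_one_iff _ _).1 (hn.2.2.1 i h), h0⟩
  -- Spins descend from the top value `M` along each block. The zero block has at most `⌈M⌉` places,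
  -- so they remain positive there.
  refine ⟨fun i => ⟨d - (i - countGt n (n i)), by omega⟩, hn, fun i j hij hlt => ?_,
    fun i h0 => ?_⟩
  · rw [spinValue_lt_iff, Fin.lt_def]
    have hi := hblock i
    have hj := hblock j
    have hm := (hmul j).1
    have : (i : ℕ) < j := hlt
    simp only at hij
    simp only [← hij] at *
    omega
  · rw [spinValue_pos_iff]
    have hi := hblock i
    have := (hmul i).2 h0
    simp only
    omega

/-- Strict decrease makes `s` injective on each block, so the multiplicity bounds of `Admissible`
follow by counting the available spin values. -/
theorem isLabel_of_strict {N d m : ℕ} {n : Fin N → ℕ} {s : Spins N d} (hn : Antitone n)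
    (hm : ∀ i, n i ≤ m) (hs : ∀ i j, n i = n j → i < j → s j < s i)
    (h0 : ∀ i, n i = 0 → d < 2 * (s i : ℕ)) : IsLabel d m (n, s) := by
  have hinj : ∀ k, Set.InjOn s {i | n i = k} := by
    intro k i hi j hj hij
    rcases lt_trichotomy i j with h | h | h
    · exact absurd hij (hs i j (hi.trans hj.symm) h).ne'
    · exact h
    · exact absurd hij (hs j i (hj.trans hi.symm) h).ne
  refine ⟨⟨hn, hm, fun i _ => ?_, fun i hi => ?_⟩, fun i j hij hlt => ?_, fun i hi => ?_⟩
  · rw [le_two_spinM_add_one_iff, ← Fintype.card_fin (d + 1), multiplicity, ← Finset.card_univ]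
    refine Finset.card_le_card_of_injOn s (fun _ _ => Finset.mem_coe.2 (Finset.mem_univ _)) ?_
    simpa using hinj (n i)
  · rw [le_ceil_spinM_iff, hi, multiplicity]
    have : (Finset.univ.filter fun j => n j = 0).card ≤ (Finset.range ((d + 1) / 2)).card := by
      -- Positive spins have labels `d / 2 + 1, …, d`; shifting them to start at `0` gives the first
      -- `(d + 1) / 2` naturals.
      refine Finset.card_le_card_of_injOn (fun j => (s j : ℕ) - (d / 2 + 1)) (fun j hj => ?_) ?_
      · have hj' : n j = 0 := by simpa using hj
        have := h0 j hj'
        have := (s j).2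
        simp only [Finset.coe_range, Set.mem_Iio]
        omega
      · intro j hj l hl hjl
        have hj' : n j = 0 := by simpa using hj
        have hl' : n l = 0 := by simpa using hl
        have := h0 j hj'
        have := h0 l hl'
        refine hinj 0 hj' hl' (Fin.ext ?_)
        simp only at hjl
        omega
    rw [Finset.card_range] at this
    change 2 * (Finset.univ.filter fun j => n j = 0).card ≤ _
    omega
  · exact (spinValue_lt_iff _ _).2 (hs i j hij hlt)
  · exact (spinValue_pos_iff _).2 (h0 i hi)

/-! ### Labels as representatives of Weyl orbits. -/

theorem IsLabel.strict {N d m : ℕ} {p : (Fin N → ℕ) × Spins N d} (h : IsLabel d m p) :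
    (∀ i j, p.1 i = p.1 j → i < j → p.2 j < p.2 i) ∧
      ∀ i, p.1 i = 0 → d < 2 * (p.2 i : ℕ) :=
  ⟨fun i j h1 h2 => (spinValue_lt_iff _ _).1 (h.2.1 i j h1 h2),
    fun i hi => (spinValue_pos_iff _).1 (h.2.2 i hi)⟩

/-- The action of the Weyl group on the pairs of a multi-index and a spin configuration. -/
def weylIndex {N d : ℕ} (T : Finset (Fin N)) (σ : Equiv.Perm (Fin N))
    (p : (Fin N → ℤ) × Spins N d) : (Fin N → ℤ) × Spins N d :=
  (flipInts T (p.1 ∘ ⇑σ⁻¹), flipSpins T (p.2 ∘ ⇑σ⁻¹))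

/-- Regard the multi-index of a label as an integer multi-index. -/
def castIndex {N d : ℕ} (p : (Fin N → ℕ) × Spins N d) : (Fin N → ℤ) × Spins N d :=
  (fun i => (p.1 i : ℤ), p.2)

theorem weylIndex_label_eq {N d m : ℕ} {p p' : (Fin N → ℕ) × Spins N d} (hp : IsLabel d m p)
    (hp' : IsLabel d m p') {T : Finset (Fin N)} {σ : Equiv.Perm (Fin N)}
    (h : weylIndex T σ (castIndex p') = castIndex p) : T = ∅ ∧ σ = 1 ∧ p' = p := by
  obtain ⟨h1, h2⟩ := Prod.ext_iff.1 h
  have hn : ∀ i, (if i ∈ T then -(p'.1 (σ⁻¹ i) : ℤ) else p'.1 (σ⁻¹ i)) = p.1 i :=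
    fun i => congrFun h1 i
  have hs : ∀ i, (if i ∈ T then Fin.rev (p'.2 (σ⁻¹ i)) else p'.2 (σ⁻¹ i)) = p.2 i :=
    fun i => congrFun h2 i
  -- A flipped position has `-n' = n` with both nonnegative, so both vanish and both spins are
  -- positive; but one of them is the opposite of the other.
  have hT : T = ∅ := by
    refine Finset.eq_empty_of_forall_notMem fun i hi => ?_
    have e1 := hn i
    have e2 := hs i
    rw [if_pos hi] at e1 e2
    have e3 := hp.strict.2 i (by omega)
    have e4 := hp'.strict.2 (σ⁻¹ i) (by omega)
    have e5 := congrArg Fin.val e2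
    rw [Fin.val_rev] at e5
    omega
  subst hT
  have hn' : ∀ i, p'.1 (σ⁻¹ i) = p.1 i := fun i => by
    have := hn i
    rw [if_neg (Finset.notMem_empty i)] at this
    exact_mod_cast this
  have hs' : ∀ i, p'.2 (σ⁻¹ i) = p.2 i := fun i => by
    have := hs i
    rwa [if_neg (Finset.notMem_empty i)] at this
  -- A monotone permutation is the identity. A descent of `σ⁻¹` would force equal entries of `n`,
  -- and strict decrease of the spins would then hold in both directions.
  have hσ : σ⁻¹ = 1 := by
    refine (Equiv.Perm.monotone_iff _).1 fun i j hij => ?_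
    rcases hij.eq_or_lt with rfl | hij
    · exact le_rfl
    by_contra! hlt
    have a1 := hp'.1.1 hlt.le
    have a2 := hp.1.1 hij.le
    rw [hn', hn'] at a1
    have e : p.1 i = p.1 j := le_antisymm a1 a2
    have a3 := hp.strict.1 i j e hij
    have a4 := hp'.strict.1 _ _ (by rw [hn', hn', e]) hlt
    rw [hs', hs'] at a4
    exact lt_asymm a3 a4
  have hσ1 : σ = 1 := inv_eq_one.1 hσ
  subst hσ1
  exact ⟨rfl, rfl, Prod.ext (funext hn') (funext hs')⟩

theorem exists_weylIndex_sorted {N d : ℕ} (n : Fin N → ℤ) (s : Spins N d) :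
    ∃ (T : Finset (Fin N)) (σ : Equiv.Perm (Fin N)) (n' : Fin N → ℕ) (s' : Spins N d),
      weylIndex ∅ σ (weylIndex T 1 (n, s)) = castIndex (n', s') ∧ Antitone n' ∧
      (∀ i j, n' i = n' j → i < j → s' j ≤ s' i) ∧ (∀ i, n' i = 0 → d ≤ 2 * (s' i : ℕ)) ∧
      (∀ i, (n' i : ℤ) = |n (σ⁻¹ i)|) := by
  -- These flips make the entries nonnegative and also make the spins nonnegative where the entry is
  -- `0`.
  let T : Finset (Fin N) := Finset.univ.filter fun i => n i < 0 ∨ (n i = 0 ∧ 2 * (s i : ℕ) < d)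
  let n₁ : Fin N → ℕ := fun i => (n i).natAbs
  let s₁ : Spins N d := flipSpins T s
  -- `Tuple.sort` sorts upwards; the order dual gives decreasing lexicographic order in (entry,
  -- spin).
  let key : Fin N → (ℕ ×ₗ Fin (d + 1))ᵒᵈ := fun i => OrderDual.toDual (toLex (n₁ i, s₁ i))
  let τ := Tuple.sort key
  have hmono : Monotone (key ∘ τ) := Tuple.monotone_sort key
  have hlex : ∀ i j, i ≤ j → toLex (n₁ (τ j), s₁ (τ j)) ≤ toLex (n₁ (τ i), s₁ (τ i)) :=
    fun i j hij => hmono hij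
  refine ⟨T, τ⁻¹, n₁ ∘ τ, s₁ ∘ τ, ?_, fun i j hij => ?_, fun i j h hij => ?_, fun i hi => ?_,
    fun i => ?_⟩
  · have hflip : ∀ i, flipInts T n i = n₁ i := fun i => by
      simp only [flipInts, T, Finset.mem_filter, Finset.mem_univ, true_and, n₁]
      split_ifs with h
      · omega
      · omega
    refine Prod.ext (funext fun i => ?_) (funext fun i => ?_)
    · simp only [weylIndex, castIndex, inv_inv, inv_one, Equiv.Perm.coe_one, Function.comp_id,
        Function.comp_apply]
      simp [flipInts]
      exact hflip (τ i)
    · simp [weylIndex, castIndex, flipSpins, s₁]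
  · exact (Prod.Lex.le_iff.1 (hlex i j hij)).elim le_of_lt fun h => h.1.le
  · rcases Prod.Lex.le_iff.1 (hlex i j hij.le) with h' | h'
    · exact absurd h h'.ne'
    · exact h'.2
  · have h0 : n (τ i) = 0 := by simpa [n₁] using hi
    simp only [Function.comp_apply, s₁, flipSpins, T, Finset.mem_filter, Finset.mem_univ, true_and,
      h0, lt_irrefl, false_or]
    split_ifs with h
    · rw [Fin.val_rev]; omega
    · omega
  · simp [n₁]

/-! ### Linear independence -/

/-- A real vector space is not a finite union of hyperplanes; `R` lists those to avoid, the singular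
ones and the loci where two exponents of `S` agree. -/
theorem exists_generic_ray {N : ℕ} (S : Finset (Fin N → ℤ)) :
    ∃ v : Fin N → ℝ, v ∈ regular N ∧
      Set.InjOn (fun n : Fin N → ℤ => ∑ i, (n i : ℝ) * v i) S := by
  classical
  let lin : (Fin N → ℤ) → Module.Dual ℝ (Fin N → ℝ) := fun n =>
    ∑ i, (n i : ℝ) • LinearMap.proj i
  have hlin : ∀ n v, lin n v = ∑ i, (n i : ℝ) * v i := fun n v => by
    simp [lin, LinearMap.sum_apply]
  let R : Finset (Fin N → ℤ) :=
    ((Finset.univ.image fun i : Fin N => (Pi.single i 1 : Fin N → ℤ)) ∪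
      (Finset.univ.image fun p : Fin N × Fin N => (Pi.single p.1 1 - Pi.single p.2 1)) ∪
      (Finset.univ.image fun p : Fin N × Fin N => (Pi.single p.1 1 + Pi.single p.2 1)) ∪
      (S ×ˢ S).image fun p => p.1 - p.2).filter fun n => n ≠ 0
  obtain ⟨v, hv⟩ := Module.Dual.exists_forall_ne_zero_of_forall_exists
    (fun n : R => lin n.1) (fun n => by
      have hn : n.1 ≠ 0 := (Finset.mem_filter.1 n.2).2
      obtain ⟨i, hi⟩ := Function.ne_iff.1 hn
      refine ⟨Pi.single i 1, ?_⟩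
      rw [hlin]
      simpa [Pi.single_apply] using hi)
  have hR : ∀ n ∈ R, ∑ i, (n i : ℝ) * v i ≠ 0 := fun n hn => by
    rw [← hlin]; exact hv ⟨n, hn⟩
  refine ⟨v, ⟨fun i => ?_, fun i j hij => ⟨fun h => ?_, fun h => ?_⟩⟩, fun n hn n' hn' h => ?_⟩
  · have := hR (Pi.single i 1) (by simp [R])
    simpa [Pi.single_apply] using this
  · refine hR (Pi.single i 1 - Pi.single j 1) (Finset.mem_filter.2 ⟨?_, ?_⟩) ?_
    · simp only [Finset.mem_union, Finset.mem_image]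
      exact Or.inl (Or.inl (Or.inr ⟨(i, j), Finset.mem_univ _, rfl⟩))
    · intro h
      have := congrFun h i
      simp [hij] at this
    · simp [Pi.single_apply, sub_mul, Finset.sum_sub_distrib, h]
  · refine hR (Pi.single i 1 + Pi.single j 1) (Finset.mem_filter.2 ⟨?_, ?_⟩) ?_
    · simp only [Finset.mem_union, Finset.mem_image]
      exact Or.inl (Or.inr ⟨(i, j), Finset.mem_univ _, rfl⟩)
    · intro h
      have := congrFun h i
      simp [hij] at this
    · simp [Pi.single_apply, add_mul, Finset.sum_add_distrib, h]
  · by_contra hne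
    refine hR (n - n') (Finset.mem_filter.2 ⟨?_, sub_ne_zero.2 hne⟩) ?_
    · simp only [Finset.mem_union, Finset.mem_image]
      exact Or.inr ⟨(n, n'), Finset.mem_product.2 ⟨hn, hn'⟩, rfl⟩
    · simp only at h
      simp [sub_mul, Finset.sum_sub_distrib, h]

theorem smul_mem_regular {N : ℕ} {x : Fin N → ℝ} (hx : x ∈ regular N) {t : ℝ} (ht : t ≠ 0) :
    t • x ∈ regular N := by
  refine ⟨fun i => mul_ne_zero ht (hx.1 i), fun i j hij => ⟨fun h => ?_, fun h => ?_⟩⟩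
  · exact (hx.2 i j hij).1 (mul_left_cancel₀ ht h)
  · refine (hx.2 i j hij).2 (mul_left_cancel₀ ht ?_)
    simp only [Pi.smul_apply, smul_eq_mul] at h
    rw [h]; ring

theorem mu_pos {N : ℕ} (a b b' : ℝ) {x : Fin N → ℝ} (hx : x ∈ regular N) :
    0 < mu N a b b' x := by
  rw [mu_eq_exp a b b' hx]
  exact Real.exp_pos _

/-- Distinct numbers define distinct characters `k ↦ r ^ k` of the monoid of naturals, and distinct
characters are independent. -/
theorem eq_zero_of_sum_mul_pow {ι : Type*} (S : Finset ι) (r g : ι → ℂ) (hr : Set.InjOn r S)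
    (h : ∀ k : ℕ, ∑ i ∈ S, g i * r i ^ k = 0) : ∀ i ∈ S, g i = 0 := by
  have hli : LinearIndependent ℂ (fun i : S => fun k : Multiplicative ℕ => r i ^ k.toAdd) := by
    have h1 := (linearIndependent_monoidHom (Multiplicative ℕ) ℂ).comp
      (fun i : S => powersHom ℂ (r i)) (fun i j hij => by
        have := congrArg (fun f : Multiplicative ℕ →* ℂ => f (Multiplicative.ofAdd 1)) hij
        simp only [powersHom_apply, toAdd_ofAdd, pow_one] at this
        exact Subtype.ext (hr i.2 j.2 this))
    exact h1
  intro i hi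
  refine Fintype.linearIndependent_iff.1 hli (fun i => g i) (funext fun k => ?_) ⟨i, hi⟩
  rw [Finset.sum_apply]
  simp only [Pi.smul_apply, smul_eq_mul, Pi.zero_apply]
  rw [← h k.toAdd, ← Finset.sum_coe_sort S]

theorem linearIndependent_expMonomial (N : ℕ) (a b b' : ℝ) :
    LinearIndependent ℂ (expMonomial N a b b') := by
  rw [linearIndependent_iff']
  intro S g hsum
  obtain ⟨v, hv, hinj⟩ := exists_generic_ray S
  let c : (Fin N → ℤ) → ℝ := fun n => Real.exp (2 * ∑ i, (n i : ℝ) * v i)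
  have hc : Set.InjOn (fun n => (c n : ℂ)) S := fun n hn n' hn' h => by
    have h1 : c n = c n' := Complex.ofReal_injective h
    exact hinj hn hn' (mul_left_cancel₀ two_ne_zero (Real.exp_injective h1))
  -- The samples are taken at `(k + 1) v`, because the origin is singular. The extra factor `c n`
  -- moves into the coefficient and is nonzero.
  have key := eq_zero_of_sum_mul_pow S (fun n => (c n : ℂ)) (fun n => g n * c n) hc fun k => by
    have ht : ((k : ℝ) + 1) ≠ 0 := by positivity
    have hx := smul_mem_regular hv ht
    have h1 : (∑ n ∈ S, g n • expMonomial N a b b' n).1 (((k : ℝ) + 1) • v) = 0 := by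
      rw [hsum]; rfl
    rw [smoothFun_sum_val] at h1
    have h2 : ∀ n, expFun N a b b' n (((k : ℝ) + 1) • v) =
        mu N a b b' (((k : ℝ) + 1) • v) * c n ^ (k + 1) := fun n => by
      rw [expFun, ← Real.exp_nat_mul]
      congr 2
      simp only [Pi.smul_apply, smul_eq_mul, mul_left_comm _ ((k : ℝ) + 1), ← Finset.mul_sum]
      push_cast
      ring
    simp only [SmoothFun.smul_val, expMonomial_val a b b' _ hx, h2, smul_eq_mul] at h1
    have h3 : (mu N a b b' (((k : ℝ) + 1) • v) : ℂ) ≠ 0 := by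
      exact_mod_cast (mu_pos a b b' hx).ne'
    refine mul_left_cancel₀ h3 ?_
    rw [mul_zero, ← h1, Finset.mul_sum]
    refine Finset.sum_congr rfl fun n _ => ?_
    push_cast
    ring
  intro n hn
  have hne : (c n : ℂ) ≠ 0 := by exact_mod_cast (Real.exp_pos _).ne'
  exact (mul_eq_zero.1 (key n hn)).resolve_right hne

/-- The element `f_n ⊗ |s⟩` of `R_m ⊗ S`. -/
def waveMonomial {N d : ℕ} (a b b' : ℝ) (p : (Fin N → ℤ) × Spins N d) : WaveFun N d :=
  tensorSpin N d (expMonomial N a b b' p.1) (Pi.single p.2 1)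

theorem linearIndependent_waveMonomial (N d : ℕ) (a b b' : ℝ) :
    LinearIndependent ℂ (waveMonomial (N := N) (d := d) a b b') := by
  classical
  rw [linearIndependent_iff']
  intro S g hsum p hp
  let S' := S.filter fun q => q.2 = p.2
  have hinj : Set.InjOn Prod.fst (S' : Set ((Fin N → ℤ) × Spins N d)) := by
    rintro ⟨n, s⟩ h ⟨n', s'⟩ h' (rfl : n = n')
    have h1 : s = p.2 := (Finset.mem_filter.1 h).2
    have h2 : s' = p.2 := (Finset.mem_filter.1 h').2
    rw [h1, h2]
  have h1 : ∑ n ∈ S'.image Prod.fst, g (n, p.2) • expMonomial N a b b' n = 0 := by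
    refine SmoothFun.ext fun x => ?_
    have h2 : (∑ q ∈ S, g q • waveMonomial a b b' q).1 x p.2 = 0 := by rw [hsum]; rfl
    rw [smoothFun_sum_val, Finset.sum_apply] at h2
    rw [smoothFun_sum_val, Finset.sum_image hinj]
    change _ = (0 : ℂ)
    rw [← h2, Finset.sum_filter]
    refine Finset.sum_congr rfl fun q _ => ?_
    have e : (g q • waveMonomial a b b' q).1 x p.2 = g q * ((expMonomial N a b b' q.1).1 x *
        (Pi.single q.2 1 : SpinSpace N d) p.2) := rfl
    rw [e, SmoothFun.smul_val, Pi.single_apply]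
    by_cases h : q.2 = p.2
    · rw [if_pos h, if_pos h.symm, ← h]
      simp
    · rw [if_neg h, if_neg (Ne.symm h)]
      simp
  exact linearIndependent_iff'.1 (linearIndependent_expMonomial N a b b') _ _ h1 p.1
    (Finset.mem_image.2 ⟨p, Finset.mem_filter.2 ⟨hp, rfl⟩, rfl⟩)

theorem weylOp_waveMonomial {N d : ℕ} (a b b' : ℝ) (T : Finset (Fin N))
    (σ : Equiv.Perm (Fin N)) (p : (Fin N → ℤ) × Spins N d) :
    weylOp N d T σ (waveMonomial a b b' p) = waveMonomial a b b' (weylIndex T σ p) := by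
  rw [waveMonomial, weylOp_tensorSpin, waveMonomial, weylIndex]
  congr 1
  funext t
  rw [spinSign_apply, spinPerm_apply, Pi.single_apply, Pi.single_apply]
  congr 1
  rw [eq_iff_iff]
  constructor
  · intro h
    rw [← h]
    funext i
    by_cases hi : i ∈ T <;> simp [flipSpins, hi]
  · rintro rfl
    funext i
    by_cases hi : σ i ∈ T <;> simp [flipSpins, hi]

theorem antisymmetriser_waveMonomial_weylIndex {N d : ℕ} (a b b' : ℝ) (T : Finset (Fin N))
    (σ : Equiv.Perm (Fin N)) (p : (Fin N → ℤ) × Spins N d) :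
    antisymmetriser N d (waveMonomial a b b' (weylIndex T σ p)) =
      ((-1) ^ T.card * ((Equiv.Perm.sign σ : ℤ) : ℂ)) •
        antisymmetriser N d (waveMonomial a b b' p) := by
  rw [← weylOp_waveMonomial, ← Module.End.mul_apply, antisymmetriser_mul_weylOp]
  rfl

theorem mem_labels {N d m : ℕ} {p : (Fin N → ℕ) × Spins N d} :
    p ∈ labels N d m ↔ IsLabel d m p :=
  (finite_isLabel N d m).mem_toFinset

/-- Independence is checked in the free module on pairs `(n, s)`. There the orbit sum of a label
contains that label exactly once and no other label. -/
theorem linearIndependent_antisymmetriser (N d m : ℕ) (a b b' : ℝ) :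
    LinearIndependent ℂ (fun p : labels N d m =>
      antisymmetriser N d (waveMonomial a b b' (castIndex p.1))) := by
  classical
  let B : labels N d m → ((Fin N → ℤ) × Spins N d →₀ ℂ) := fun p =>
    ((2 ^ N * (N.factorial : ℂ))⁻¹) • ∑ T : Finset (Fin N), ∑ σ : Equiv.Perm (Fin N),
      ((-1) ^ T.card * ((Equiv.Perm.sign σ : ℤ) : ℂ)) •
        Finsupp.single (weylIndex T σ (castIndex p.1)) 1
  have hB : (fun p : labels N d m => antisymmetriser N d (waveMonomial a b b' (castIndex p.1))) =
      Finsupp.linearCombination ℂ (waveMonomial a b b') ∘ B := by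
    funext p
    simp only [B, Function.comp_apply, map_smul, map_sum, Finsupp.linearCombination_single,
      one_smul, antisymmetriser, LinearMap.smul_apply, LinearMap.sum_apply, weylOp_waveMonomial]
  have hmem : ∀ p : labels N d m, IsLabel d m p.1 := fun p => mem_labels.1 p.2
  rw [hB]
  refine LinearIndependent.map' ?_ _
    (LinearMap.ker_eq_bot.2 (linearIndependent_waveMonomial N d a b b'))
  have hc : ((2 ^ N * (N.factorial : ℂ))⁻¹) ≠ 0 :=
    inv_ne_zero (mul_ne_zero (by norm_num) (Nat.cast_ne_zero.2 N.factorial_ne_zero))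
  -- Only the identity carries a label to a label, so the coefficients at labels form a nonzero
  -- scalar matrix.
  have heval : ∀ p q : labels N d m, B p (castIndex q.1) =
      if p = q then ((2 ^ N * (N.factorial : ℂ))⁻¹) else 0 := by
    intro p q
    simp only [B, Finsupp.smul_apply, Finsupp.finsetSum_apply, smul_eq_mul,
      Finsupp.single_apply]
    split_ifs with h
    · subst h
      rw [Finset.sum_eq_single ∅, Finset.sum_eq_single 1]
      · rw [if_pos]
        · simp
        · refine Prod.ext (funext fun i => ?_) (funext fun i => ?_) <;>
            simp [weylIndex, flipInts, flipSpins]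
      · intro σ _ hσ
        rw [if_neg fun h => hσ (weylIndex_label_eq (hmem p) (hmem p) h).2.1, mul_zero]
      · simp
      · intro T _ hT
        refine Finset.sum_eq_zero fun σ _ => ?_
        rw [if_neg fun h => hT (weylIndex_label_eq (hmem p) (hmem p) h).1, mul_zero]
      · simp
    · rw [Finset.sum_eq_zero fun T _ => Finset.sum_eq_zero fun σ _ => by
        rw [if_neg fun h' => h (Subtype.ext (weylIndex_label_eq (hmem q) (hmem p) h').2.2),
          mul_zero], mul_zero]
  rw [Fintype.linearIndependent_iff]
  intro g hg q
  have h := DFunLike.congr_fun hg (castIndex q.1)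
  rw [Finsupp.finsetSum_apply] at h
  simp only [Finsupp.smul_apply, heval, smul_eq_mul, mul_ite, mul_zero, Finset.sum_ite_eq',
    Finset.mem_univ, if_true, Finsupp.coe_zero, Pi.zero_apply] at h
  exact (mul_eq_zero.1 h).resolve_right hc

/-! ### Straightening to labels. -/

theorem antisymmetriser_waveMonomial_eq {N d : ℕ} (a b b' : ℝ) {m : ℕ} {n : Fin N → ℤ}
    (hn : ∀ i, -(m : ℤ) ≤ n i ∧ n i ≤ m) (s : Spins N d) :
    antisymmetriser N d (waveMonomial a b b' (n, s)) = 0 ∨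
      ∃ p ∈ labels N d m, ∑ i, (p.1 i : ℤ) ^ 2 = ∑ i, n i ^ 2 ∧ ∃ c : ℂ,
        antisymmetriser N d (waveMonomial a b b' (n, s)) =
          c • antisymmetriser N d (waveMonomial a b b' (castIndex p)) := by
  obtain ⟨T, σ, n', s', h1, hanti, hties, hzero, habs⟩ := exists_weylIndex_sorted n s
  -- A pair fixed by an odd element has antisymmetrisation equal to its own negative.
  have hfix : ∀ (U : Finset (Fin N)) (τ : Equiv.Perm (Fin N)),
      (-1 : ℂ) ^ U.card * ((Equiv.Perm.sign τ : ℤ) : ℂ) = -1 →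
      weylIndex U τ (castIndex (n', s')) = castIndex (n', s') →
      antisymmetriser N d (waveMonomial a b b' (castIndex (n', s'))) = 0 := by
    intro U τ hs hf
    have := antisymmetriser_waveMonomial_weylIndex a b b' U τ (castIndex (n', s'))
    rw [hf, hs, neg_one_smul, eq_neg_iff_add_eq_zero, ← two_smul ℂ] at this
    exact (smul_eq_zero.1 this).resolve_left two_ne_zero
  have hc : ∃ c : ℂ, antisymmetriser N d (waveMonomial a b b' (n, s)) =
      c • antisymmetriser N d (waveMonomial a b b' (castIndex (n', s'))) := by
    rw [← h1, antisymmetriser_waveMonomial_weylIndex, antisymmetriser_waveMonomial_weylIndex,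
      smul_smul]
    have hne : ∀ (U : Finset (Fin N)) (τ : Equiv.Perm (Fin N)),
        (-1 : ℂ) ^ U.card * ((Equiv.Perm.sign τ : ℤ) : ℂ) ≠ 0 := fun U τ =>
      mul_ne_zero (pow_ne_zero _ (by norm_num)) (Int.cast_ne_zero.2 (Units.ne_zero _))
    exact ⟨_, (inv_smul_smul₀ (mul_ne_zero (hne ∅ σ) (hne T 1)) _).symm⟩
  obtain ⟨c, hc⟩ := hc
  by_cases hstrict : ∀ i j, n' i = n' j → i < j → s' j < s' i
  · by_cases hpos : ∀ i, n' i = 0 → d < 2 * (s' i : ℕ)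
    · refine Or.inr ⟨(n', s'), ?_, ?_, c, hc⟩
      · refine mem_labels.2 (isLabel_of_strict hanti (fun i => ?_) hstrict hpos)
        have h2 := habs i
        have h3 := abs_le.2 (hn (σ⁻¹ i))
        omega
      · simp only [habs, sq_abs]
        exact Equiv.sum_comp σ⁻¹ fun i => n i ^ 2
    · push Not at hpos
      obtain ⟨i, hi, hi'⟩ := hpos
      left
      -- The spin at `i` is both `≤ 0` and `≥ 0`, hence `0`; with entry `0` as well, the pair is
      -- fixed by the odd sign change at `i`.
      have hz := hzero i hi
      rw [hc, hfix {i} 1 (by simp) ?_, smul_zero]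
      refine Prod.ext (funext fun l => ?_) (funext fun l => ?_)
      · by_cases hl : l = i
        · subst hl; simp [weylIndex, castIndex, flipInts, hi]
        · simp [weylIndex, castIndex, flipInts, hl]
      · by_cases hl : l = i
        · subst hl
          simp only [weylIndex, castIndex, flipSpins, Finset.mem_singleton, if_true, inv_one,
            Equiv.Perm.coe_one, Function.comp_id]
          refine Fin.ext ?_
          rw [Fin.val_rev]
          omega
        · simp [weylIndex, castIndex, flipSpins, hl]
  · push Not at hstrict
    obtain ⟨i, j, hij, hlt, hle⟩ := hstrict
    left
    -- Two particles share both entry and spin, so their transposition fixes the pair: the exclusion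
    -- principle.
    have hs : s' i = s' j := le_antisymm hle (hties i j hij hlt)
    rw [hc, hfix ∅ (Equiv.swap i j) (by simp [Equiv.Perm.sign_swap hlt.ne]) ?_, smul_zero]
    have hsw : ∀ {α : Type} (f : Fin N → α), f i = f j → f ∘ Equiv.swap i j = f := by
      intro α f hf
      funext l
      by_cases h1 : l = i
      · subst h1; simp [hf]
      by_cases h2 : l = j
      · subst h2; simp [hf]
      simp [Equiv.swap_apply_of_ne_of_ne h1 h2]
    have e1 := hsw (fun l => (n' l : ℤ)) (by simp [hij])
    have e2 := hsw s' hs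
    refine Prod.ext (funext fun l => ?_) (funext fun l => ?_)
    · simpa [weylIndex, castIndex, flipInts] using congrFun e1 l
    · simpa [weylIndex, castIndex, flipSpins] using congrFun e2 l

/-! ### The spectrum -/

/-- Vectors with equal key do not mix off the diagonal, so ties may be broken arbitrarily; in the
resulting linear order the matrix is upper triangular. -/
theorem charpoly_eq_prod_of_triangular {V ι : Type*} [AddCommGroup V] [Module ℂ V]
    [FiniteDimensional ℂ V] [Fintype ι] (v : Module.Basis ι ℂ V) (f : Module.End ℂ V)
    (key : ι → ℤ) (E : ι → ℂ)
    (h : ∀ j, f (v j) - E j • v j ∈ Submodule.span ℂ (v '' {i | key i < key j})) :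
    f.charpoly = ∏ i, (Polynomial.X - Polynomial.C (E i)) := by
  let e := Fintype.equivFin ι
  let order : LinearOrder ι := LinearOrder.lift' (fun i => toLex (key i, e i))
    (fun i j hij => e.injective (Prod.ext_iff.1 (toLex.injective hij)).2)
  have hlt : ∀ i j, i < j → key i ≤ key j := fun i j hij =>
    (Prod.Lex.lt_iff.1 (show toLex (key i, e i) < toLex (key j, e j) from hij)).elim
      (fun h' => h'.le) (fun h' => h'.1.le)
  have hrepr : ∀ i j, i ≠ j → key j ≤ key i → v.repr (f (v j)) i = 0 := by
    intro i j hij hle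
    have h1 := v.repr_support_subset_of_mem_span _ (h j)
    have h2 : v.repr (f (v j) - E j • v j) i = 0 := by
      by_contra hne
      exact absurd (h1 (Finsupp.mem_support_iff.2 hne)) (not_lt.2 hle)
    simpa [Finsupp.single_apply, hij.symm] using h2
  have hdiag : ∀ j, v.repr (f (v j)) j = E j := by
    intro j
    have h1 := v.repr_support_subset_of_mem_span _ (h j)
    have h2 : v.repr (f (v j) - E j • v j) j = 0 := by
      by_contra hne
      exact absurd (h1 (Finsupp.mem_support_iff.2 hne)) (lt_irrefl (key j))
    rw [map_sub, Finsupp.sub_apply, sub_eq_zero] at h2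
    simpa using h2
  rw [← LinearMap.charpoly_toMatrix f v, Matrix.charpoly_of_isUpperTriangular]
  · simp only [LinearMap.toMatrix_apply, hdiag]
  · intro i j hij
    rw [LinearMap.toMatrix_apply]
    exact hrepr i j (ne_of_gt hij) (hlt j i hij)

/-- The antisymmetrised monomial with label `p`. -/
def labelVector {N d : ℕ} (a b b' : ℝ) (m : ℕ) (p : labels N d m) : WaveFun N d :=
  antisymmetriser N d (waveMonomial a b b' (castIndex p.1))

theorem labels_bound {N d m : ℕ} (p : labels N d m) (i : Fin N) :
    -(m : ℤ) ≤ (castIndex p.1).1 i ∧ (castIndex p.1).1 i ≤ m := by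
  have := (mem_labels.1 p.2).1.2.1 i
  simp only [castIndex]
  omega

theorem antisymmetriser_mem_spinFlag {N d : ℕ} (a b b' : ℝ) {m : ℕ} {n : Fin N → ℤ}
    (hn : ∀ i, -(m : ℤ) ≤ n i ∧ n i ≤ m) (v : SpinSpace N d) :
    antisymmetriser N d (tensorSpin N d (expMonomial N a b b' n) v) ∈
      spinFlag N d a b b' m :=
  Submodule.mem_map_of_mem (Submodule.apply_mem_map₂ _ (Submodule.subset_span ⟨n, hn, rfl⟩)
    Submodule.mem_top)

theorem spinFlag_eq_span (N d : ℕ) (a b b' : ℝ) (m : ℕ) :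
    spinFlag N d a b b' m =
      Submodule.span ℂ (Set.range (labelVector (N := N) (d := d) a b b' m)) := by
  refine le_antisymm ?_ (Submodule.span_le.2 ?_)
  · rw [spinFlag, scalarSpace, ← (Pi.basisFun ℂ (Spins N d)).span_eq, Submodule.map₂_span_span,
      Submodule.map_span, Submodule.span_le]
    rintro _ ⟨_, ⟨_, ⟨n, hn, rfl⟩, _, ⟨s, rfl⟩, rfl⟩, rfl⟩
    rw [Pi.basisFun_apply]
    rcases antisymmetriser_waveMonomial_eq (d := d) a b b' hn s with h | ⟨p, hp, -, c, h⟩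
    · exact (show antisymmetriser N d (waveMonomial a b b' (n, s)) ∈ _ by
        rw [h]; exact Submodule.zero_mem _)
    · exact (show antisymmetriser N d (waveMonomial a b b' (n, s)) ∈ _ by
        rw [h]
        exact Submodule.smul_mem _ _ (Submodule.subset_span ⟨⟨p, hp⟩, rfl⟩))
  · rintro _ ⟨p, rfl⟩
    exact antisymmetriser_mem_spinFlag a b b' (labels_bound p) _

/-- Shorter monomials need not be sorted. Straightening preserves `∑ n_i²`, so they still land on
labels strictly below `p`. -/
theorem hamiltonian_labelVector {N d : ℕ} (a b b' : ℝ) (m : ℕ) (p : labels N d m) :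
    hamiltonian N d a b b' (labelVector a b b' m p) -
        (energy a b b' p.1.1 : ℂ) • labelVector a b b' m p ∈
      Submodule.span ℂ (labelVector (N := N) (d := d) a b b' m ''
        {q | ∑ i, (q.1.1 i : ℤ) ^ 2 < ∑ i, (p.1.1 i : ℤ) ^ 2}) := by
  have hp := mem_labels.1 p.2
  obtain ⟨φ, hφ, h⟩ := antisymmetriser_hamiltonian_tensorSpin (d := d) a b b' (m := m)
    (n := fun i => (p.1.1 i : ℤ)) (fun i j hij => Nat.cast_le.2 (hp.1.1 hij))
    (fun i => Int.natCast_nonneg _) (fun i => by exact_mod_cast hp.1.2.1 i)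
  have h' := h (Pi.single p.1.2 1)
  have hval : hamiltonian N d a b b' (labelVector a b b' m p) -
      (energy a b b' p.1.1 : ℂ) • labelVector a b b' m p =
      antisymmetriser N d (tensorSpin N d φ (Pi.single p.1.2 1)) := by
    rw [energy_eq_scalarEnergy a b b' hp.1.1]
    exact sub_eq_iff_eq_add'.2 h'
  rw [hval]
  let L : SmoothFun N ℂ →ₗ[ℂ] WaveFun N d :=
    antisymmetriser N d ∘ₗ (tensorSpin N d).flip (Pi.single p.1.2 1)
  refine Submodule.mem_comap.1 ((Submodule.span_le (p := Submodule.comap L _)).2 ?_ hφ)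
  rintro _ ⟨n, hn, hlt, rfl⟩
  change antisymmetriser N d (waveMonomial a b b' (n, p.1.2)) ∈ Submodule.span ℂ _
  rcases antisymmetriser_waveMonomial_eq (d := d) a b b' hn p.1.2 with h | ⟨q, hq, hsum, c, h⟩
  · rw [h]; exact Submodule.zero_mem _
  · rw [h]
    refine Submodule.smul_mem _ _ (Submodule.subset_span ⟨⟨q, hq⟩, ?_, rfl⟩)
    simp only [Set.mem_ofPred_eq]
    rw [hsum]
    exact hlt

theorem hamiltonian_mem_spinFlag {N d : ℕ} (a b b' : ℝ) (m : ℕ) (ψ : WaveFun N d)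
    (hψ : ψ ∈ spinFlag N d a b b' m) : hamiltonian N d a b b' ψ ∈ spinFlag N d a b b' m := by
  rw [spinFlag_eq_span] at hψ ⊢
  refine Submodule.mem_comap.1
    ((Submodule.span_le (p := Submodule.comap (hamiltonian N d a b b') _)).2 ?_ hψ)
  rintro _ ⟨p, rfl⟩
  change hamiltonian N d a b b' (labelVector a b b' m p) ∈ Submodule.span ℂ _
  have h := Submodule.span_mono (Set.image_subset_range _ _) (hamiltonian_labelVector a b b' m p)
  have h2 : (energy a b b' p.1.1 : ℂ) • labelVector a b b' m p ∈
      Submodule.span ℂ (Set.range (labelVector (N := N) (d := d) a b b' m)) :=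
    Submodule.smul_mem _ _ (Submodule.subset_span ⟨p, rfl⟩)
  simpa using Submodule.add_mem _ h h2

theorem charpoly_hamiltonianOn {N d : ℕ} (a b b' : ℝ) (m : ℕ)
    (hinv : ∀ ψ ∈ spinFlag N d a b b' m, hamiltonian N d a b b' ψ ∈ spinFlag N d a b b' m) :
    (hamiltonianOn N d a b b' m hinv).charpoly =
      ∏ p ∈ labels N d m, (Polynomial.X - Polynomial.C ((energy a b b' p.1 : ℝ) : ℂ)) := by
  have hmem : ∀ p, labelVector (N := N) (d := d) a b b' m p ∈ spinFlag N d a b b' m := fun p => by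
    rw [spinFlag_eq_span]
    exact Submodule.subset_span ⟨p, rfl⟩
  let w : labels N d m → spinFlag N d a b b' m := fun p => ⟨labelVector a b b' m p, hmem p⟩
  have hli : LinearIndependent ℂ w := by
    refine LinearIndependent.of_comp (spinFlag N d a b b' m).subtype ?_
    exact linearIndependent_antisymmetriser N d m a b b'
  -- Moves span membership from the ambient space of wave functions into the invariant subspace,
  -- where the basis lives.
  have hmap : ∀ (s : Set (labels N d m)) (x : spinFlag N d a b b' m),
      (x : WaveFun N d) ∈ Submodule.span ℂ (labelVector a b b' m '' s) →
      x ∈ Submodule.span ℂ (w '' s) := by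
    intro s x hx
    have h1 : labelVector (N := N) (d := d) a b b' m '' s =
        (spinFlag N d a b b' m).subtype '' (w '' s) := by
      rw [Set.image_image]; rfl
    rw [h1, ← Submodule.map_span] at hx
    obtain ⟨y, hy, hyx⟩ := hx
    rwa [← Subtype.ext hyx]
  let v := Module.Basis.mk hli fun x _ => by
    rw [← Set.image_univ]
    refine hmap _ x ?_
    rw [Set.image_univ, ← spinFlag_eq_span]
    exact x.2
  rw [charpoly_eq_prod_of_triangular v _ (fun p => ∑ i, (p.1.1 i : ℤ) ^ 2)
    (fun p => ((energy a b b' p.1.1 : ℝ) : ℂ)) fun p => ?_]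
  · exact Finset.prod_coe_sort (labels N d m)
      fun p => Polynomial.X - Polynomial.C ((energy a b b' p.1 : ℝ) : ℂ)
  · rw [Module.Basis.coe_mk]
    exact hmap _ _ (hamiltonian_labelVector a b b' m p)

end SutherlandBN

end

theorem mainTheorem2 (N d : ℕ) (a b b' : ℝ) (m₁ : ℕ)
    (hm₁ : IsGreatest {m : ℕ | (b + b') / 2 + a * ((N : ℝ) - 1) + (m : ℝ) < 0} m₁)
    (hm : SutherlandBN.mZero N d ≤ (m₁ : ℤ)) :
    ∃ hinv : ∀ ψ ∈ SutherlandBN.spinFlag N d a b b' m₁,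
        SutherlandBN.hamiltonian N d a b b' ψ ∈ SutherlandBN.spinFlag N d a b b' m₁,
      (∀ E : ℂ,
        Module.End.HasEigenvalue (SutherlandBN.hamiltonianOn N d a b b' m₁ hinv) E ↔
          ∃ n : Fin N → ℕ, SutherlandBN.Admissible d m₁ n ∧
            E = ((SutherlandBN.energy a b b' n : ℝ) : ℂ)) ∧
      (SutherlandBN.hamiltonianOn N d a b b' m₁ hinv).charpoly =
        ∏ p ∈ SutherlandBN.labels N d m₁,
          (Polynomial.X - Polynomial.C ((SutherlandBN.energy a b b' p.1 : ℝ) : ℂ)) := by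
  refine ⟨SutherlandBN.hamiltonian_mem_spinFlag a b b' m₁, fun E => ?_,
    SutherlandBN.charpoly_hamiltonianOn a b b' m₁ _⟩
  rw [Module.End.hasEigenvalue_iff_isRoot_charpoly, SutherlandBN.charpoly_hamiltonianOn,
    Polynomial.isRoot_prod]
  simp only [Polynomial.root_X_sub_C]
  constructor
  · rintro ⟨p, hp, rfl⟩
    exact ⟨p.1, (SutherlandBN.mem_labels.1 hp).1, rfl⟩
  · rintro ⟨n, hn, rfl⟩
    -- The product runs over pairs `(n, s)`, so an admissible `n` gives a root only because some
    -- spin configuration completes it.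
    obtain ⟨s, hs⟩ := SutherlandBN.exists_isLabel hn
    exact ⟨(n, s), SutherlandBN.mem_labels.2 hs, rfl⟩
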